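/- Throughout, $(x)_n=x(x+1)\cdots(x+n-1)$, $1/\Gamma$ denotes the entire reciprocal Gamma function, $H_m^{(s)}=\sum_{j=1}^m j^{-s}$, $H_m=H_m^{(1)}$. For $a,b,c,d\in\mathbb C$ and integers $n,k\ge 0$ put $$F(n,k)=\frac{\begin{gathered}(-1)^n(2d+2k+1)\,2^{-2(2a+b+c+2n)}\,\Gamma(-a-b-n+1)\,\Gamma(a+2b+c+n+\tfrac12)\,\Gamma(a+b+2c+n+\tfrac12)\\ \times\,\Gamma(-a+d+k-n+1)\,\Gamma(a+b+2d+2k+n+\tfrac12)\,\Gamma(a+c+2d+2k+n+\tfrac12)\,\Gamma(-a-b-c+d+k-n+1)\end{gathered}}{\begin{gathered}\Gamma(-a+b-n+\tfrac12)\,\Gamma(-a+c-n+\tfrac12)\,\Gamma(a+c+n)\,\Gamma(2a+b+c+2n-1)\,\Gamma(a+d+k+n+1)\\ \times\,\Gamma(-a-b+2d+2k-n+\tfrac52)\,\Gamma(-a-c+2d+2k-n+\tfrac52)\,\Gamma(a+b+c+d+k+n+1)\end{gathered}}$$ $$L=\tfrac18\cos(\pi(a-b))\csc(\pi(a+b))\cos(\pi(a-c))\csc(\pi(a-d))\csc(\pi(a+b+c-d)).$$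 Put further $$A(k)=\frac{(2d+2k+1)(-a+d+1)_k(a+b+2d+\frac12)_{2k}(a+c+2d+\frac12)_{2k}(-a-b-c+d+1)_k}{(a+d+1)_k(a+b+c+d+1)_k(-a-b+2d+\frac12)_{2k+2}(-a-c+2d+\frac12)_{2k+2}},$$ $$B_1=\frac{2^{4a+2b+2c-4}\,\Gamma(a+d+1)\Gamma(-a-b+2d+\frac12)\Gamma(-a-c+2d+\frac12)\Gamma(a+b+c+d+1)}{(a+b)(a+c)(2a+b+c-1)(2a+b+c)\Gamma(-a+d+1)\Gamma(a+b+2d+\frac12)\Gamma(a+c+2d+\frac12)\Gamma(-a-b-c+d+1)},$$ $$B_2(n)=\frac{Q(n)\,(a-b+\frac12)_n(a-c+\frac12)_n(a+2b+c+\frac12)_n(a+b+2c+\frac12)_n}{(2a+b+c+2n+1)(a+b+1)_n(a+c+1)_n(2a+b+c+1)_{2n}},$$ $$Q(n)=12a^2+12ab+12ac+24an+8a-4bc+12bn+4b+12cn+4c+12n^2+8n+1,$$ $$D=\frac{\begin{gathered}2^{-2(2a+b+c)}(2a+b+c-1)\Gamma(-a-b+1)\Gamma(-a+d+1)\Gamma(a+2b+c+\tfrac12)\Gamma(a+b+2c+\tfrac12)\\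 \times\,\Gamma(a+b+2d+\tfrac12)\Gamma(a+c+2d+\tfrac12)\Gamma(-a-b-c+d+1)\end{gathered}}{\begin{gathered}\Gamma(-a+b+\tfrac12)\Gamma(-a+c+\tfrac12)\Gamma(a+c)\Gamma(a+d+1)\Gamma(2a+b+c)\\ \times\,\Gamma(-a-b+2d+\tfrac12)\Gamma(-a-c+2d+\tfrac12)\Gamma(a+b+c+d+1)\end{gathered}},$$ $$C(n)=\frac{\begin{gathered}-2^{-4n-8}(a-b+\tfrac12)_n(a-c+\tfrac12)_n(a+2b+c+\tfrac12)_n(a+b+2c+\tfrac12)_n\\ \times\,(a+b-2d+\tfrac12)_n(a+b+2d+\tfrac12)_n(a+c-2d+\tfrac12)_n(a+c+2d+\tfrac12)_n\,P(n)\end{gathered}}{\begin{gathered}(a+b)(a+c)(a-d)(2a+b+c-1)(2a+b+c)(a+b+c-d)(2a+b+c+2n+1)(a+b+1)_n(a+c+1)_n\\ \times\,(a-d+1)_n(a+d+1)_n(2a+b+c+1)_{2n}(a+b+c-d+1)_n(a+b+c+d+1)_n\end{gathered}},$$ where, with $s=a+n$, $$\begin{aligned}P(n)={}&336s^4+(672(b+c)+320)s^3+(432b^2+960bc+432c^2-192d^2+480(b+c)+104)s^2\\&+(96b^3+384b^2c+384bc^2+96c^3-192(b+c)d^2+192b^2+448bc+192c^2-128d^2+104(b+c)+16)s\\&+32b^3c+80b^2c^2+32bc^3+64bcd^2+16b^3+80b^2c+80bc^2+16c^3-64(b+c)d^2+20b^2+48bc+20c^2-16d^2+8(b+c)+1.\end{aligned}$$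 Finally let (reading $(-1)^b=e^{\pi i b}$) $$\mathrm{Seed9}(a,b,e,k)=\frac{\begin{gathered}(-1)^b\,2(a+2k)\,2^{4a-2b-2e}\,\Gamma(a-b+\tfrac12)\Gamma(a+k)\Gamma(b+2k)\Gamma(e+2k)\Gamma(2a-b-e+1)\\ \times\,\Gamma(-2a+2b+e+1)\Gamma(-2a+b+2e+1)\Gamma(2a-b-e+k)\end{gathered}}{\begin{gathered}\Gamma(b)\Gamma(e)\Gamma(k+1)\Gamma(-a+e+\tfrac12)\Gamma(2a-b-e)\Gamma(-2a+b+e+1)\\ \times\,\Gamma(2a-b+2k+1)\Gamma(2a-e+2k+1)\Gamma(-a+b+e+k+1)\end{gathered}}.$$ **Claim.** There is a neighbourhood of $0\in\mathbb C^4$ such that for all $(a,b,c,d)$ in it with $a+b$, $a-d$, $a+b+c-d$ nonzero, the following hold. (1) $\sum_{k\ge0}F(n,k)$ converges absolutely for every $n\ge0$, and $\displaystyle\lim_{n\to\infty}\sum_{k\ge0}F(n,k)=L$. (2) If moreover $a+c\ne0$ and $2a+b+c\ne0$, then: - for all $n,k\ge0$, $F(n,k)=-\tfrac18e^{-\pi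 i(-a+b+1/2)}\,\mathrm{Seed9}(1-2(a+n),\,-a+b-n+\tfrac12,\,-a+c-n+\tfrac12,\,a+d+k+n)$; - there is $G:\mathbb N^2\to\mathbb C$ with $F(n+1,k)-F(n,k)=G(n,k+1)-G(n,k)$, and $F(0,k)=D\,A(k)$, $G(n,0)=D\,C(n)$, $\lim_{k\to\infty}G(n,k)=D\,B_1B_2(n)$ for all $n,k\ge 0$; - $D\ne0$, the series $\sum_k A(k)$, $\sum_n B_2(n)$, $\sum_n C(n)$ converge absolutely, and $$\sum_{k\ge0}A(k)+B_1\sum_{n\ge0}B_2(n)=\sum_{n\ge0}C(n)+\frac{L}{D}.$$ (3) With $a_n=2^{-6n}\dfrac{(1/2)_n^7}{(1)_n^7}$ and $p_n=168n^3+76n^2+14n+1$, $$\begin{aligned}\sum_{n\ge0}a_np_n&=\frac{32}{\pi^3},\\ \sum_{n\ge0}a_n\left[7p_n(H_{2n}-H_n)+252n^2+76n+7\right]&=\frac{320\log2}{\pi^3},\\ \sum_{n\ge0}a_n\left[p_n(16H^{(2)}_{2n}-5H^{(2)}_n)+48n+8\right]&=\frac{80}{3\pi},\\ \sum_{n\ge0}a_n\left[p_n(128H^{(4)}_{2n}-7H^{(4)}_n)+\frac{64}{2n+1}\right]&=\frac{976\pi}{45},\end{aligned}$$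 all four series converging absolutely. -/

import Mathlib

noncomputable section

namespace Seed9

/-- The Pochhammer symbol `(x)_n = x (x + 1) ⋯ (x + n - 1)`. -/
def poch (x : ℂ) (n : ℕ) : ℂ := (ascPochhammer ℂ n).eval x

/-- The classical WZ-seed `Seed9(a, b, e, k)` (the limit `q → 1` of its `q`-version); the factor
`(-1)^b` is read as `exp(π i b)`. -/
def seed9 (a b e k : ℂ) : ℂ :=
  (Complex.exp (Real.pi * Complex.I * b) * (2 * (a + 2 * k)) * 2 ^ (4 * a - 2 * b - 2 * e)
      * Complex.Gamma (a - b + 1 / 2) * Complex.Gamma (a + k) * Complex.Gamma (b + 2 * k)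
      * Complex.Gamma (e + 2 * k) * Complex.Gamma (2 * a - b - e + 1)
      * Complex.Gamma (-2 * a + 2 * b + e + 1) * Complex.Gamma (-2 * a + b + 2 * e + 1)
      * Complex.Gamma (2 * a - b - e + k))
    / (Complex.Gamma b * Complex.Gamma e * Complex.Gamma (k + 1)
      * Complex.Gamma (-a + e + 1 / 2) * Complex.Gamma (2 * a - b - e)
      * Complex.Gamma (-2 * a + b + e + 1) * Complex.Gamma (2 * a - b + 2 * k + 1)
      * Complex.Gamma (2 * a - e + 2 * k + 1) * Complex.Gamma (-a + b + e + k + 1))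

/-- The function `F(n, k)`. Since `Complex.Gamma` vanishes at the poles of the Gamma function, a
Gamma factor at a pole in the denominator makes the quotient `0`, the value of the entire
function `1 / Γ`. -/
def F (a b c d : ℂ) (n k : ℕ) : ℂ :=
  ((-1) ^ n * (2 * d + 2 * k + 1) * 2 ^ (-2 * (2 * a + b + c + 2 * n))
      * Complex.Gamma (-a - b - n + 1) * Complex.Gamma (a + 2 * b + c + n + 1 / 2)
      * Complex.Gamma (a + b + 2 * c + n + 1 / 2) * Complex.Gamma (-a + d + k - n + 1)
      * Complex.Gamma (a + b + 2 * d + 2 * k + n + 1 / 2)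
      * Complex.Gamma (a + c + 2 * d + 2 * k + n + 1 / 2)
      * Complex.Gamma (-a - b - c + d + k - n + 1))
    / (Complex.Gamma (-a + b - n + 1 / 2) * Complex.Gamma (-a + c - n + 1 / 2)
      * Complex.Gamma (a + c + n) * Complex.Gamma (2 * a + b + c + 2 * n - 1)
      * Complex.Gamma (a + d + k + n + 1)
      * Complex.Gamma (-a - b + 2 * d + 2 * k - n + 5 / 2)
      * Complex.Gamma (-a - c + 2 * d + 2 * k - n + 5 / 2)
      * Complex.Gamma (a + b + c + d + k + n + 1))

/-- The summand `A(k)`. -/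
def A (a b c d : ℂ) (k : ℕ) : ℂ :=
  ((2 * d + 2 * k + 1) * poch (-a + d + 1) k * poch (a + b + 2 * d + 1 / 2) (2 * k)
      * poch (a + c + 2 * d + 1 / 2) (2 * k) * poch (-a - b - c + d + 1) k)
    / (poch (a + d + 1) k * poch (a + b + c + d + 1) k
      * poch (-a - b + 2 * d + 1 / 2) (2 * k + 2) * poch (-a - c + 2 * d + 1 / 2) (2 * k + 2))

/-- The factor `B₁`. -/
def B₁ (a b c d : ℂ) : ℂ :=
  (2 ^ (4 * a + 2 * b + 2 * c - 4) * Complex.Gamma (a + d + 1)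
      * Complex.Gamma (-a - b + 2 * d + 1 / 2) * Complex.Gamma (-a - c + 2 * d + 1 / 2)
      * Complex.Gamma (a + b + c + d + 1))
    / ((a + b) * (a + c) * (2 * a + b + c - 1) * (2 * a + b + c)
      * Complex.Gamma (-a + d + 1) * Complex.Gamma (a + b + 2 * d + 1 / 2)
      * Complex.Gamma (a + c + 2 * d + 1 / 2) * Complex.Gamma (-a - b - c + d + 1))

/-- The summand `B₂(n)`. -/
def B₂ (a b c : ℂ) (n : ℕ) : ℂ :=
  ((12 * a ^ 2 + 12 * a * b + 12 * a * c + 24 * a * n + 8 * a - 4 * b * c + 12 * b * n + 4 * b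
        + 12 * c * n + 4 * c + 12 * n ^ 2 + 8 * n + 1)
      * poch (a - b + 1 / 2) n * poch (a - c + 1 / 2) n
      * poch (a + 2 * b + c + 1 / 2) n * poch (a + b + 2 * c + 1 / 2) n)
    / ((2 * a + b + c + 2 * n + 1) * poch (a + b + 1) n * poch (a + c + 1) n
      * poch (2 * a + b + c + 1) (2 * n))

/-- The Gamma factor `D`. -/
def D (a b c d : ℂ) : ℂ :=
  (2 ^ (-2 * (2 * a + b + c)) * (2 * a + b + c - 1)
      * Complex.Gamma (-a - b + 1) * Complex.Gamma (-a + d + 1)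
      * Complex.Gamma (a + 2 * b + c + 1 / 2) * Complex.Gamma (a + b + 2 * c + 1 / 2)
      * Complex.Gamma (a + b + 2 * d + 1 / 2) * Complex.Gamma (a + c + 2 * d + 1 / 2)
      * Complex.Gamma (-a - b - c + d + 1))
    / (Complex.Gamma (-a + b + 1 / 2) * Complex.Gamma (-a + c + 1 / 2) * Complex.Gamma (a + c)
      * Complex.Gamma (a + d + 1) * Complex.Gamma (2 * a + b + c)
      * Complex.Gamma (-a - b + 2 * d + 1 / 2) * Complex.Gamma (-a - c + 2 * d + 1 / 2)
      * Complex.Gamma (a + b + c + d + 1))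

/-- The polynomial `P(n) ∈ ℤ[a, b, c, d, n]`, written in powers of `s = a + n`. At
`a = b = c = d = 0` it is `(2n + 1)(168n³ + 76n² + 14n + 1)`. -/
def P (a b c d : ℂ) (n : ℕ) : ℂ :=
  336 * (a + n) ^ 4
    + (672 * (b + c) + 320) * (a + n) ^ 3
    + (432 * b ^ 2 + 960 * b * c + 432 * c ^ 2 - 192 * d ^ 2 + 480 * (b + c) + 104) * (a + n) ^ 2
    + (96 * b ^ 3 + 384 * b ^ 2 * c + 384 * b * c ^ 2 + 96 * c ^ 3 - 192 * (b + c) * d ^ 2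
        + 192 * b ^ 2 + 448 * b * c + 192 * c ^ 2 - 128 * d ^ 2 + 104 * (b + c) + 16) * (a + n)
    + (32 * b ^ 3 * c + 80 * b ^ 2 * c ^ 2 + 32 * b * c ^ 3 + 64 * b * c * d ^ 2
        + 16 * b ^ 3 + 80 * b ^ 2 * c + 80 * b * c ^ 2 + 16 * c ^ 3 - 64 * (b + c) * d ^ 2
        + 20 * b ^ 2 + 48 * b * c + 20 * c ^ 2 - 16 * d ^ 2 + 8 * (b + c) + 1)

/-- The summand `C(n)`. -/
def C (a b c d : ℂ) (n : ℕ) : ℂ :=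
  (-(2 : ℂ) ^ (-4 * (n : ℤ) - 8)
      * poch (a - b + 1 / 2) n * poch (a - c + 1 / 2) n
      * poch (a + 2 * b + c + 1 / 2) n * poch (a + b + 2 * c + 1 / 2) n
      * poch (a + b - 2 * d + 1 / 2) n * poch (a + b + 2 * d + 1 / 2) n
      * poch (a + c - 2 * d + 1 / 2) n * poch (a + c + 2 * d + 1 / 2) n * P a b c d n)
    / ((a + b) * (a + c) * (a - d) * (2 * a + b + c - 1) * (2 * a + b + c) * (a + b + c - d)
      * (2 * a + b + c + 2 * n + 1) * poch (a + b + 1) n * poch (a + c + 1) n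
      * poch (a - d + 1) n * poch (a + d + 1) n * poch (2 * a + b + c + 1) (2 * n)
      * poch (a + b + c - d + 1) n * poch (a + b + c + d + 1) n)

/-- `(1/8) cos π(a-b) csc π(a+b) cos π(a-c) csc π(a-d) csc π(a+b+c-d)`. -/
def limitValue (a b c d : ℂ) : ℂ :=
  1 / 8 * Complex.cos (Real.pi * (a - b)) * (Complex.sin (Real.pi * (a + b)))⁻¹
    * Complex.cos (Real.pi * (a - c)) * (Complex.sin (Real.pi * (a - d)))⁻¹
    * (Complex.sin (Real.pi * (a + b + c - d)))⁻¹

/-- `a_n = 2^{-6n} (1/2)_n⁷ / (1)_n⁷`. -/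
def coeff (n : ℕ) : ℝ :=
  1 / 2 ^ (6 * n) * ((ascPochhammer ℝ n).eval (1 / 2) ^ 7 / (ascPochhammer ℝ n).eval 1 ^ 7)

/-- `p_n = 168n³ + 76n² + 14n + 1`. -/
def p (n : ℕ) : ℝ := 168 * (n : ℝ) ^ 3 + 76 * (n : ℝ) ^ 2 + 14 * n + 1

/-- The harmonic number `H_n^{(s)} = ∑_{j=1}^n 1/j^s`. -/
def H (s n : ℕ) : ℝ := ∑ j ∈ Finset.Icc 1 n, 1 / (j : ℝ) ^ s

end Seed9

end

/-! ### The regularized WZ pair. -/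

noncomputable section
namespace Seed9

/-! Reflecting the three numerator Gammas of `F` that can meet poles near the origin, and the two
reciprocal Gammas with arguments near `1/2 - n`, gives `F(n,k) = 8π L Φ(a+n,b,c,d+k)`
(`Generic.F_eq`). In `Phi` the numerator Gammas stay in the right half plane and every other Gamma
occurs as the entire function `1/Γ`. So `Phi` is still meaningful on `a = d`, where `L` has a pole.
`Phi` and `Psi` form a WZ pair: both sides of the equation are one Gamma product times polynomials
(`wz_polynomial_identity`).

The analytic core is that `∑_k Φ(a+n,b,c,d+k)` tends to `1/(8π)` whatever the parameters are
(`tendsto_tsum_Phi`). With `x = k/n`, the modulus of the quotient of consecutive kernel values is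
close to the square of `|1-x|(1+2x)² / ((1+x)(2x-1)²)`, which crosses `1` at `x = √3/2`. Near this
peak `Γ(z+m) ~ Γ(m) m^z` shows that `Phi` is asymptotic to a positive model free of the parameters
(`tendsto_Phi_div_modelPhi`). Away from it the terms are negligible (`far_bound`); extra care is
needed as `x → 0` and `x → ∞`, where the quotient returns to `1`. Hence all row sums have the same
limit, and one explicit case decides it. At `(1/4, -1/4, 1/4, 1/4)` the rows are finite sums of
nonnegative reals, and WZ telescoping gives exactly `1/(8π)` for every `n ≥ 1` (`hasSum_Phi_ref`).

Summing the WZ equation over `k`, then over `n`, with the boundary values of `F` and `G`, gives the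
four-variable identity (`Generic.tsum_identity`).

For the harmonic sums, put `d = a`. Then `Φ(a+n,b,c,a+k)` vanishes for `k ≥ n`, the row sums are
partial sums of `-Ψ(a+m,b,c,a)`, and their limit evaluates a single series: `∑ term(a,b,c,a) = 32/(π
gammaQuot)` (`Small.hasSum_term`). The origin gives `32/π³`. The first derivative along `(t,0,0,t)`
gives the `H^{(1)}` sum, the coefficient of `u²` along `(0,u,-u,0)` the `H^{(2)}` sum, and the
coefficient of `t⁴` along `(t,-t+2it,-t-2it,t)` the `H^{(4)}` sum. -/

/-- The product of the powers of two and the six Gamma values in the numerators of the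
regularized WZ-pair. -/
def gammaNum (a b c d : ℂ) : ℂ :=
  2 ^ (-2 * (2 * a + b + c))
    * (Complex.Gamma (a + 2 * b + c + 1 / 2) * Complex.Gamma (a + b + 2 * c + 1 / 2)
      * Complex.Gamma (a - b + 1 / 2) * Complex.Gamma (a - c + 1 / 2)
      * Complex.Gamma (a + b + 2 * d + 1 / 2) * Complex.Gamma (a + c + 2 * d + 1 / 2))

/-- `Φ(a, b, c, d) / (2 d + 1)`, the hypergeometric kernel of the regularized WZ-pair. -/
def kern (a b c d : ℂ) : ℂ :=
  gammaNum a b c d * ((Complex.Gamma (a + b))⁻¹ * (Complex.Gamma (a + c))⁻¹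
    * (Complex.Gamma (2 * a + b + c - 1))⁻¹ * (Complex.Gamma (a + d + 1))⁻¹
    * (Complex.Gamma (a + b + c + d + 1))⁻¹ * (Complex.Gamma (a - d))⁻¹
    * (Complex.Gamma (a + b + c - d))⁻¹ * (Complex.Gamma (-a - b + 2 * d + 5 / 2))⁻¹
    * (Complex.Gamma (-a - c + 2 * d + 5 / 2))⁻¹)

/-- The first function of the regularized WZ-pair. -/
def Phi (a b c d : ℂ) : ℂ := (2 * d + 1) * kern a b c d

/-- The second function of the regularized WZ-pair, without its polynomial factor. -/
def psi (a b c d : ℂ) : ℂ :=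
  -(1 / 256) * gammaNum a b c d * ((Complex.Gamma (a + b + 1))⁻¹ * (Complex.Gamma (a + c + 1))⁻¹
    * (Complex.Gamma (2 * a + b + c + 2))⁻¹ * (Complex.Gamma (a + d + 1))⁻¹
    * (Complex.Gamma (a + b + c + d + 1))⁻¹ * (Complex.Gamma (a - d + 1))⁻¹
    * (Complex.Gamma (a + b + c - d + 1))⁻¹ * (Complex.Gamma (-a - b + 2 * d + 1 / 2))⁻¹
    * (Complex.Gamma (-a - c + 2 * d + 1 / 2))⁻¹)

/-- The second function of the regularized WZ-pair. -/
def Psi (a b c d : ℂ) : ℂ := P a b c d 0 * psi a b c d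

/-- The numerator Gamma arguments lie in the right half plane. -/
structure Admissible (a b c d : ℂ) : Prop where
  h₁ : 0 < (a + 2 * b + c + 1 / 2).re
  h₂ : 0 < (a + b + 2 * c + 1 / 2).re
  h₃ : 0 < (a - b + 1 / 2).re
  h₄ : 0 < (a - c + 1 / 2).re
  h₅ : 0 < (a + b + 2 * d + 1 / 2).re
  h₆ : 0 < (a + c + 2 * d + 1 / 2).re

/-- Each numerator argument has nonnegative coefficients in `a` and `d`, so one-step recurrences can
be iterated over the whole lattice. -/
theorem Admissible.add_nat {a b c d : ℂ} (h : Admissible a b c d) (n k : ℕ) :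
    Admissible (a + n) b c (d + k) := by
  obtain ⟨h₁, h₂, h₃, h₄, h₅, h₆⟩ := h
  have hn : (0 : ℝ) ≤ n := n.cast_nonneg
  have hk : (0 : ℝ) ≤ k := k.cast_nonneg
  constructor <;> simp at * <;> linarith

/-- No hypothesis on `z`: `Complex.Gamma` is `0` at its poles, so its inverse is the entire function
`1/Γ` everywhere. -/
theorem inv_Gamma (z : ℂ) : (Complex.Gamma z)⁻¹ = z * (Complex.Gamma (z + 1))⁻¹ :=
  Complex.one_div_Gamma_eq_self_mul_one_div_Gamma_add_one z

theorem inv_Gamma' {z w : ℂ} (h : w = z + 1) :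
    (Complex.Gamma z)⁻¹ = z * (Complex.Gamma w)⁻¹ := by
  rw [h]; exact inv_Gamma z

theorem Gamma_succ' {z w : ℂ} (hz : 0 < z.re) (h : w = z + 1) :
    Complex.Gamma w = z * Complex.Gamma z := by
  rw [h]; exact Complex.Gamma_add_one z (by rintro rfl; simp at hz)

theorem re_add_one_pos {z : ℂ} (hz : 0 < z.re) : 0 < (z + 1).re := by
  simp; linarith

theorem two_cpow_shift (s : ℂ) : (2 : ℂ) ^ (-2 * (s + 2)) = 2 ^ (-2 * s) * (1 / 16) := by
  rw [show -2 * (s + 2) = -2 * s + ((-4 : ℤ) : ℂ) by push_cast; ring,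
    Complex.cpow_add _ _ two_ne_zero, Complex.cpow_intCast]
  norm_num

theorem gammaNum_succ_left {a b c d : ℂ} (h : Admissible a b c d) :
    gammaNum (a + 1) b c d = gammaNum a b c d * (1 / 16 * ((a + 2 * b + c + 1 / 2)
      * (a + b + 2 * c + 1 / 2) * (a - b + 1 / 2) * (a - c + 1 / 2) * (a + b + 2 * d + 1 / 2)
      * (a + c + 2 * d + 1 / 2))) := by
  unfold gammaNum
  rw [show 2 * (a + 1) + b + c = 2 * a + b + c + 2 by ring, two_cpow_shift,
    Gamma_succ' h.h₁ (w := a + 1 + 2 * b + c + 1 / 2) (by ring),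
    Gamma_succ' h.h₂ (w := a + 1 + b + 2 * c + 1 / 2) (by ring),
    Gamma_succ' h.h₃ (w := a + 1 - b + 1 / 2) (by ring),
    Gamma_succ' h.h₄ (w := a + 1 - c + 1 / 2) (by ring),
    Gamma_succ' h.h₅ (w := a + 1 + b + 2 * d + 1 / 2) (by ring),
    Gamma_succ' h.h₆ (w := a + 1 + c + 2 * d + 1 / 2) (by ring)]
  ring

theorem gammaNum_succ_right {a b c d : ℂ} (h : Admissible a b c d) :
    gammaNum a b c (d + 1) = gammaNum a b c d * ((a + b + 2 * d + 1 / 2) * (a + b + 2 * d + 3 / 2)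
      * (a + c + 2 * d + 1 / 2) * (a + c + 2 * d + 3 / 2)) := by
  unfold gammaNum
  rw [Gamma_succ' (re_add_one_pos h.h₅) (w := a + b + 2 * (d + 1) + 1 / 2) (by ring),
    Gamma_succ' (re_add_one_pos h.h₆) (w := a + c + 2 * (d + 1) + 1 / 2) (by ring),
    Gamma_succ' h.h₅ rfl, Gamma_succ' h.h₆ rfl]
  ring

/-- What remains of the WZ equation once the common Gamma product is divided out; `P` is the
certificate that makes it hold. -/
theorem wz_polynomial_identity (a b c d : ℂ) :
    (1 / 16 * ((a + 2 * b + c + 1 / 2)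
      * (a + b + 2 * c + 1 / 2) * (a - b + 1 / 2) * (a - c + 1 / 2) * (a + b + 2 * d + 1 / 2)
      * (a + c + 2 * d + 1 / 2))) * (2 * d + 1) * (2 * a + b + c + 1) * (-a - b + 2 * d + 3 / 2)
      * (-a - c + 2 * d + 3 / 2)
      - (2 * d + 1) * (a + b) * (a + c) * (2 * a + b + c - 1) * (2 * a + b + c)
      * (2 * a + b + c + 1) * (a + d + 1) * (a + b + c + d + 1) * (a - d) * (a + b + c - d)
      = -(1 / 256) * (P a b c (d + 1) 0 * (a + b + 2 * d + 1 / 2) * (a + b + 2 * d + 3 / 2)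
      * (a + c + 2 * d + 1 / 2) * (a + c + 2 * d + 3 / 2) * (a - d) * (a + b + c - d))
      + 1 / 256 * (P a b c d 0 * (a + d + 1) * (a + b + c + d + 1) * (-a - b + 2 * d + 1 / 2)
      * (-a - b + 2 * d + 3 / 2) * (-a - c + 2 * d + 1 / 2) * (-a - c + 2 * d + 3 / 2)) := by
  unfold P
  push_cast
  ring

/-- The regularized WZ-equation. -/
theorem Phi_sub_Phi {a b c d : ℂ} (h : Admissible a b c d) :
    Phi (a + 1) b c d - Phi a b c d = Psi a b c (d + 1) - Psi a b c d := by
  unfold Phi kern Psi psi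
  rw [gammaNum_succ_left h, gammaNum_succ_right h]
  -- Every reciprocal Gamma is moved up to the largest shift occurring in its family, so that all
  -- four terms share the same nine factors.
  rw [inv_Gamma' (z := a + b) rfl, inv_Gamma' (z := a + c) rfl,
    inv_Gamma' (z := 2 * a + b + c - 1) (w := 2 * a + b + c) (by ring),
    inv_Gamma' (z := 2 * a + b + c) rfl,
    inv_Gamma' (z := 2 * a + b + c + 1) (w := 2 * a + b + c + 2) (by ring),
    inv_Gamma' (z := a + d + 1) (w := a + d + 2) (by ring),
    inv_Gamma' (z := a + b + c + d + 1) (w := a + b + c + d + 2) (by ring),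
    inv_Gamma' (z := a - d) rfl, inv_Gamma' (z := a + b + c - d) rfl,
    inv_Gamma' (z := -a - b + 2 * d + 1 / 2) (w := -a - b + 2 * d + 3 / 2) (by ring),
    inv_Gamma' (z := -a - b + 2 * d + 3 / 2) (w := -a - b + 2 * d + 5 / 2) (by ring),
    inv_Gamma' (z := -a - c + 2 * d + 1 / 2) (w := -a - c + 2 * d + 3 / 2) (by ring),
    inv_Gamma' (z := -a - c + 2 * d + 3 / 2) (w := -a - c + 2 * d + 5 / 2) (by ring),
    show a + 1 + b = a + b + 1 by ring, show a + 1 + c = a + c + 1 by ring,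
    show 2 * (a + 1) + b + c - 1 = 2 * a + b + c + 1 by ring,
    inv_Gamma' (z := 2 * a + b + c + 1) (w := 2 * a + b + c + 2) (by ring),
    show a + 1 + d + 1 = a + d + 2 by ring, show a + b + 1 + c + d + 1 = a + b + c + d + 2 by ring,
    show a + 1 - d = a - d + 1 by ring, show a + b + 1 + c - d = a + b + c - d + 1 by ring,
    show -(a + 1) - b + 2 * d + 5 / 2 = -a - b + 2 * d + 3 / 2 by ring,
    show -(a + 1) - c + 2 * d + 5 / 2 = -a - c + 2 * d + 3 / 2 by ring,
    inv_Gamma' (z := -a - b + 2 * d + 3 / 2) (w := -a - b + 2 * d + 5 / 2) (by ring),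
    inv_Gamma' (z := -a - c + 2 * d + 3 / 2) (w := -a - c + 2 * d + 5 / 2) (by ring),
    show a + (d + 1) + 1 = a + d + 2 by ring,
    show a + b + c + (d + 1) + 1 = a + b + c + d + 2 by ring,
    show a - (d + 1) + 1 = a - d by ring,
    show a + b + c - (d + 1) + 1 = a + b + c - d by ring,
    show -a - b + 2 * (d + 1) + 1 / 2 = -a - b + 2 * d + 5 / 2 by ring,
    show -a - c + 2 * (d + 1) + 1 / 2 = -a - c + 2 * d + 5 / 2 by ring,
    inv_Gamma' (z := a - d) rfl, inv_Gamma' (z := a + b + c - d) rfl]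
  have key := wz_polynomial_identity a b c d
  -- The linear forms become atoms, so that the final `ring` compares products instead of expanding
  -- polynomials of high degree.
  generalize gammaNum a b c d = g
  generalize (Complex.Gamma (a + b + 1))⁻¹ = g₁
  generalize (Complex.Gamma (a + c + 1))⁻¹ = g₂
  generalize (Complex.Gamma (2 * a + b + c + 2))⁻¹ = g₃
  generalize (Complex.Gamma (a + d + 2))⁻¹ = g₄
  generalize (Complex.Gamma (a + b + c + d + 2))⁻¹ = g₅
  generalize (Complex.Gamma (a - d + 1))⁻¹ = g₆
  generalize (Complex.Gamma (a + b + c - d + 1))⁻¹ = g₇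
  generalize (Complex.Gamma (-a - b + 2 * d + 5 / 2))⁻¹ = g₈
  generalize (Complex.Gamma (-a - c + 2 * d + 5 / 2))⁻¹ = g₉
  generalize P a b c (d + 1) 0 = x₁ at key ⊢
  generalize P a b c d 0 = x₂ at key ⊢
  generalize a + 2 * b + c + 1 / 2 = x₃ at key ⊢
  generalize a + b + 2 * c + 1 / 2 = x₄ at key ⊢
  generalize a - b + 1 / 2 = x₅ at key ⊢
  generalize a - c + 1 / 2 = x₆ at key ⊢
  generalize a + b + 2 * d + 1 / 2 = x₇ at key ⊢
  generalize a + b + 2 * d + 3 / 2 = x₈ at key ⊢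
  generalize a + c + 2 * d + 1 / 2 = x₉ at key ⊢
  generalize a + c + 2 * d + 3 / 2 = x₁₀ at key ⊢
  generalize -a - b + 2 * d + 1 / 2 = x₁₁ at key ⊢
  generalize -a - b + 2 * d + 3 / 2 = x₁₂ at key ⊢
  generalize -a - c + 2 * d + 1 / 2 = x₁₃ at key ⊢
  generalize -a - c + 2 * d + 3 / 2 = x₁₄ at key ⊢
  generalize 2 * a + b + c + 1 = x₁₅ at key ⊢
  generalize 2 * a + b + c - 1 = x₁₆ at key ⊢
  generalize 2 * a + b + c = x₁₇ at key ⊢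
  generalize a + b + c + d + 1 = x₁₈ at key ⊢
  generalize a + d + 1 = x₁₉ at key ⊢
  generalize a + b + c - d = x₂₀ at key ⊢
  generalize a - d = x₂₁ at key ⊢
  generalize a + b = x₂₂ at key ⊢
  generalize a + c = x₂₃ at key ⊢
  generalize 2 * d + 1 = x₂₄ at key ⊢
  linear_combination (g * g₁ * g₂ * g₃ * g₄ * g₅ * g₆ * g₇ * g₈ * g₉) * key

end Seed9
end

/-! ### Asymptotics of the kernel near its peak. -/

noncomputable section
namespace Seed9
open Filter Topology

theorem Gamma_add_nat_eq_prod {z : ℂ} (hz : 0 < z.re) (n : ℕ) :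
    Complex.Gamma (z + n) = (∏ j ∈ Finset.range n, (z + j)) * Complex.Gamma z := by
  induction n with
  | zero => simp
  | succ n ih =>
    rw [Gamma_succ' (z := z + n) (by simp; positivity) (by push_cast; ring), ih,
      Finset.prod_range_succ]
    ring

theorem tendsto_nat_div_add (z : ℂ) :
    Tendsto (fun m : ℕ => (m : ℂ) / (z + m)) atTop (𝓝 1) := by
  have h : Tendsto (fun m : ℕ => (1 + z / (m : ℂ))⁻¹) atTop (𝓝 1) := by
    have h0 : Tendsto (fun m : ℕ => z / (m : ℂ)) atTop (𝓝 0) :=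
      tendsto_const_div_atTop_nhds_zero_nat z
    simpa using (h0.const_add 1).inv₀ (by simp)
  refine h.congr' ?_
  filter_upwards [eventually_gt_atTop 0] with m hm
  have hm' : (m : ℂ) ≠ 0 := by exact_mod_cast hm.ne'
  have : 1 + z / (m : ℂ) = (z + m) / m := by field_simp; ring
  rw [this, inv_div]

/-- `Γ(z + m) ∼ Γ(m) m ^ z` as `m → ∞`, in the right half plane. -/
theorem tendsto_Gamma_add_nat_of_re_pos {z : ℂ} (hz : 0 < z.re) :
    Tendsto (fun m : ℕ => Complex.Gamma (z + m) / (Complex.Gamma m * (m : ℂ) ^ z))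
      atTop (𝓝 1) := by
  have hG : Complex.Gamma z ≠ 0 := Complex.Gamma_ne_zero_of_re_pos hz
  -- Euler's limit `m^z m! / ∏_{j ≤ m} (z+j) → Γ(z)`, with `Γ(z+m) = Γ(z) ∏_{j < m} (z+j)`; the
  -- extra factor `m/(z+m)` removes the last term of Euler's product.
  have h1 : Tendsto (fun m : ℕ => Complex.Gamma z / Complex.GammaSeq z m * ((m : ℂ) / (z + m)))
      atTop (𝓝 1) := by
    have := ((tendsto_const_nhds (x := Complex.Gamma z)).div (Complex.GammaSeq_tendsto_Gamma z) hG).mul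
      (tendsto_nat_div_add z)
    simpa [hG] using this
  refine h1.congr' ?_
  filter_upwards [eventually_gt_atTop 0] with m hm
  have hm' : (m : ℂ) ≠ 0 := by exact_mod_cast hm.ne'
  have hzm : z + m ≠ 0 := by
    intro h
    have := congrArg Complex.re h
    simp at this
    have : (0 : ℝ) ≤ m := m.cast_nonneg
    linarith
  have hpow : (m : ℂ) ^ z ≠ 0 := by simp [Complex.cpow_eq_zero_iff, hm']
  obtain ⟨k, rfl⟩ : ∃ k, m = k + 1 := ⟨m - 1, by omega⟩
  rw [Complex.GammaSeq, Finset.prod_range_succ, Gamma_add_nat_eq_prod hz]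
  have hk : Complex.Gamma ((k + 1 : ℕ) : ℂ) = k.factorial := by
    push_cast
    exact Complex.Gamma_nat_eq_factorial k
  rw [hk, Nat.factorial_succ]
  have hkf : (k.factorial : ℂ) ≠ 0 := by exact_mod_cast k.factorial_ne_zero
  push_cast at *
  field_simp

/-- `Γ(z + m) ∼ Γ(m) m ^ z` as `m → ∞`. -/
theorem tendsto_Gamma_add_nat (z : ℂ) :
    Tendsto (fun m : ℕ => Complex.Gamma (z + m) / (Complex.Gamma m * (m : ℂ) ^ z))
      atTop (𝓝 1) := by
  -- Induction on an integer above `-Re z`: the functional equation passes from `z + 1` to `z`, and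
  -- large `m` avoids the pole.
  obtain ⟨N, hN⟩ := exists_nat_gt (-z.re)
  induction N generalizing z with
  | zero => exact tendsto_Gamma_add_nat_of_re_pos (by simpa using hN)
  | succ N ih =>
    have h := (ih (z + 1) (by push_cast at hN; simp; linarith)).mul (tendsto_nat_div_add z)
    rw [one_mul] at h
    refine h.congr' ?_
    filter_upwards [eventually_gt_atTop 0, eventually_gt_atTop (N + 1)] with m hm hmN
    have hm' : (m : ℂ) ≠ 0 := by exact_mod_cast hm.ne'
    have hzm : z + m ≠ 0 := by
      intro h
      have h1 := congrArg Complex.re h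
      simp at h1
      have : ((N + 1 : ℕ) : ℝ) < m := by exact_mod_cast hmN
      linarith
    rw [show z + 1 + (m : ℂ) = z + m + 1 by ring, Complex.Gamma_add_one _ hzm,
      Complex.cpow_add _ _ hm', Complex.cpow_one]
    have hpow : (m : ℂ) ^ z ≠ 0 := by simp [Complex.cpow_eq_zero_iff, hm']
    have hG : Complex.Gamma m ≠ 0 := Complex.Gamma_ne_zero_of_re_pos (by simpa using hm)
    field_simp

section Scaled

variable {ι : Type*} {l : Filter ι} {m n : ι → ℕ} {ρ : ℝ}

theorem tendsto_atTop_of_ratio (hρ : 0 < ρ) (hn : Tendsto n l atTop)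
    (h : Tendsto (fun i => (m i : ℝ) / n i) l (𝓝 ρ)) : Tendsto m l atTop := by
  have h1 : Tendsto (fun i => (m i : ℝ) / n i * n i) l atTop :=
    h.pos_mul_atTop hρ (tendsto_natCast_atTop_atTop.comp hn)
  rw [← tendsto_natCast_atTop_iff (R := ℝ)]
  refine h1.congr' ?_
  filter_upwards [hn.eventually_gt_atTop 0] with i hi
  have : (n i : ℝ) ≠ 0 := by exact_mod_cast hi.ne'
  field_simp

/-- `Γ(z + m) ∼ Γ(m) (ρ n) ^ z` when `m / n → ρ`. -/
theorem tendsto_Gamma_scaled (hρ : 0 < ρ) (hn : Tendsto n l atTop)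
    (h : Tendsto (fun i => (m i : ℝ) / n i) l (𝓝 ρ)) (z : ℂ) :
    Tendsto (fun i => Complex.Gamma (z + m i) / (Complex.Gamma (m i) * (n i : ℂ) ^ z)) l
      (𝓝 ((ρ : ℂ) ^ z)) := by
  have hm := tendsto_atTop_of_ratio hρ hn h
  have h1 := (tendsto_Gamma_add_nat z).comp hm
  have h2 : Tendsto (fun i => (((m i : ℝ) / n i : ℝ) : ℂ) ^ z) l (𝓝 ((ρ : ℂ) ^ z)) :=
    ((Complex.continuous_ofReal.tendsto ρ).comp h).cpow tendsto_const_nhds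
      (Or.inl (by simpa using hρ))
  have h3 := h1.mul h2
  rw [one_mul] at h3
  refine h3.congr' ?_
  filter_upwards [hn.eventually_gt_atTop 0, hm.eventually_gt_atTop 0] with i hi hi'
  have hn' : (n i : ℂ) ≠ 0 := by exact_mod_cast hi.ne'
  have hm' : (m i : ℂ) ≠ 0 := by exact_mod_cast hi'.ne'
  -- Complex powers are multiplicative here because both bases are nonnegative reals.
  have e : (m i : ℂ) ^ z = (((m i : ℝ) / n i : ℝ) : ℂ) ^ z * (n i : ℂ) ^ z := by
    have := Complex.mul_cpow_ofReal_nonneg (a := (m i : ℝ) / n i) (b := n i) (by positivity)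
      (by positivity) z
    rw [Complex.ofReal_natCast] at this
    rw [← this]
    congr 1
    push_cast
    field_simp
  have hp : (((m i : ℝ) / n i : ℝ) : ℂ) ^ z ≠ 0 := by
    rw [Ne, Complex.cpow_eq_zero_iff]
    push_cast
    simp [hm', hn']
  simp only [Function.comp]
  rw [e]
  field_simp

theorem tendsto_inv_Gamma_scaled (hρ : 0 < ρ) (hn : Tendsto n l atTop)
    (h : Tendsto (fun i => (m i : ℝ) / n i) l (𝓝 ρ)) (z : ℂ) :
    Tendsto (fun i => (Complex.Gamma (z + m i))⁻¹ * (Complex.Gamma (m i) * (n i : ℂ) ^ z)) l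
      (𝓝 ((ρ : ℂ) ^ z)⁻¹) := by
  have h1 := (tendsto_Gamma_scaled hρ hn h z).inv₀ (by
    rw [Ne, Complex.cpow_eq_zero_iff]; simp [hρ.ne'])
  refine h1.congr fun i => ?_
  rw [inv_div, div_eq_mul_inv, mul_comm]

end Scaled

/-- The abscissa of the peak of the kernel. -/
def peak : ℝ := √3 / 2

theorem peak_sq : peak ^ 2 = 3 / 4 := by
  rw [peak, div_pow, Real.sq_sqrt (by norm_num)]; norm_num

theorem peak_gt : 0.86 < peak := by
  have h : 0 ≤ peak := by unfold peak; positivity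
  nlinarith [peak_sq]

theorem peak_lt : peak < 0.87 := by
  have h : 0 ≤ peak := by unfold peak; positivity
  nlinarith [peak_sq]

/-- The pairs `(n, k)` with `n → ∞` and `k / n → √3 / 2`. -/
def peakFilter : Filter (ℕ × ℕ) :=
  comap Prod.fst atTop ⊓ comap (fun q : ℕ × ℕ => (q.2 : ℝ) / q.1) (𝓝 peak)

theorem tendsto_fst_peakFilter : Tendsto Prod.fst peakFilter atTop :=
  tendsto_comap.mono_left inf_le_left

theorem tendsto_ratio_peakFilter :
    Tendsto (fun q : ℕ × ℕ => (q.2 : ℝ) / q.1) peakFilter (𝓝 peak) :=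
  tendsto_comap.mono_left inf_le_right

/-- A parameter-free model of the kernel near its peak. -/
def model (n k : ℕ) : ℝ :=
  (2 ^ (4 * n))⁻¹ * (Real.Gamma n ^ 4 * Real.Gamma (n + 2 * k : ℕ) ^ 2)
    / (Real.Gamma n ^ 2 * Real.Gamma (2 * n : ℕ) * Real.Gamma (n + k : ℕ) ^ 2
      * Real.Gamma (n - k : ℕ) ^ 2 * Real.Gamma (2 * k - n : ℕ) ^ 2) / n ^ 3

/-- The limit of the kernel divided by its model. -/
def modelConst : ℝ :=
  Real.exp (Real.log (1 + 2 * peak) + Real.log 2 - 2 * Real.log (1 + peak)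
    - 5 * Real.log (2 * peak - 1))

theorem ofReal_cpow_eq_exp {ρ : ℝ} (hρ : 0 < ρ) (z : ℂ) :
    (ρ : ℂ) ^ z = Complex.exp (Real.log ρ * z) := by
  rw [Complex.cpow_def_of_ne_zero (by exact_mod_cast hρ.ne'), Complex.ofReal_log hρ.le]

/-- These inequalities turn the truncated subtractions `n - k` and `2 * k - n` in `model` into true
differences and keep its Gamma arguments positive. -/
theorem eventually_peakFilter :
    ∀ᶠ q : ℕ × ℕ in peakFilter, 0 < q.1 ∧ q.2 < q.1 ∧ q.1 < 2 * q.2 := by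
  have h1 := tendsto_ratio_peakFilter.eventually (lt_mem_nhds peak_gt)
  have h2 := tendsto_ratio_peakFilter.eventually (gt_mem_nhds peak_lt)
  filter_upwards [h1, h2, tendsto_fst_peakFilter.eventually_gt_atTop 0] with q h1 h2 h3
  have hq : (0 : ℝ) < q.1 := by exact_mod_cast h3
  rw [lt_div_iff₀ hq] at h1
  rw [div_lt_iff₀ hq] at h2
  refine ⟨h3, ?_, ?_⟩
  · have : (q.2 : ℝ) < q.1 := by linarith
    exact_mod_cast this
  · have : (q.1 : ℝ) < 2 * q.2 := by linarith
    exact_mod_cast this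

theorem model_pos {n k : ℕ} (hn : 0 < n) (h1 : k < n) (h2 : n < 2 * k) : 0 < model n k := by
  have g : ∀ m : ℕ, 0 < m → 0 < Real.Gamma m := fun m hm => Real.Gamma_pos_of_pos (by exact_mod_cast hm)
  have := g n hn
  have := g (n + 2 * k) (by omega)
  have := g (2 * n) (by omega)
  have := g (n + k) (by omega)
  have := g (n - k) (by omega)
  have := g (2 * k - n) (by omega)
  have : (0 : ℝ) < n := by exact_mod_cast hn
  unfold model
  positivity

theorem mul_inv_eq_of_eq_mul' {x y z : ℂ} (hz : z ≠ 0) (h : x = y * z) : x * z⁻¹ = y := by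
  rw [h, mul_inv_cancel_right₀ hz]

/-- Each Gamma with argument `z + m`, `m ≈ ρ n`, contributes `Γ(m) (ρ n)^z`. The powers of `n` add
up to `n⁻³`, and the powers of the various `ρ` lose their dependence on the parameters exactly
because `peak² = 3/4`. -/
theorem tendsto_kern_div_model (a b c d : ℂ) :
    Tendsto (fun q : ℕ × ℕ => kern (a + q.1) b c (d + q.2) / model q.1 q.2) peakFilter
      (𝓝 modelConst) := by
  have hx := peak_gt
  have hx' := peak_lt
  have hn := tendsto_fst_peakFilter
  have hk := tendsto_ratio_peakFilter
  have hev := eventually_peakFilter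
  have ne : ∀ᶠ q : ℕ × ℕ in peakFilter, (q.1 : ℝ) ≠ 0 := by
    filter_upwards [hev] with q hq
    exact_mod_cast hq.1.ne'
  have r1 : Tendsto (fun q : ℕ × ℕ => (q.1 : ℝ) / q.1) peakFilter (𝓝 1) :=
    tendsto_const_nhds.congr' (by filter_upwards [ne] with q hq; field_simp)
  have r2 : Tendsto (fun q : ℕ × ℕ => ((2 * q.1 : ℕ) : ℝ) / q.1) peakFilter (𝓝 2) :=
    tendsto_const_nhds.congr' (by filter_upwards [ne] with q hq; push_cast; field_simp)
  have r3 : Tendsto (fun q : ℕ × ℕ => ((q.1 + 2 * q.2 : ℕ) : ℝ) / q.1) peakFilter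
      (𝓝 (1 + 2 * peak)) :=
    ((hk.const_mul 2).const_add 1).congr' (by
      filter_upwards [ne] with q hq; push_cast; field_simp)
  have r4 : Tendsto (fun q : ℕ × ℕ => ((q.1 + q.2 : ℕ) : ℝ) / q.1) peakFilter
      (𝓝 (1 + peak)) :=
    (hk.const_add 1).congr' (by filter_upwards [ne] with q hq; push_cast; field_simp)
  have r5 : Tendsto (fun q : ℕ × ℕ => ((q.1 - q.2 : ℕ) : ℝ) / q.1) peakFilter
      (𝓝 (1 - peak)) :=
    (hk.const_sub 1).congr' (by
      filter_upwards [ne, hev] with q hq hq'; rw [Nat.cast_sub hq'.2.1.le]; field_simp)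
  have r6 : Tendsto (fun q : ℕ × ℕ => ((2 * q.2 - q.1 : ℕ) : ℝ) / q.1) peakFilter
      (𝓝 (2 * peak - 1)) :=
    ((hk.const_mul 2).sub_const 1).congr' (by
      filter_upwards [ne, hev] with q hq hq'
      rw [Nat.cast_sub hq'.2.2.le]; push_cast; field_simp)
  have p1 : (0 : ℝ) < 1 := one_pos
  have p2 : (0 : ℝ) < 2 := two_pos
  have p3 : 0 < 1 + 2 * peak := by linarith
  have p4 : 0 < 1 + peak := by linarith
  have p5 : 0 < 1 - peak := by linarith
  have p6 : 0 < 2 * peak - 1 := by linarith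
  have t := (((((((((((((((tendsto_Gamma_scaled p1 hn r1 (a + 2 * b + c + 1 / 2)).mul
    (tendsto_Gamma_scaled p1 hn r1 (a + b + 2 * c + 1 / 2))).mul
    (tendsto_Gamma_scaled p1 hn r1 (a - b + 1 / 2))).mul
    (tendsto_Gamma_scaled p1 hn r1 (a - c + 1 / 2))).mul
    (tendsto_Gamma_scaled p3 hn r3 (a + b + 2 * d + 1 / 2))).mul
    (tendsto_Gamma_scaled p3 hn r3 (a + c + 2 * d + 1 / 2))).mul
    (tendsto_inv_Gamma_scaled p1 hn r1 (a + b))).mul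
    (tendsto_inv_Gamma_scaled p1 hn r1 (a + c))).mul
    (tendsto_inv_Gamma_scaled p2 hn r2 (2 * a + b + c - 1))).mul
    (tendsto_inv_Gamma_scaled p4 hn r4 (a + d + 1))).mul
    (tendsto_inv_Gamma_scaled p4 hn r4 (a + b + c + d + 1))).mul
    (tendsto_inv_Gamma_scaled p5 hn r5 (a - d))).mul
    (tendsto_inv_Gamma_scaled p5 hn r5 (a + b + c - d))).mul
    (tendsto_inv_Gamma_scaled p6 hn r6 (-a - b + 2 * d + 5 / 2))).mul
    (tendsto_inv_Gamma_scaled p6 hn r6 (-a - c + 2 * d + 5 / 2))).const_mul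
    ((2 : ℂ) ^ (-2 * (2 * a + b + c)))
  have t' := t.congr' (f₂ := fun q : ℕ × ℕ => kern (a + q.1) b c (d + q.2) / model q.1 q.2) ?_
  · convert! t' using 2
    simp only [ofReal_cpow_eq_exp p1, ofReal_cpow_eq_exp p2, ofReal_cpow_eq_exp p3,
      ofReal_cpow_eq_exp p4, ofReal_cpow_eq_exp p5, ofReal_cpow_eq_exp p6, ← Complex.exp_neg]
    rw [show (2 : ℂ) = ((2 : ℝ) : ℂ) by norm_num, ofReal_cpow_eq_exp p2, modelConst,
      Complex.ofReal_exp]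
    simp only [← Complex.exp_add]
    congr 1
    -- `(1+2x)(2x-1) = 2` and `(1+x)(1-x) = 1/4` at `x² = 3/4`; together they remove `2a+b+c` from
    -- the exponent.
    have l1 : Real.log (1 + 2 * peak) + Real.log (2 * peak - 1) = Real.log 2 := by
      rw [← Real.log_mul p3.ne' p6.ne']
      congr 1
      linear_combination 4 * peak_sq
    have l2 : Real.log (1 + peak) + Real.log (1 - peak) = -(2 * Real.log 2) := by
      rw [← Real.log_mul p4.ne' p5.ne', ← Real.log_rpow two_pos, ← Real.log_inv]
      congr 1
      norm_num
      linear_combination -peak_sq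
    -- The equation `(1+2x)²(1-x) = (2x-1)²(1+x)` that defines the peak; it removes `d`.
    have l3 : 2 * Real.log (1 + 2 * peak) + Real.log (1 - peak)
        = 2 * Real.log (2 * peak - 1) + Real.log (1 + peak) := by
      rw [← Real.log_rpow p3, ← Real.log_rpow p6, ← Real.log_mul (by positivity) p5.ne',
        ← Real.log_mul (by positivity) p4.ne']
      congr 1
      norm_num
      linear_combination (-8 * peak) * peak_sq
    have l1' : (Real.log (1 + 2 * peak) : ℂ) + Real.log (2 * peak - 1) = Real.log 2 := by
      exact_mod_cast l1
    have l2' : (Real.log (1 + peak) : ℂ) + Real.log (1 - peak) = -(2 * Real.log 2) := by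
      exact_mod_cast l2
    have l3' : 2 * (Real.log (1 + 2 * peak) : ℂ) + Real.log (1 - peak)
        = 2 * Real.log (2 * peak - 1) + Real.log (1 + peak) := by
      exact_mod_cast l3
    rw [Real.log_one]
    push_cast
    linear_combination (2 * a + b + c) * (l2' - l1') - 2 * d * l3'
  · filter_upwards [hev] with q hq
    obtain ⟨n, k⟩ := q
    obtain ⟨q1, q2, q3⟩ := hq
    simp only at q1 q2 q3 ⊢
    have hnC : (n : ℂ) ≠ 0 := by exact_mod_cast q1.ne'
    -- The denominator exponents exceed the numerator exponents by exactly `3`; this is the `n ^ 3`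
    -- in `model`.
    have hpow : (n : ℂ) ^ (a + b) * (n : ℂ) ^ (a + c) * (n : ℂ) ^ (2 * a + b + c - 1)
        * (n : ℂ) ^ (a + d + 1) * (n : ℂ) ^ (a + b + c + d + 1) * (n : ℂ) ^ (a - d)
        * (n : ℂ) ^ (a + b + c - d) * (n : ℂ) ^ (-a - b + 2 * d + 5 / 2)
        * (n : ℂ) ^ (-a - c + 2 * d + 5 / 2)
        = (n : ℂ) ^ 3 * ((n : ℂ) ^ (a + 2 * b + c + 1 / 2) * (n : ℂ) ^ (a + b + 2 * c + 1 / 2)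
        * (n : ℂ) ^ (a - b + 1 / 2) * (n : ℂ) ^ (a - c + 1 / 2)
        * (n : ℂ) ^ (a + b + 2 * d + 1 / 2) * (n : ℂ) ^ (a + c + 2 * d + 1 / 2)) := by
      rw [← Complex.cpow_natCast (n : ℂ) 3]
      simp only [← Complex.cpow_add _ _ hnC]
      congr 1
      push_cast
      ring
    have c5 : ((n - k : ℕ) : ℂ) = n - k := by rw [Nat.cast_sub q2.le]
    have c6 : ((2 * k - n : ℕ) : ℂ) = 2 * k - n := by rw [Nat.cast_sub q3.le]; push_cast; ring
    have h2 : (2 : ℂ) ^ (-2 * (2 * (a + n) + b + c))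
        = (2 : ℂ) ^ (-2 * (2 * a + b + c)) * (2 ^ (4 * n))⁻¹ := by
      rw [show -2 * (2 * (a + n) + b + c) = -2 * (2 * a + b + c) + -((4 * n : ℕ) : ℂ) by
        push_cast; ring, Complex.cpow_add _ _ two_ne_zero, Complex.cpow_neg, Complex.cpow_natCast]
    unfold kern gammaNum model
    rw [h2]
    push_cast [← Complex.Gamma_ofReal]
    rw [c5, c6]
    rw [show a + n + 2 * b + c + 1 / 2 = a + 2 * b + c + 1 / 2 + n by ring,
      show a + n + b + 2 * c + 1 / 2 = a + b + 2 * c + 1 / 2 + n by ring,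
      show a + n - b + 1 / 2 = a - b + 1 / 2 + n by ring,
      show a + n - c + 1 / 2 = a - c + 1 / 2 + n by ring,
      show a + n + b + 2 * (d + k) + 1 / 2 = a + b + 2 * d + 1 / 2 + (n + 2 * k) by ring,
      show a + n + c + 2 * (d + k) + 1 / 2 = a + c + 2 * d + 1 / 2 + (n + 2 * k) by ring,
      show a + n + b = a + b + n by ring, show a + n + c = a + c + n by ring,
      show 2 * (a + n) + b + c - 1 = 2 * a + b + c - 1 + 2 * n by ring,
      show a + n + (d + k) + 1 = a + d + 1 + (n + k) by ring,
      show a + b + n + c + (d + k) + 1 = a + b + c + d + 1 + (n + k) by ring,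
      show a + n - (d + k) = a - d + (n - k) by ring,
      show a + b + n + c - (d + k) = a + b + c - d + (n - k) by ring,
      show -(a + n) - b + 2 * (d + k) + 5 / 2 = -a - b + 2 * d + 5 / 2 + (2 * k - n) by ring,
      show -(a + n) - c + 2 * (d + k) + 5 / 2 = -a - c + 2 * d + 5 / 2 + (2 * k - n) by ring]
    have hP : ∀ z : ℂ, (n : ℂ) ^ z ≠ 0 := fun z => by
      rw [Ne, Complex.cpow_eq_zero_iff]; simp [hnC]
    have hpow' := mul_inv_eq_of_eq_mul' (mul_ne_zero (mul_ne_zero (mul_ne_zero (mul_ne_zero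
      (mul_ne_zero (hP (a + 2 * b + c + 1 / 2)) (hP (a + b + 2 * c + 1 / 2)))
      (hP (a - b + 1 / 2))) (hP (a - c + 1 / 2))) (hP (a + b + 2 * d + 1 / 2)))
      (hP (a + c + 2 * d + 1 / 2))) hpow
    have hT : ((2 : ℂ) ^ (4 * n)) * ((2 : ℂ) ^ (4 * n))⁻¹ = 1 := mul_inv_cancel₀ (by simp)
    simp only [div_eq_mul_inv, mul_inv, inv_inv] at hpow' ⊢
    linear_combination (2 ^ (-2 * (2 * a + b + c))
      * Complex.Gamma (a + 2 * b + c + 1 * 2⁻¹ + n)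
      * Complex.Gamma (a + b + 2 * c + 1 * 2⁻¹ + n)
      * Complex.Gamma (a - b + 1 * 2⁻¹ + n)
      * Complex.Gamma (a - c + 1 * 2⁻¹ + n)
      * Complex.Gamma (a + b + 2 * d + 1 * 2⁻¹ + (n + 2 * k))
      * Complex.Gamma (a + c + 2 * d + 1 * 2⁻¹ + (n + 2 * k))
      * (Complex.Gamma (a + b + n))⁻¹
      * (Complex.Gamma (a + c + n))⁻¹
      * (Complex.Gamma (2 * a + b + c - 1 + 2 * n))⁻¹
      * (Complex.Gamma (a + d + 1 + (n + k)))⁻¹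
      * (Complex.Gamma (a + b + c + d + 1 + (n + k)))⁻¹
      * (Complex.Gamma (a - d + (n - k)))⁻¹
      * (Complex.Gamma (a + b + c - d + (n - k)))⁻¹
      * (Complex.Gamma (-a - b + 2 * d + 5 * 2⁻¹ + (2 * k - n)))⁻¹
      * (Complex.Gamma (-a - c + 2 * d + 5 * 2⁻¹ + (2 * k - n)))⁻¹
      * (Complex.Gamma (n : ℂ))⁻¹ ^ 4
      * (Complex.Gamma (n + 2 * k : ℂ))⁻¹ ^ 2
      * Complex.Gamma (n : ℂ) ^ 2
      * Complex.Gamma (2 * n : ℂ)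
      * Complex.Gamma (n + k : ℂ) ^ 2
      * Complex.Gamma (n - k : ℂ) ^ 2
      * Complex.Gamma (2 * k - n : ℂ) ^ 2)
      * (hpow' - (n : ℂ) ^ 3 * hT)

end Seed9
end

/-! ### Quotients of consecutive kernel values. -/

noncomputable section
namespace Seed9
open Filter Topology

/-- The numerator of `kern a b c (d + 1) / kern a b c d`. -/
def ratioNum (a b c d : ℂ) : ℂ :=
  (a - d - 1) * (a + b + c - d - 1) * ((a + b + 2 * d + 1 / 2) * (a + b + 2 * d + 3 / 2)
    * (a + c + 2 * d + 1 / 2) * (a + c + 2 * d + 3 / 2))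

/-- The denominator of `kern a b c (d + 1) / kern a b c d`. -/
def ratioDen (a b c d : ℂ) : ℂ :=
  (a + d + 1) * (a + b + c + d + 1) * ((-a - b + 2 * d + 5 / 2) * (-a - b + 2 * d + 7 / 2)
    * (-a - c + 2 * d + 5 / 2) * (-a - c + 2 * d + 7 / 2))

/-- Kept in multiplied-out form because `ratioDen` may vanish. -/
theorem kern_succ_right {a b c d : ℂ} (h : Admissible a b c d) :
    kern a b c (d + 1) * ratioDen a b c d = kern a b c d * ratioNum a b c d := by
  unfold kern
  rw [gammaNum_succ_right h,
    inv_Gamma' (z := a + d + 1) (w := a + d + 2) (by ring),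
    inv_Gamma' (z := a + b + c + d + 1) (w := a + b + c + d + 2) (by ring),
    inv_Gamma' (z := -a - b + 2 * d + 5 / 2) (w := -a - b + 2 * d + 7 / 2) (by ring),
    inv_Gamma' (z := -a - b + 2 * d + 7 / 2) (w := -a - b + 2 * d + 9 / 2) (by ring),
    inv_Gamma' (z := -a - c + 2 * d + 5 / 2) (w := -a - c + 2 * d + 7 / 2) (by ring),
    inv_Gamma' (z := -a - c + 2 * d + 7 / 2) (w := -a - c + 2 * d + 9 / 2) (by ring),
    show a + (d + 1) + 1 = a + d + 2 by ring,
    show a + b + c + (d + 1) + 1 = a + b + c + d + 2 by ring,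
    inv_Gamma' (z := a - (d + 1)) (w := a - d) (by ring),
    inv_Gamma' (z := a + b + c - (d + 1)) (w := a + b + c - d) (by ring),
    show -a - b + 2 * (d + 1) + 5 / 2 = -a - b + 2 * d + 9 / 2 by ring,
    show -a - c + 2 * (d + 1) + 5 / 2 = -a - c + 2 * d + 9 / 2 by ring]
  unfold ratioDen ratioNum
  generalize (Complex.Gamma (a + d + 2))⁻¹ = g₄
  generalize (Complex.Gamma (a + b + c + d + 2))⁻¹ = g₅
  generalize (Complex.Gamma (a - d))⁻¹ = g₆
  generalize (Complex.Gamma (a + b + c - d))⁻¹ = g₇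
  generalize (Complex.Gamma (-a - b + 2 * d + 9 / 2))⁻¹ = g₈
  generalize (Complex.Gamma (-a - c + 2 * d + 9 / 2))⁻¹ = g₉
  rw [show a - (d + 1) = a - d - 1 by ring,
    show a + b + c - (d + 1) = a + b + c - d - 1 by ring]
  generalize a + b + 2 * d + 1 / 2 = x₁
  generalize a + b + 2 * d + 3 / 2 = x₂
  generalize a + c + 2 * d + 1 / 2 = x₃
  generalize a + c + 2 * d + 3 / 2 = x₄
  generalize -a - b + 2 * d + 5 / 2 = x₅
  generalize -a - b + 2 * d + 7 / 2 = x₆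
  generalize -a - c + 2 * d + 5 / 2 = x₇
  generalize -a - c + 2 * d + 7 / 2 = x₈
  generalize a + d + 1 = x₉
  generalize a + b + c + d + 1 = x₁₀
  generalize a + b + c - d - 1 = x₁₁
  generalize a - d - 1 = x₁₂
  ring

/-- A bound for all the shifts that occur in the ratio of consecutive kernel values. -/
def shiftBound (a b c d : ℂ) : ℝ := 2 * (‖a‖ + ‖b‖ + ‖c‖ + ‖d‖) + 4

section Bounds

variable (a b c d : ℂ)

theorem one_le_shiftBound : 4 ≤ shiftBound a b c d := by
  unfold shiftBound
  linarith [norm_nonneg a, norm_nonneg b, norm_nonneg c, norm_nonneg d]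

/-- All linear factors of the quotient, up to their integer parts in `n` and `k`, have coefficients
at most `2` and a constant at most `4`; a single bound serves them all. -/
theorem norm_shift_le {x₁ x₂ x₃ x₄ : ℤ} {y : ℝ} (h₁ : |x₁| ≤ 2) (h₂ : |x₂| ≤ 2) (h₃ : |x₃| ≤ 2)
    (h₄ : |x₄| ≤ 2) (hy : |y| ≤ 4) :
    ‖(x₁ : ℂ) * a + x₂ * b + x₃ * c + x₄ * d + y‖ ≤ shiftBound a b c d := by
  have key : ∀ (x : ℤ) (z : ℂ), |x| ≤ 2 → ‖(x : ℂ) * z‖ ≤ 2 * ‖z‖ := by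
    intro x z hx
    rw [norm_mul]
    gcongr
    rw [Complex.norm_intCast]
    exact_mod_cast hx
  have hy' : ‖(y : ℂ)‖ ≤ 4 := by rwa [Complex.norm_real, Real.norm_eq_abs]
  have := norm_add_le ((x₁ : ℂ) * a + x₂ * b + x₃ * c + x₄ * d) y
  have := norm_add_le ((x₁ : ℂ) * a + x₂ * b + x₃ * c) (x₄ * d)
  have := norm_add_le ((x₁ : ℂ) * a + x₂ * b) (x₃ * c)
  have := norm_add_le ((x₁ : ℂ) * a) (x₂ * b)
  have := key _ a h₁
  have := key _ b h₂
  have := key _ c h₃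
  have := key _ d h₄
  unfold shiftBound
  linarith

theorem norm_factor_le {z w : ℂ} {x s : ℝ} (h : z = x + w) (hw : ‖w‖ ≤ s) : ‖z‖ ≤ |x| + s := by
  rw [h]
  refine (norm_add_le _ _).trans ?_
  rw [Complex.norm_real, Real.norm_eq_abs]
  linarith

theorem le_norm_factor {z w : ℂ} {x s : ℝ} (h : z = x + w) (hw : ‖w‖ ≤ s) : |x| - s ≤ ‖z‖ := by
  have := norm_sub_norm_le (x : ℂ) (-w)
  rw [sub_neg_eq_add, norm_neg, Complex.norm_real, Real.norm_eq_abs] at this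
  rw [h]
  linarith

theorem norm_numShift_le :
    ‖a - d - 1‖ ≤ shiftBound a b c d ∧ ‖a + b + c - d - 1‖ ≤ shiftBound a b c d
    ∧ ‖a + b + 2 * d + 1 / 2‖ ≤ shiftBound a b c d ∧ ‖a + b + 2 * d + 3 / 2‖ ≤ shiftBound a b c d
    ∧ ‖a + c + 2 * d + 1 / 2‖ ≤ shiftBound a b c d ∧ ‖a + c + 2 * d + 3 / 2‖ ≤ shiftBound a b c d := by
  refine ⟨?_, ?_, ?_, ?_, ?_, ?_⟩
  · convert norm_shift_le a b c d (x₁ := 1) (x₂ := 0) (x₃ := 0) (x₄ := -1) (y := -1)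
      (by decide) (by decide) (by decide) (by decide) (by rw [abs_le]; norm_num) using 2
    push_cast
    ring
  · convert norm_shift_le a b c d (x₁ := 1) (x₂ := 1) (x₃ := 1) (x₄ := -1) (y := -1)
      (by decide) (by decide) (by decide) (by decide) (by rw [abs_le]; norm_num) using 2
    push_cast
    ring
  · convert norm_shift_le a b c d (x₁ := 1) (x₂ := 1) (x₃ := 0) (x₄ := 2) (y := 1 / 2)
      (by decide) (by decide) (by decide) (by decide) (by rw [abs_le]; norm_num) using 2
    push_cast
    ring
  · convert norm_shift_le a b c d (x₁ := 1) (x₂ := 1) (x₃ := 0) (x₄ := 2) (y := 3 / 2)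
      (by decide) (by decide) (by decide) (by decide) (by rw [abs_le]; norm_num) using 2
    push_cast
    ring
  · convert norm_shift_le a b c d (x₁ := 1) (x₂ := 0) (x₃ := 1) (x₄ := 2) (y := 1 / 2)
      (by decide) (by decide) (by decide) (by decide) (by rw [abs_le]; norm_num) using 2
    push_cast
    ring
  · convert norm_shift_le a b c d (x₁ := 1) (x₂ := 0) (x₃ := 1) (x₄ := 2) (y := 3 / 2)
      (by decide) (by decide) (by decide) (by decide) (by rw [abs_le]; norm_num) using 2
    push_cast
    ring

theorem norm_denShift_le :
    ‖a + d + 1‖ ≤ shiftBound a b c d ∧ ‖a + b + c + d + 1‖ ≤ shiftBound a b c d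
    ∧ ‖-a - b + 2 * d + 5 / 2‖ ≤ shiftBound a b c d ∧ ‖-a - b + 2 * d + 7 / 2‖ ≤ shiftBound a b c d
    ∧ ‖-a - c + 2 * d + 5 / 2‖ ≤ shiftBound a b c d ∧ ‖-a - c + 2 * d + 7 / 2‖ ≤ shiftBound a b c d := by
  refine ⟨?_, ?_, ?_, ?_, ?_, ?_⟩
  · convert norm_shift_le a b c d (x₁ := 1) (x₂ := 0) (x₃ := 0) (x₄ := 1) (y := 1)
      (by decide) (by decide) (by decide) (by decide) (by rw [abs_le]; norm_num) using 2
    push_cast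
    ring
  · convert norm_shift_le a b c d (x₁ := 1) (x₂ := 1) (x₃ := 1) (x₄ := 1) (y := 1)
      (by decide) (by decide) (by decide) (by decide) (by rw [abs_le]; norm_num) using 2
    push_cast
    ring
  · convert norm_shift_le a b c d (x₁ := -1) (x₂ := -1) (x₃ := 0) (x₄ := 2) (y := 5 / 2)
      (by decide) (by decide) (by decide) (by decide) (by rw [abs_le]; norm_num) using 2
    push_cast
    ring
  · convert norm_shift_le a b c d (x₁ := -1) (x₂ := -1) (x₃ := 0) (x₄ := 2) (y := 7 / 2)
      (by decide) (by decide) (by decide) (by decide) (by rw [abs_le]; norm_num) using 2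
    push_cast
    ring
  · convert norm_shift_le a b c d (x₁ := -1) (x₂ := 0) (x₃ := -1) (x₄ := 2) (y := 5 / 2)
      (by decide) (by decide) (by decide) (by decide) (by rw [abs_le]; norm_num) using 2
    push_cast
    ring
  · convert norm_shift_le a b c d (x₁ := -1) (x₂ := 0) (x₃ := -1) (x₄ := 2) (y := 7 / 2)
      (by decide) (by decide) (by decide) (by decide) (by rw [abs_le]; norm_num) using 2
    push_cast
    ring

/-- Two factors have one size and four another, so the bound is a perfect square and later
comparisons need only its square root, a cubic. -/
theorem norm_prod_six_le {z₁ z₂ z₃ z₄ z₅ z₆ : ℂ} {x y : ℝ} (h₁ : ‖z₁‖ ≤ x) (h₂ : ‖z₂‖ ≤ x)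
    (h₃ : ‖z₃‖ ≤ y) (h₄ : ‖z₄‖ ≤ y) (h₅ : ‖z₅‖ ≤ y) (h₆ : ‖z₆‖ ≤ y) :
    ‖z₁ * z₂ * (z₃ * z₄ * z₅ * z₆)‖ ≤ (x * y ^ 2) ^ 2 := by
  have hx := (norm_nonneg _).trans h₁
  have hy := (norm_nonneg _).trans h₃
  simp only [norm_mul]
  calc ‖z₁‖ * ‖z₂‖ * (‖z₃‖ * ‖z₄‖ * ‖z₅‖ * ‖z₆‖) ≤ x * x * (y * y * y * y) := by gcongr
    _ = (x * y ^ 2) ^ 2 := by ring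

theorem le_norm_prod_six {z₁ z₂ z₃ z₄ z₅ z₆ : ℂ} {x y : ℝ} (hx : 0 ≤ x) (hy : 0 ≤ y)
    (h₁ : x ≤ ‖z₁‖) (h₂ : x ≤ ‖z₂‖)
    (h₃ : y ≤ ‖z₃‖) (h₄ : y ≤ ‖z₄‖) (h₅ : y ≤ ‖z₅‖) (h₆ : y ≤ ‖z₆‖) :
    (x * y ^ 2) ^ 2 ≤ ‖z₁ * z₂ * (z₃ * z₄ * z₅ * z₆)‖ := by
  simp only [norm_mul]
  calc (x * y ^ 2) ^ 2 = x * x * (y * y * y * y) := by ring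
    _ ≤ ‖z₁‖ * ‖z₂‖ * (‖z₃‖ * ‖z₄‖ * ‖z₅‖ * ‖z₆‖) := by gcongr

variable (n k : ℕ)

theorem norm_ratioNum_le : ‖ratioNum (a + n) b c (d + k)‖ ≤
    ((|(n : ℝ) - k| + shiftBound a b c d) * (n + 2 * k + shiftBound a b c d) ^ 2) ^ 2 := by
  obtain ⟨h₁, h₂, h₃, h₄, h₅, h₆⟩ := norm_numShift_le a b c d
  have e : (n + 2 * k : ℝ) = |(n + 2 * k : ℝ)| := (abs_of_nonneg (by positivity)).symm
  rw [e]
  refine norm_prod_six_le (norm_factor_le ?_ h₁) (norm_factor_le ?_ h₂) (norm_factor_le ?_ h₃)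
    (norm_factor_le ?_ h₄) (norm_factor_le ?_ h₅) (norm_factor_le ?_ h₆) <;> push_cast <;> ring

theorem le_norm_ratioNum (h : shiftBound a b c d ≤ |(n : ℝ) - k|)
    (h' : shiftBound a b c d ≤ n + 2 * k) :
    ((|(n : ℝ) - k| - shiftBound a b c d) * (n + 2 * k - shiftBound a b c d) ^ 2) ^ 2
      ≤ ‖ratioNum (a + n) b c (d + k)‖ := by
  obtain ⟨h₁, h₂, h₃, h₄, h₅, h₆⟩ := norm_numShift_le a b c d
  have e : (n + 2 * k : ℝ) = |(n + 2 * k : ℝ)| := (abs_of_nonneg (by positivity)).symm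
  rw [e] at h' ⊢
  refine le_norm_prod_six (sub_nonneg.2 h) (sub_nonneg.2 h') (le_norm_factor ?_ h₁)
    (le_norm_factor ?_ h₂) (le_norm_factor ?_ h₃) (le_norm_factor ?_ h₄) (le_norm_factor ?_ h₅)
    (le_norm_factor ?_ h₆) <;> push_cast <;> ring

theorem norm_ratioDen_le : ‖ratioDen (a + n) b c (d + k)‖ ≤
    ((n + k + shiftBound a b c d) * (|2 * (k : ℝ) - n| + shiftBound a b c d) ^ 2) ^ 2 := by
  obtain ⟨h₁, h₂, h₃, h₄, h₅, h₆⟩ := norm_denShift_le a b c d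
  have e : (n + k : ℝ) = |(n + k : ℝ)| := (abs_of_nonneg (by positivity)).symm
  rw [e]
  refine norm_prod_six_le (norm_factor_le ?_ h₁) (norm_factor_le ?_ h₂) (norm_factor_le ?_ h₃)
    (norm_factor_le ?_ h₄) (norm_factor_le ?_ h₅) (norm_factor_le ?_ h₆) <;> push_cast <;> ring

theorem le_norm_ratioDen (h : shiftBound a b c d ≤ n + k)
    (h' : shiftBound a b c d ≤ |2 * (k : ℝ) - n|) :
    ((n + k - shiftBound a b c d) * (|2 * (k : ℝ) - n| - shiftBound a b c d) ^ 2) ^ 2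
      ≤ ‖ratioDen (a + n) b c (d + k)‖ := by
  obtain ⟨h₁, h₂, h₃, h₄, h₅, h₆⟩ := norm_denShift_le a b c d
  have e : (n + k : ℝ) = |(n + k : ℝ)| := (abs_of_nonneg (by positivity)).symm
  rw [e] at h ⊢
  refine le_norm_prod_six (sub_nonneg.2 h) (sub_nonneg.2 h') (le_norm_factor ?_ h₁)
    (le_norm_factor ?_ h₂) (le_norm_factor ?_ h₃) (le_norm_factor ?_ h₄) (le_norm_factor ?_ h₅)
    (le_norm_factor ?_ h₆) <;> push_cast <;> ring

end Bounds

section Scaling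

/-! Comparison of the leading terms of the ratio, in the scaled variable `n / k` or `k / n`. -/

/-- Here `m = n/k` and `t` is the shift bound divided by `k`; `17` bounds the increment per unit of
`t`. `right_lower` does the same for the denominator with `14`. -/
theorem right_upper {m t : ℝ} (hm : 0 ≤ m) (hm2 : m ≤ 1.16) (ht : 0 ≤ t) (ht' : t ≤ 1 / 100) :
    (|m - 1| + t) * (m + 2 + t) ^ 2 ≤ |m - 1| * (m + 2) ^ 2 + 17 * t := by
  have ha : |m - 1| ≤ 1 := by rw [abs_le]; constructor <;> linarith
  have ha0 := abs_nonneg (m - 1)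
  generalize |m - 1| = x at *
  have : (m + 2) ^ 2 + (x + t) * (2 * (m + 2) + t) ≤ 17 := by
    have : (x + t) * (2 * (m + 2) + t) ≤ 1.01 * 6.4 :=
      mul_le_mul (by linarith) (by linarith) (by positivity) (by norm_num)
    nlinarith
  nlinarith [mul_le_mul_of_nonneg_left this ht]

theorem right_lower {m t : ℝ} (hm : 0 ≤ m) (hm2 : m ≤ 1.16) (ht : 0 ≤ t) (ht' : t ≤ 1 / 100) :
    (1 + m) * (2 - m) ^ 2 - 14 * t ≤ (1 + m - t) * (2 - m - t) ^ 2 := by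
  have h1 : (2 - m - t) ^ 2 ≥ (2 - m) ^ 2 - 2 * (2 - m) * t := by nlinarith
  have h2 : (1 + m - t) * (2 - m - t) ^ 2 ≥ (1 + m - t) * ((2 - m) ^ 2 - 2 * (2 - m) * t) :=
    mul_le_mul_of_nonneg_left h1 (by linarith)
  have h3 : (2 - m) ^ 2 + 2 * (2 - m) * (1 + m) ≤ 14 := by nlinarith
  nlinarith [mul_le_mul_of_nonneg_left h3 ht,
    mul_nonneg (mul_nonneg ht ht) (by linarith : 0 ≤ 2 - m)]

/-- At `t = 0` the denominator minus the numerator is `2(4 - 3m²)` for `m ≥ 1` and `2m³` for `m ≤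
1`, so it is nonnegative to the right of the peak. The perturbation costs `(17 + 14) t`, which `60
t` absorbs because `(1+m)(2-m)² ≥ 0.7`. -/
theorem right_mild {m t : ℝ} (hm : 0 ≤ m) (hm' : 3 * m ^ 2 ≤ 4) (ht : 0 ≤ t) (ht' : t ≤ 1 / 100) :
    (|m - 1| + t) * (m + 2 + t) ^ 2 ≤ (1 + 60 * t) * ((1 + m - t) * (2 - m - t) ^ 2) := by
  have hm2 : m ≤ 1.155 := by nlinarith
  have h0 : |m - 1| * (m + 2) ^ 2 ≤ (1 + m) * (2 - m) ^ 2 := by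
    rcases abs_cases (m - 1) with ⟨h, _⟩ | ⟨h, _⟩ <;> rw [h] <;> nlinarith
  have hU := right_upper hm (by linarith) ht ht'
  have hV := right_lower hm (by linarith) ht ht'
  have hV0 : 0.7 ≤ (1 + m) * (2 - m) ^ 2 := by
    have : 0.845 ^ 2 ≤ (2 - m) ^ 2 := by gcongr; linarith
    nlinarith
  nlinarith

/-- The gap `2(4 - 3m²) ≥ 2η` loses at most `31 t ≤ η`, and the denominator is at most `3`, so a
relative gain `η / 3` remains. -/
theorem right_strong {m η t : ℝ} (hm : 1 ≤ m) (hm' : 3 * m ^ 2 + η ≤ 4) (hη : 0 ≤ η)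
    (ht : 0 ≤ t) (ht' : t ≤ 1 / 100) (htη : 31 * t ≤ η) :
    (|m - 1| + t) * (m + 2 + t) ^ 2 ≤ (1 - η / 3) * ((1 + m - t) * (2 - m - t) ^ 2) := by
  have hm2 : m ≤ 1.155 := by nlinarith
  have hU := right_upper (m := m) (by linarith) (by linarith) ht ht'
  have hV := right_lower (m := m) (by linarith) (by linarith) ht ht'
  rw [abs_of_nonneg (by linarith : 0 ≤ m - 1)] at *
  have hV3 : (1 + m - t) * (2 - m - t) ^ 2 ≤ 3 := by
    have h1 : (2 - m - t) ^ 2 ≤ 1 := by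
      rw [sq_le_one_iff_abs_le_one, abs_le]
      constructor <;> linarith
    nlinarith
  nlinarith

theorem left_upper {m t : ℝ} (hm : 0 ≤ m) (hm2 : m ≤ 0.867) (ht : 0 ≤ t) (ht' : t ≤ 1 / 1000) :
    (1 + m + t) * (|2 * m - 1| + t) ^ 2 ≤ (1 + m) * |2 * m - 1| ^ 2 + 6 * t := by
  have ha : |2 * m - 1| ≤ 1 := by rw [abs_le]; constructor <;> linarith
  have ha0 := abs_nonneg (2 * m - 1)
  generalize |2 * m - 1| = x at *
  have : x ^ 2 + (1 + m + t) * (2 * x + t) ≤ 6 := by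
    have : (1 + m + t) * (2 * x + t) ≤ 1.88 * 2.01 :=
      mul_le_mul (by linarith) (by linarith) (by positivity) (by norm_num)
    nlinarith
  nlinarith [mul_le_mul_of_nonneg_left this ht]

theorem left_lower {m t : ℝ} (hm : 0 ≤ m) (hm2 : m ≤ 0.867) (ht : 0 ≤ t) (ht' : t ≤ 1 / 1000) :
    (1 - m) * (1 + 2 * m) ^ 2 - 14 * t ≤ (1 - m - t) * (1 + 2 * m - t) ^ 2 := by
  have h1 : (1 + 2 * m - t) ^ 2 ≥ (1 + 2 * m) ^ 2 - 2 * (1 + 2 * m) * t := by nlinarith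
  have h2 : (1 - m - t) * (1 + 2 * m - t) ^ 2
      ≥ (1 - m - t) * ((1 + 2 * m) ^ 2 - 2 * (1 + 2 * m) * t) :=
    mul_le_mul_of_nonneg_left h1 (by linarith)
  have h3 : (1 + 2 * m) ^ 2 + 2 * (1 + 2 * m) * (1 - m) ≤ 14 := by nlinarith
  nlinarith [mul_le_mul_of_nonneg_left h3 ht,
    mul_nonneg (mul_nonneg ht ht) (by linarith : 0 ≤ 1 + 2 * m)]

/-- Now `m = k/n`, and the unperturbed gap is `2m(3 - 4m²)`. The loss `(6 + 14) t` is absorbed by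
`200 t` because `(1-m)(1+2m)² ≥ 0.133`. -/
theorem left_mild {m t : ℝ} (hm : 0 ≤ m) (hm' : 4 * m ^ 2 ≤ 3) (ht : 0 ≤ t) (ht' : t ≤ 1 / 1000) :
    (1 + m + t) * (|2 * m - 1| + t) ^ 2
      ≤ (1 + 200 * t) * ((1 - m - t) * (1 + 2 * m - t) ^ 2) := by
  have hm2 : m ≤ 0.8661 := by nlinarith
  have h0 : (1 + m) * |2 * m - 1| ^ 2 ≤ (1 - m) * (1 + 2 * m) ^ 2 := by
    rw [sq_abs]
    nlinarith
  have hU := left_upper hm (by linarith) ht ht'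
  have hV := left_lower hm (by linarith) ht ht'
  have hV0 : 0.133 ≤ (1 - m) * (1 + 2 * m) ^ 2 := by
    have : 1 ≤ (1 + 2 * m) ^ 2 := by nlinarith
    nlinarith
  nlinarith

/-- For `m ≥ 1/2` the gap `2m(3 - 4m²)` is at least `η`; half of it pays for `20 t`, and the other
half is a relative gain `η / 8` against a quantity at most `4`. Near `m = 0` the gap closes, hence
the lower bound on `m`. -/
theorem left_strong {m η t : ℝ} (hm : 1 / 2 ≤ m) (hm' : 4 * m ^ 2 + η ≤ 3) (hη : 0 ≤ η)
    (ht : 0 ≤ t) (ht' : t ≤ 1 / 1000) (htη : 40 * t ≤ η) :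
    (1 + m + t) * (|2 * m - 1| + t) ^ 2
      ≤ (1 - η / 8) * ((1 - m - t) * (1 + 2 * m - t) ^ 2) := by
  have hm2 : m ≤ 0.8661 := by nlinarith
  have hU := left_upper (m := m) (by linarith) (by linarith) ht ht'
  have hV := left_lower (m := m) (by linarith) (by linarith) ht ht'
  rw [sq_abs] at hU
  have hV4 : (1 - m - t) * (1 + 2 * m - t) ^ 2 ≤ 4 := by
    have h1 : (1 + 2 * m - t) ^ 2 ≤ (1 + 2 * m) ^ 2 := by gcongr <;> linarith
    have h2 : (1 - m - t) * (1 + 2 * m - t) ^ 2 ≤ (1 - m) * (1 + 2 * m) ^ 2 :=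
      mul_le_mul (by linarith) h1 (sq_nonneg _) (by linarith)
    nlinarith
  nlinarith

end Scaling

/-- Both sides are homogeneous of degree three in `(n, k, s)`. -/
theorem right_scale {n k s q : ℝ} (hk : 0 < k)
    (H : (|n / k - 1| + s / k) * (n / k + 2 + s / k) ^ 2
      ≤ q * ((1 + n / k - s / k) * (2 - n / k - s / k) ^ 2)) :
    (|n - k| + s) * (n + 2 * k + s) ^ 2 ≤ q * ((n + k - s) * (2 * k - n - s) ^ 2) := by
  have e : |n - k| = k * |n / k - 1| := by
    rw [← abs_of_pos hk, ← abs_mul, abs_of_pos hk]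
    congr 1
    field_simp
  have eU : (|n - k| + s) * (n + 2 * k + s) ^ 2
      = k ^ 3 * ((|n / k - 1| + s / k) * (n / k + 2 + s / k) ^ 2) := by
    rw [e]
    generalize |n / k - 1| = x
    field_simp
  have eV : (n + k - s) * (2 * k - n - s) ^ 2
      = k ^ 3 * ((1 + n / k - s / k) * (2 - n / k - s / k) ^ 2) := by
    field_simp
    ring
  rw [eU, eV, mul_left_comm q]
  exact mul_le_mul_of_nonneg_left H (by positivity)

theorem left_scale {n k s q : ℝ} (hn : 0 < n)
    (H : (1 + k / n + s / n) * (|2 * (k / n) - 1| + s / n) ^ 2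
      ≤ q * ((1 - k / n - s / n) * (1 + 2 * (k / n) - s / n) ^ 2)) :
    (n + k + s) * (|2 * k - n| + s) ^ 2 ≤ q * ((n - k - s) * (n + 2 * k - s) ^ 2) := by
  have e : |2 * k - n| = n * |2 * (k / n) - 1| := by
    rw [← abs_of_pos hn, ← abs_mul, abs_of_pos hn]
    congr 1
    field_simp
  have eU : (n + k + s) * (|2 * k - n| + s) ^ 2
      = n ^ 3 * ((1 + k / n + s / n) * (|2 * (k / n) - 1| + s / n) ^ 2) := by
    rw [e]
    generalize |2 * (k / n) - 1| = x
    field_simp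
  have eV : (n - k - s) * (n + 2 * k - s) ^ 2
      = n ^ 3 * ((1 - k / n - s / n) * (1 + 2 * (k / n) - s / n) ^ 2) := by
    field_simp
  rw [eU, eV, mul_left_comm q]
  exact mul_le_mul_of_nonneg_left H (by positivity)

section KernRatio

variable {a b c d : ℂ} {n k : ℕ} {q : ℝ}

theorem norm_kern_succ_mul (h : Admissible a b c d) (n k : ℕ) :
    ‖kern (a + n) b c (d + (k + 1 : ℕ))‖ * ‖ratioDen (a + n) b c (d + k)‖
      = ‖kern (a + n) b c (d + k)‖ * ‖ratioNum (a + n) b c (d + k)‖ := by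
  rw [← norm_mul, ← norm_mul, ← kern_succ_right (h.add_nat n k)]
  push_cast
  rw [add_assoc]

/-- The cubic comparison `H` is squared, whence `q ^ 2`; it is fed by `right_mild` or
`right_strong`. `norm_kern_le_succ` is the mirror image to the left of the peak. -/
theorem norm_kern_succ_le (h : Admissible a b c d) (hk : 0 < k)
    (hs : 100 * shiftBound a b c d ≤ k) (hnk : 3 * (n : ℝ) ^ 2 ≤ 4 * (k : ℝ) ^ 2)
    (H : (|(n : ℝ) / k - 1| + shiftBound a b c d / k)
        * ((n : ℝ) / k + 2 + shiftBound a b c d / k) ^ 2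
      ≤ q * ((1 + (n : ℝ) / k - shiftBound a b c d / k)
        * (2 - (n : ℝ) / k - shiftBound a b c d / k) ^ 2)) :
    ‖kern (a + n) b c (d + (k + 1 : ℕ))‖ ≤ q ^ 2 * ‖kern (a + n) b c (d + k)‖ := by
  have hk' : (0 : ℝ) < k := by exact_mod_cast hk
  have hn' : (0 : ℝ) ≤ n := n.cast_nonneg
  have hs4 := one_le_shiftBound a b c d
  have hn2 : (n : ℝ) ≤ 1.155 * k := by nlinarith
  have habs : |2 * (k : ℝ) - n| = 2 * k - n := abs_of_nonneg (by linarith)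
  have hnum := norm_ratioNum_le a b c d n k
  have hden := le_norm_ratioDen a b c d n k (by linarith) (by rw [habs]; linarith)
  rw [habs] at hden
  have hrec := norm_kern_succ_mul h n k
  generalize shiftBound a b c d = s at *
  have hUV := right_scale hk' H
  have hVpos : 0 < (n + k - s) * (2 * (k : ℝ) - n - s) ^ 2 := by
    have : 0 < 2 * (k : ℝ) - n - s := by linarith
    have : 0 < n + k - s := by linarith
    positivity
  have hdpos := (pow_pos hVpos 2).trans_le hden
  have hU0 : 0 ≤ (|(n : ℝ) - k| + s) * (n + 2 * k + s) ^ 2 := by positivity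
  have key : ‖ratioNum (a + n) b c (d + k)‖ ≤ q ^ 2 * ‖ratioDen (a + n) b c (d + k)‖ := by
    refine hnum.trans ((pow_le_pow_left₀ hU0 hUV 2).trans ?_)
    rw [mul_pow]
    gcongr
  refine le_of_mul_le_mul_right ?_ hdpos
  rw [hrec]
  calc _ ≤ ‖kern (a + n) b c (d + k)‖ * (q ^ 2 * ‖ratioDen (a + n) b c (d + k)‖) :=
        mul_le_mul_of_nonneg_left key (norm_nonneg _)
    _ = _ := by ring

theorem norm_kern_le_succ (h : Admissible a b c d) (hn : 0 < n)
    (hs : 1000 * shiftBound a b c d ≤ n) (hnk : 4 * (k : ℝ) ^ 2 ≤ 3 * (n : ℝ) ^ 2)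
    (H : (1 + (k : ℝ) / n + shiftBound a b c d / n)
        * (|2 * ((k : ℝ) / n) - 1| + shiftBound a b c d / n) ^ 2
      ≤ q * ((1 - (k : ℝ) / n - shiftBound a b c d / n)
        * (1 + 2 * ((k : ℝ) / n) - shiftBound a b c d / n) ^ 2)) :
    ‖kern (a + n) b c (d + k)‖ ≤ q ^ 2 * ‖kern (a + n) b c (d + (k + 1 : ℕ))‖ := by
  have hn' : (0 : ℝ) < n := by exact_mod_cast hn
  have hk' : (0 : ℝ) ≤ k := k.cast_nonneg
  have hs4 := one_le_shiftBound a b c d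
  have hk2 : (k : ℝ) ≤ 0.8661 * n := by nlinarith
  have habs : |(n : ℝ) - k| = n - k := abs_of_nonneg (by linarith)
  have hden := norm_ratioDen_le a b c d n k
  have hnum := le_norm_ratioNum a b c d n k (by rw [habs]; linarith) (by linarith)
  rw [habs] at hnum
  have hrec := norm_kern_succ_mul h n k
  generalize shiftBound a b c d = s at *
  have hUV := left_scale hn' H
  have hVpos : 0 < (n - k - s) * (n + 2 * (k : ℝ) - s) ^ 2 := by
    have : 0 < n + 2 * (k : ℝ) - s := by linarith
    have : 0 < n - k - s := by linarith
    positivity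
  have hdpos := (pow_pos hVpos 2).trans_le hnum
  have hU0 : 0 ≤ (n + k + s) * (|2 * (k : ℝ) - n| + s) ^ 2 := by positivity
  have key : ‖ratioDen (a + n) b c (d + k)‖ ≤ q ^ 2 * ‖ratioNum (a + n) b c (d + k)‖ := by
    refine hden.trans ((pow_le_pow_left₀ hU0 hUV 2).trans ?_)
    rw [mul_pow]
    gcongr
  refine le_of_mul_le_mul_right ?_ hdpos
  rw [← hrec]
  calc _ ≤ ‖kern (a + n) b c (d + (k + 1 : ℕ))‖ * (q ^ 2 * ‖ratioNum (a + n) b c (d + k)‖) :=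
        mul_le_mul_of_nonneg_left key (norm_nonneg _)
    _ = _ := by ring

end KernRatio

/-! ### Decay of the kernel for `k` beyond a multiple of `n²`. -/

section Tail

theorem norm_one_add_le_exp (z : ℂ) : ‖1 + z‖ ≤ Real.exp (z.re + ‖z‖ ^ 2 / 2) := by
  have h1 : ‖1 + z‖ ^ 2 = 1 + (2 * z.re + ‖z‖ ^ 2) := by
    rw [← Complex.normSq_eq_norm_sq, ← Complex.normSq_eq_norm_sq, Complex.normSq_apply,
      Complex.normSq_apply]
    simp
    ring
  have h2 : ‖1 + z‖ ^ 2 ≤ Real.exp (z.re + ‖z‖ ^ 2 / 2) ^ 2 := by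
    rw [h1, ← Real.exp_nat_mul]
    refine (le_of_eq ?_).trans (Real.add_one_le_exp _)
    push_cast
    ring
  exact le_of_sq_le_sq h2 (Real.exp_pos _).le

/-- The upper bound at `-z` becomes a lower bound at `z` through `|1+z||1-z| ≥ 1 - |z|²`. -/
theorem exp_le_norm_one_add {z : ℂ} (hz : ‖z‖ ≤ 1 / 2) :
    Real.exp (z.re - 5 / 2 * ‖z‖ ^ 2) ≤ ‖1 + z‖ := by
  have h1 := norm_one_add_le_exp (-z)
  rw [norm_neg, Complex.neg_re] at h1
  have h2 : 1 - ‖z‖ ^ 2 ≤ ‖1 + z‖ * ‖1 + -z‖ := by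
    rw [← norm_mul, show (1 + z) * (1 + -z) = 1 - z ^ 2 by ring]
    have := norm_sub_norm_le (1 : ℂ) (z ^ 2)
    rwa [norm_one, norm_pow] at this
  have h3 : Real.exp (-(2 * ‖z‖ ^ 2)) ≤ 1 - ‖z‖ ^ 2 := by
    rw [Real.exp_neg]
    have hr : ‖z‖ ^ 2 ≤ 1 / 4 := by nlinarith [norm_nonneg z]
    have h4 := Real.add_one_le_exp (2 * ‖z‖ ^ 2)
    rw [inv_le_iff_one_le_mul₀ (Real.exp_pos _)]
    nlinarith [sq_nonneg ‖z‖]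
  have h5 : Real.exp (-(2 * ‖z‖ ^ 2)) ≤ ‖1 + z‖ * Real.exp (-z.re + ‖z‖ ^ 2 / 2) :=
    h3.trans (h2.trans (by gcongr))
  calc Real.exp (z.re - 5 / 2 * ‖z‖ ^ 2)
      = Real.exp (-(2 * ‖z‖ ^ 2)) * Real.exp (-(-z.re + ‖z‖ ^ 2 / 2)) := by
        rw [← Real.exp_add]; congr 1; ring
    _ ≤ ‖1 + z‖ * Real.exp (-z.re + ‖z‖ ^ 2 / 2) * Real.exp (-(-z.re + ‖z‖ ^ 2 / 2)) := by
        gcongr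
    _ = ‖1 + z‖ := by rw [mul_assoc, ← Real.exp_add, add_neg_cancel, Real.exp_zero, mul_one]

/-- The quadratic constant `3` is chosen to cover both `1/2` here and `5/2` in the companion lower
bound. -/
theorem norm_add_le_exp {x B : ℝ} (hx : 0 < x) {α : ℂ} (hα : ‖α‖ ≤ B) :
    ‖(x : ℂ) + α‖ ≤ x * Real.exp (α.re / x + 3 * B ^ 2 / x ^ 2) := by
  have h := norm_one_add_le_exp (α / x)
  have hx' : (x : ℂ) ≠ 0 := by exact_mod_cast hx.ne'
  have e : (x : ℂ) + α = x * (1 + α / x) := by field_simp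
  rw [e, norm_mul, Complex.norm_real, Real.norm_eq_abs, abs_of_pos hx]
  gcongr
  refine h.trans (Real.exp_le_exp.2 ?_)
  rw [norm_div, Complex.norm_real, Real.norm_eq_abs, abs_of_pos hx, div_pow, Complex.div_ofReal_re]
  have : ‖α‖ ^ 2 ≤ B ^ 2 := by gcongr
  have h3 : ‖α‖ ^ 2 / x ^ 2 / 2 ≤ 3 * B ^ 2 / x ^ 2 := by
    rw [div_div, mul_comm (x ^ 2) 2, ← div_div]
    gcongr
    nlinarith [sq_nonneg B]
  linarith

theorem exp_le_norm_add {x B : ℝ} (hx : 0 < x) {α : ℂ} (hα : ‖α‖ ≤ B) (hB : 2 * B ≤ x) :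
    x * Real.exp (α.re / x - 3 * B ^ 2 / x ^ 2) ≤ ‖(x : ℂ) + α‖ := by
  have hn : ‖α / x‖ = ‖α‖ / x := by
    rw [norm_div, Complex.norm_real, Real.norm_eq_abs, abs_of_pos hx]
  have h := exp_le_norm_one_add (z := α / x) (by rw [hn, div_le_iff₀ hx]; linarith)
  have hx' : (x : ℂ) ≠ 0 := by exact_mod_cast hx.ne'
  have e : (x : ℂ) + α = x * (1 + α / x) := by field_simp
  rw [e, norm_mul, Complex.norm_real, Real.norm_eq_abs, abs_of_pos hx]
  gcongr
  refine (Real.exp_le_exp.2 ?_).trans h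
  rw [hn, div_pow, Complex.div_ofReal_re]
  have : ‖α‖ ^ 2 ≤ B ^ 2 := by gcongr
  have h3 : 5 / 2 * (‖α‖ ^ 2 / x ^ 2) ≤ 3 * B ^ 2 / x ^ 2 := by
    rw [← mul_div_assoc]
    gcongr
    nlinarith [sq_nonneg B]
  linarith

/-- To first order a quotient of products of factors `x + α` depends only on the sum of the
differences of the shifts; that sum gives the exponent of the decay. -/
theorem norm_prod_le_of_exp {ι : Type*} (s : Finset ι) (α β : ι → ℂ) {x B : ℝ} (hx : 0 < x)
    (hα : ∀ i ∈ s, ‖α i‖ ≤ B) (hβ : ∀ i ∈ s, ‖β i‖ ≤ B) (hB : 2 * B ≤ x) :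
    ‖∏ i ∈ s, ((x : ℂ) + α i)‖ ≤ Real.exp ((∑ i ∈ s, (α i - β i)).re / x
      + s.card * (6 * B ^ 2 / x ^ 2)) * ‖∏ i ∈ s, ((x : ℂ) + β i)‖ := by
  classical
  induction s using Finset.induction_on with
  | empty => simp
  | insert i s hi ih =>
    rw [Finset.prod_insert hi, Finset.prod_insert hi, Finset.sum_insert hi,
      Finset.card_insert_of_notMem hi, norm_mul, norm_mul]
    have ih' := ih (fun j hj => hα j (Finset.mem_insert_of_mem hj))
      (fun j hj => hβ j (Finset.mem_insert_of_mem hj))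
    have h1 := norm_add_le_exp hx (hα i (Finset.mem_insert_self i s))
    have h2 := exp_le_norm_add hx (hβ i (Finset.mem_insert_self i s)) hB
    have h3 : x * Real.exp ((α i).re / x + 3 * B ^ 2 / x ^ 2)
        ≤ Real.exp ((α i - β i).re / x + 6 * B ^ 2 / x ^ 2) * ‖(x : ℂ) + β i‖ := by
      refine (le_of_eq ?_).trans (mul_le_mul_of_nonneg_left h2 (Real.exp_pos _).le)
      rw [mul_left_comm, ← Real.exp_add]
      congr 2
      rw [Complex.sub_re]
      ring
    refine (mul_le_mul (h1.trans h3) ih' (norm_nonneg _) (by positivity)).trans (le_of_eq ?_)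
    rw [mul_mul_mul_comm, ← Real.exp_add, Complex.add_re]
    congr 2
    push_cast
    ring

/-- The kernel decays at least like `k⁻³` once `k` is large compared to `n ^ 2`. -/
theorem norm_kern_succ_tail {a b c d : ℂ} (h : Admissible a b c d) {n k : ℕ}
    (hk : 36 * (shiftBound a b c d * (n + 1)) ^ 2 ≤ k) :
    ‖kern (a + n) b c (d + (k + 1 : ℕ))‖ * (k + 1) ^ 3 ≤ ‖kern (a + n) b c (d + k)‖ * k ^ 3 := by
  have hs4 := one_le_shiftBound a b c d
  have hB1 : 4 ≤ shiftBound a b c d * (n + 1) := by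
    nlinarith [(Nat.cast_nonneg n : (0 : ℝ) ≤ n)]
  obtain ⟨h₁, h₂, h₃, h₄, h₅, h₆⟩ := norm_numShift_le a b c d
  obtain ⟨h₁', h₂', h₃', h₄', h₅', h₆'⟩ := norm_denShift_le a b c d
  have hrec := norm_kern_succ_mul h n k
  have hb1 : ∀ z : ℂ, ‖z‖ ≤ shiftBound a b c d → ‖-z - n‖ ≤ shiftBound a b c d * (n + 1) := by
    intro z hz
    have := norm_sub_le (-z) (n : ℂ)
    rw [norm_neg, Complex.norm_natCast] at this
    nlinarith [(Nat.cast_nonneg n : (0 : ℝ) ≤ n)]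
  have hb2 : ∀ z : ℂ, ‖z‖ ≤ shiftBound a b c d → ‖z + n‖ ≤ shiftBound a b c d * (n + 1) := by
    intro z hz
    have := norm_add_le z (n : ℂ)
    rw [Complex.norm_natCast] at this
    nlinarith [(Nat.cast_nonneg n : (0 : ℝ) ≤ n)]
  have hb3 : ∀ z : ℂ, ‖z‖ ≤ shiftBound a b c d →
      ‖(z + n) / 2‖ ≤ shiftBound a b c d * (n + 1) := by
    intro z hz
    have := hb2 z hz
    rw [norm_div, Complex.norm_ofNat]
    linarith [norm_nonneg (z + n)]
  have hb4 : ∀ z : ℂ, ‖z‖ ≤ shiftBound a b c d →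
      ‖(z - n) / 2‖ ≤ shiftBound a b c d * (n + 1) := by
    intro z hz
    have := hb1 (-z) (by rwa [norm_neg])
    rw [neg_neg] at this
    rw [norm_div, Complex.norm_ofNat]
    linarith [norm_nonneg (z - n)]
  generalize shiftBound a b c d * (n + 1) = B at *
  have hk0 : (0 : ℝ) < k := by nlinarith
  have hk2 : 2 * B ≤ k := by nlinarith
  have key := norm_prod_le_of_exp (Finset.univ : Finset (Fin 6))
    ![-(a - d - 1) - n, -(a + b + c - d - 1) - n, (a + b + 2 * d + 1 / 2 + n) / 2,
      (a + b + 2 * d + 3 / 2 + n) / 2, (a + c + 2 * d + 1 / 2 + n) / 2,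
      (a + c + 2 * d + 3 / 2 + n) / 2]
    ![a + d + 1 + n, a + b + c + d + 1 + n, (-a - b + 2 * d + 5 / 2 - n) / 2,
      (-a - b + 2 * d + 7 / 2 - n) / 2, (-a - c + 2 * d + 5 / 2 - n) / 2,
      (-a - c + 2 * d + 7 / 2 - n) / 2] hk0 (B := B)
    (by
      intro i _
      fin_cases i
      · exact hb1 _ h₁
      · exact hb1 _ h₂
      · exact hb3 _ h₃
      · exact hb3 _ h₄
      · exact hb3 _ h₅
      · exact hb3 _ h₆)
    (by
      intro i _
      fin_cases i
      · exact hb2 _ h₁'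
      · exact hb2 _ h₂'
      · exact hb4 _ h₃'
      · exact hb4 _ h₄'
      · exact hb4 _ h₅'
      · exact hb4 _ h₆') hk2
  have esum : ∀ p q : Fin 6 → ℂ, ∑ i, (p i - q i) = (p 0 - q 0) + (p 1 - q 1) + (p 2 - q 2)
      + (p 3 - q 3) + (p 4 - q 4) + (p 5 - q 5) := fun p q => Fin.sum_univ_six _
  have eprod : ∀ p : Fin 6 → ℂ, ∏ i, (((k : ℝ) : ℂ) + p i) = (k + p 0) * (k + p 1) * (k + p 2)
      * (k + p 3) * (k + p 4) * (k + p 5) := fun p => by rw [Fin.prod_univ_six]; simp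
  rw [esum, eprod, eprod] at key
  simp only [Matrix.cons_val] at key
  -- All parameters and `n` cancel: the shifts differ by `-4` in total, so the kernel behaves like
  -- `k⁻⁴`.
  have e1 : (-(a - d - 1) - n - (a + d + 1 + n) + (-(a + b + c - d - 1) - n - (a + b + c + d + 1 + n))
      + ((a + b + 2 * d + 1 / 2 + n) / 2 - (-a - b + 2 * d + 5 / 2 - n) / 2)
      + ((a + b + 2 * d + 3 / 2 + n) / 2 - (-a - b + 2 * d + 7 / 2 - n) / 2)
      + ((a + c + 2 * d + 1 / 2 + n) / 2 - (-a - c + 2 * d + 5 / 2 - n) / 2)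
      + ((a + c + 2 * d + 3 / 2 + n) / 2 - (-a - c + 2 * d + 7 / 2 - n) / 2) : ℂ) = ((-4 : ℝ) : ℂ) := by
    push_cast
    ring
  rw [e1, Complex.ofReal_re] at key
  have e2 : ratioNum (a + n) b c (d + k) = 16 * ((k + (-(a - d - 1) - n))
      * (k + (-(a + b + c - d - 1) - n)) * (k + (a + b + 2 * d + 1 / 2 + n) / 2)
      * (k + (a + b + 2 * d + 3 / 2 + n) / 2) * (k + (a + c + 2 * d + 1 / 2 + n) / 2)
      * (k + (a + c + 2 * d + 3 / 2 + n) / 2)) := by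
    unfold ratioNum
    rw [show a + n - (d + k) - 1 = -(k + (-(a - d - 1) - n)) by ring,
      show a + n + b + c - (d + k) - 1 = -(k + (-(a + b + c - d - 1) - n)) by ring,
      show a + n + b + 2 * (d + k) + 1 / 2 = 2 * (k + (a + b + 2 * d + 1 / 2 + n) / 2) by ring,
      show a + n + b + 2 * (d + k) + 3 / 2 = 2 * (k + (a + b + 2 * d + 3 / 2 + n) / 2) by ring,
      show a + n + c + 2 * (d + k) + 1 / 2 = 2 * (k + (a + c + 2 * d + 1 / 2 + n) / 2) by ring,
      show a + n + c + 2 * (d + k) + 3 / 2 = 2 * (k + (a + c + 2 * d + 3 / 2 + n) / 2) by ring]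
    generalize (k + (-(a - d - 1) - n) : ℂ) = y₁
    generalize (k + (-(a + b + c - d - 1) - n) : ℂ) = y₂
    generalize (k + (a + b + 2 * d + 1 / 2 + n) / 2 : ℂ) = y₃
    generalize (k + (a + b + 2 * d + 3 / 2 + n) / 2 : ℂ) = y₄
    generalize (k + (a + c + 2 * d + 1 / 2 + n) / 2 : ℂ) = y₅
    generalize (k + (a + c + 2 * d + 3 / 2 + n) / 2 : ℂ) = y₆
    ring
  have e3 : ratioDen (a + n) b c (d + k) = 16 * ((k + (a + d + 1 + n))
      * (k + (a + b + c + d + 1 + n)) * (k + (-a - b + 2 * d + 5 / 2 - n) / 2)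
      * (k + (-a - b + 2 * d + 7 / 2 - n) / 2) * (k + (-a - c + 2 * d + 5 / 2 - n) / 2)
      * (k + (-a - c + 2 * d + 7 / 2 - n) / 2)) := by
    unfold ratioDen
    rw [show a + n + (d + k) + 1 = k + (a + d + 1 + n) by ring,
      show a + n + b + c + (d + k) + 1 = k + (a + b + c + d + 1 + n) by ring,
      show -(a + n) - b + 2 * (d + k) + 5 / 2 = 2 * (k + (-a - b + 2 * d + 5 / 2 - n) / 2) by ring,
      show -(a + n) - b + 2 * (d + k) + 7 / 2 = 2 * (k + (-a - b + 2 * d + 7 / 2 - n) / 2) by ring,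
      show -(a + n) - c + 2 * (d + k) + 5 / 2 = 2 * (k + (-a - c + 2 * d + 5 / 2 - n) / 2) by ring,
      show -(a + n) - c + 2 * (d + k) + 7 / 2 = 2 * (k + (-a - c + 2 * d + 7 / 2 - n) / 2) by ring]
    generalize (k + (a + d + 1 + n) : ℂ) = y₁
    generalize (k + (a + b + c + d + 1 + n) : ℂ) = y₂
    generalize (k + (-a - b + 2 * d + 5 / 2 - n) / 2 : ℂ) = y₃
    generalize (k + (-a - b + 2 * d + 7 / 2 - n) / 2 : ℂ) = y₄
    generalize (k + (-a - c + 2 * d + 5 / 2 - n) / 2 : ℂ) = y₅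
    generalize (k + (-a - c + 2 * d + 7 / 2 - n) / 2 : ℂ) = y₆
    ring
  -- One of the four powers is spent on the quadratic error, which is at most `1/k` once `k ≥ 36
  -- B²`; three powers remain.
  have hexp : Real.exp (-4 / k + (Finset.univ : Finset (Fin 6)).card * (6 * B ^ 2 / k ^ 2))
      * ((k : ℝ) + 1) ^ 3 ≤ (k : ℝ) ^ 3 := by
    have h1 : ((k : ℝ) + 1) ^ 3 ≤ Real.exp (3 / k) * (k : ℝ) ^ 3 := by
      have : ((k : ℝ) + 1) ≤ Real.exp (1 / k) * k := by
        have := Real.add_one_le_exp (1 / (k : ℝ))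
        calc ((k : ℝ) + 1) = (1 / k + 1) * k := by field_simp; ring
          _ ≤ _ := by gcongr
      calc ((k : ℝ) + 1) ^ 3 ≤ (Real.exp (1 / k) * k) ^ 3 := by gcongr
        _ = _ := by
          rw [mul_pow, ← Real.exp_nat_mul]
          congr 2
          push_cast
          ring
    refine (mul_le_mul_of_nonneg_left h1 (Real.exp_pos _).le).trans ?_
    rw [← mul_assoc, ← Real.exp_add]
    refine mul_le_of_le_one_left (by positivity) (Real.exp_le_one_iff.2 ?_)
    have h2 : 6 * (6 * B ^ 2 / (k : ℝ) ^ 2) ≤ 1 / k := by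
      rw [← mul_div_assoc, div_le_div_iff₀ (by positivity) hk0]
      nlinarith
    have h3 : -4 / (k : ℝ) + 3 / k = -(1 / k) := by ring
    simp only [Finset.card_univ, Fintype.card_fin]
    push_cast
    linarith
  have hD : 0 < ‖ratioDen (a + n) b c (d + k)‖ := by
    have hne : ∀ z : ℂ, ‖z‖ ≤ B → (k : ℂ) + z ≠ 0 := by
      intro z hz h0
      have := exp_le_norm_add hk0 hz hk2
      rw [Complex.ofReal_natCast, h0, norm_zero] at this
      exact absurd this (not_le.2 (by positivity))
    rw [norm_pos_iff, e3]
    have n1 := hne _ (hb2 _ h₁')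
    have n2 := hne _ (hb2 _ h₂')
    have n3 := hne _ (hb4 _ h₃')
    have n4 := hne _ (hb4 _ h₄')
    have n5 := hne _ (hb4 _ h₅')
    have n6 := hne _ (hb4 _ h₆')
    exact mul_ne_zero (by norm_num) (mul_ne_zero (mul_ne_zero (mul_ne_zero (mul_ne_zero
      (mul_ne_zero n1 n2) n3) n4) n5) n6)
  have hND : ‖ratioNum (a + n) b c (d + k)‖ ≤ Real.exp (-4 / k
      + (Finset.univ : Finset (Fin 6)).card * (6 * B ^ 2 / k ^ 2))
      * ‖ratioDen (a + n) b c (d + k)‖ := by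
    rw [e2, e3, norm_mul, norm_mul (16 : ℂ)]
    calc _ ≤ ‖(16 : ℂ)‖ * _ := mul_le_mul_of_nonneg_left key (norm_nonneg _)
      _ = _ := by ring
  refine le_of_mul_le_mul_right ?_ hD
  generalize Real.exp (-4 / k + (Finset.univ : Finset (Fin 6)).card * (6 * B ^ 2 / k ^ 2)) = E at *
  calc _ = (‖kern (a + n) b c (d + (k + 1 : ℕ))‖ * ‖ratioDen (a + n) b c (d + k)‖)
        * ((k : ℝ) + 1) ^ 3 := by ring
    _ = ‖kern (a + n) b c (d + k)‖ * ‖ratioNum (a + n) b c (d + k)‖ * ((k : ℝ) + 1) ^ 3 := by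
        rw [hrec]
    _ ≤ ‖kern (a + n) b c (d + k)‖ * (E * ‖ratioDen (a + n) b c (d + k)‖)
        * ((k : ℝ) + 1) ^ 3 := by gcongr
    _ = ‖kern (a + n) b c (d + k)‖ * ‖ratioDen (a + n) b c (d + k)‖
        * (E * ((k : ℝ) + 1) ^ 3) := by ring
    _ ≤ ‖kern (a + n) b c (d + k)‖ * ‖ratioDen (a + n) b c (d + k)‖ * (k : ℝ) ^ 3 := by gcongr
    _ = _ := by ring

end Tail

end Seed9
end

/-! ### The diagonal `d = a` and the reference point. -/

noncomputable section
namespace Seed9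
open Filter Topology

section Diagonal

theorem inv_Gamma_natCast_sub_eq_zero {n k : ℕ} (h : n ≤ k) :
    (Complex.Gamma ((n : ℂ) - k))⁻¹ = 0 := by
  obtain ⟨m, rfl⟩ := Nat.exists_eq_add_of_le h
  rw [show (n : ℂ) - (n + m : ℕ) = -m by push_cast; ring, Complex.Gamma_neg_nat_eq_zero, inv_zero]

variable (a b c : ℂ) {n k : ℕ}

theorem Phi_diag_eq_zero (h : n ≤ k) : Phi (a + n) b c (a + k) = 0 := by
  have := inv_Gamma_natCast_sub_eq_zero h
  unfold Phi kern
  rw [show a + n - (a + k) = (n : ℂ) - k by ring, this]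
  simp

/-- Strict, unlike `Phi_diag_eq_zero`: `psi` contains `1/Γ(a-d+1)` where `kern` has `1/Γ(a-d)`. -/
theorem Psi_diag_eq_zero (h : n < k) : Psi (a + n) b c (a + k) = 0 := by
  have := inv_Gamma_natCast_sub_eq_zero h
  unfold Psi psi
  rw [show a + n - (a + k) + 1 = ((n + 1 : ℕ) : ℂ) - k by push_cast; ring, this]
  simp

variable {a b c}

theorem Phi_succ_sub {a b c d : ℂ} (h : Admissible a b c d) (n k : ℕ) :
    Phi (a + (n + 1 : ℕ)) b c (d + k) - Phi (a + n) b c (d + k)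
      = Psi (a + n) b c (d + (k + 1 : ℕ)) - Psi (a + n) b c (d + k) := by
  have := Phi_sub_Phi (h.add_nat n k)
  push_cast
  rw [← add_assoc, ← add_assoc]
  exact this

/-- Passing from row `n` to row `n + 1`, the WZ equation telescopes in `k`, and the upper boundary
term `Ψ(a+n,b,c,a+n+1)` vanishes. -/
theorem sum_Phi_diag (h : Admissible a b c a) (n : ℕ) :
    ∑ k ∈ Finset.range n, Phi (a + n) b c (a + k)
      = -∑ m ∈ Finset.range n, Psi (a + m) b c a := by
  induction n with
  | zero => simp
  | succ n ih =>
    -- Row `n` may be summed up to `k = n` at no cost, so both rows have the same length.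
    have h1 : ∑ k ∈ Finset.range (n + 1), Phi (a + n) b c (a + k)
        = ∑ k ∈ Finset.range n, Phi (a + n) b c (a + k) := by
      rw [Finset.sum_range_succ, Phi_diag_eq_zero a b c le_rfl, add_zero]
    have h2 : ∑ k ∈ Finset.range (n + 1), (Phi (a + (n + 1 : ℕ)) b c (a + k)
        - Phi (a + n) b c (a + k)) = -Psi (a + n) b c a := by
      simp only [Phi_succ_sub h]
      rw [Finset.sum_range_sub (fun k : ℕ => Psi (a + n) b c (a + k)),
        Psi_diag_eq_zero a b c (Nat.lt_succ_self n)]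
      simp
    rw [Finset.sum_sub_distrib, h1, ih] at h2
    rw [Finset.sum_range_succ (fun m : ℕ => Psi (a + m) b c a)]
    linear_combination h2

theorem hasSum_Phi_diag (h : Admissible a b c a) (n : ℕ) :
    HasSum (fun k : ℕ => Phi (a + n) b c (a + k)) (-∑ m ∈ Finset.range n, Psi (a + m) b c a) := by
  rw [← sum_Phi_diag h n]
  refine hasSum_sum_of_ne_finset_zero fun k hk => ?_
  exact Phi_diag_eq_zero a b c (by simpa using hk)

end Diagonal

section Reference

/-- A point on `d = a` where also `-a - b + 2d + 1/2 = 1`, so `1/Γ(1-m)` kills every `Ψ(a+m,b,c,a)`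
with `m ≥ 1`, and the remaining Gammas have integer or half-integer arguments. -/
theorem admissible_ref : Admissible (1 / 4) (-1 / 4) (1 / 4) (1 / 4) := by
  constructor <;> norm_num

theorem Psi_ref_succ (m : ℕ) : Psi (1 / 4 + (m + 1 : ℕ)) (-1 / 4) (1 / 4) (1 / 4) = 0 := by
  have := inv_Gamma_natCast_sub_eq_zero (n := 1) (k := m + 1) (by omega)
  unfold Psi psi
  rw [show -(1 / 4 + ((m + 1 : ℕ) : ℂ)) - -1 / 4 + 2 * (1 / 4) + 1 / 2
    = ((1 : ℕ) : ℂ) - (m + 1 : ℕ) by push_cast; ring, this]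
  simp

theorem Gamma_three_halves : Complex.Gamma (3 / 2) = 1 / 2 * Complex.Gamma (1 / 2) :=
  Gamma_succ' (by norm_num) (by norm_num)

theorem Gamma_five_halves : Complex.Gamma (5 / 2) = 3 / 4 * Complex.Gamma (1 / 2) := by
  rw [Gamma_succ' (z := 3 / 2) (by norm_num) (by norm_num), Gamma_three_halves]
  ring

theorem Gamma_one_half_sq : Complex.Gamma (1 / 2) ^ 2 = Real.pi := by
  rw [Complex.Gamma_one_half_eq, ← Complex.cpow_nat_mul]
  norm_num

theorem Psi_ref_zero :
    Psi (1 / 4) (-1 / 4) (1 / 4) (1 / 4) = -(1 / (8 * Real.pi) : ℂ) := by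
  have hG : Complex.Gamma (1 / 2) ≠ 0 := Complex.Gamma_ne_zero_of_re_pos (by norm_num)
  have hpi : (Real.pi : ℂ) ≠ 0 := by exact_mod_cast Real.pi_ne_zero
  have hP : P (1 / 4) (-1 / 4) (1 / 4) (1 / 4) 0 = 12 := by unfold P; norm_num
  unfold Psi psi gammaNum
  rw [hP]
  norm_num only [Complex.Gamma_one]
  have h2 : (2 : ℂ) ^ (-1 : ℂ) = 1 / 2 := by rw [Complex.cpow_neg_one]; norm_num
  simp only [Gamma_three_halves, Gamma_five_halves, h2]
  have := Gamma_one_half_sq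
  field_simp
  rw [← this]
  ring

theorem hasSum_Phi_ref {n : ℕ} (hn : 0 < n) :
    HasSum (fun k : ℕ => Phi (1 / 4 + n) (-1 / 4) (1 / 4) (1 / 4 + k)) (1 / (8 * Real.pi)) := by
  have h := hasSum_Phi_diag admissible_ref n
  obtain ⟨m, rfl⟩ : ∃ m, n = m + 1 := ⟨n - 1, by omega⟩
  rw [Finset.sum_range_succ', Finset.sum_eq_zero fun i _ => Psi_ref_succ i] at h
  rw [Nat.cast_zero, add_zero, Psi_ref_zero, zero_add, neg_neg] at h
  exact h

/-- Positivity turns the known row sum into the sum of the absolute values; this uniform bound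
controls the comparison with all other parameters. The terms vanish unless `k < n ≤ 2k + 2`, and in
that range every Gamma argument is positive. -/
theorem Phi_ref_nonneg (n k : ℕ) :
    ∃ r : ℝ, 0 ≤ r ∧ Phi (1 / 4 + n) (-1 / 4) (1 / 4) (1 / 4 + k) = r := by
  rcases le_or_gt n k with h | h
  · exact ⟨0, le_rfl, by rw [Phi_diag_eq_zero _ _ _ h]; simp⟩
  rcases le_or_gt (2 * k + 3) n with h' | h'
  · refine ⟨0, le_rfl, ?_⟩
    have := inv_Gamma_natCast_sub_eq_zero h'
    unfold Phi kern
    rw [show -(1 / 4 + (n : ℂ)) - -1 / 4 + 2 * (1 / 4 + k) + 5 / 2 = ((2 * k + 3 : ℕ) : ℂ) - n by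
      push_cast; ring, this]
    simp
  have hn : (0 : ℝ) < n := by exact_mod_cast (by omega : 0 < n)
  have hk : (0 : ℝ) ≤ k := k.cast_nonneg
  have hnk : (k : ℝ) + 1 ≤ n := by exact_mod_cast h
  have hnk' : (n : ℝ) ≤ 2 * k + 2 := by exact_mod_cast (by omega : n ≤ 2 * k + 2)
  have g : ∀ {x : ℝ}, 0 < x → 0 ≤ Real.Gamma x := fun hx => (Real.Gamma_pos_of_pos hx).le
  have G : ∀ {z : ℂ} (x : ℝ), z = x → Complex.Gamma z = (Real.Gamma x : ℂ) := fun x h => by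
    rw [h, Complex.Gamma_ofReal]
  have e2 : (2 : ℂ) ^ (-2 * (2 * (1 / 4 + n) + -1 / 4 + 1 / 4) : ℂ)
      = (((2 : ℝ) ^ (-2 * (2 * (1 / 4 + n) + -1 / 4 + 1 / 4) : ℝ) : ℝ) : ℂ) := by
    rw [Complex.ofReal_cpow two_pos.le]
    push_cast
    rfl
  unfold Phi kern gammaNum
  rw [e2, G (n + 1 / 2 : ℝ) (by push_cast; ring : 1 / 4 + (n : ℂ) + 2 * (-1 / 4) + 1 / 4 + 1 / 2 = _),
    G (n + 1 : ℝ) (by push_cast; ring : 1 / 4 + (n : ℂ) + (-1 / 4) + 2 * (1 / 4) + 1 / 2 = _),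
    G (n + 1 : ℝ) (by push_cast; ring : 1 / 4 + (n : ℂ) - (-1 / 4) + 1 / 2 = _),
    G (n + 1 / 2 : ℝ) (by push_cast; ring : 1 / 4 + (n : ℂ) - 1 / 4 + 1 / 2 = _),
    G (n + 2 * k + 1 : ℝ)
      (by push_cast; ring : 1 / 4 + (n : ℂ) + (-1 / 4) + 2 * (1 / 4 + k) + 1 / 2 = _),
    G (n + 2 * k + 3 / 2 : ℝ)
      (by push_cast; ring : 1 / 4 + (n : ℂ) + 1 / 4 + 2 * (1 / 4 + k) + 1 / 2 = _),
    G (n + 1 / 2 : ℝ) (by push_cast; ring : 1 / 4 + (n : ℂ) + 1 / 4 = _),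
    G (n : ℝ) (by push_cast; ring : 1 / 4 + (n : ℂ) + -1 / 4 = _),
    G (2 * n - 1 / 2 : ℝ)
      (by push_cast; ring : 2 * (1 / 4 + (n : ℂ)) + -1 / 4 + 1 / 4 - 1 = _),
    G (n + k + 3 / 2 : ℝ) (by push_cast; ring : 1 / 4 + (n : ℂ) + (1 / 4 + k) + 1 = _),
    G (n + k + 3 / 2 : ℝ)
      (by push_cast; ring : 1 / 4 + (n : ℂ) + -1 / 4 + 1 / 4 + (1 / 4 + k) + 1 = _),
    G (n - k : ℝ) (by push_cast; ring : 1 / 4 + (n : ℂ) - (1 / 4 + k) = _),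
    G (n - k : ℝ) (by push_cast; ring : 1 / 4 + (n : ℂ) + -1 / 4 + 1 / 4 - (1 / 4 + k) = _),
    G (2 * k - n + 3 : ℝ)
      (by push_cast; ring : -(1 / 4 + (n : ℂ)) - -1 / 4 + 2 * (1 / 4 + k) + 5 / 2 = _),
    G (2 * k - n + 5 / 2 : ℝ)
      (by push_cast; ring : -(1 / 4 + (n : ℂ)) - 1 / 4 + 2 * (1 / 4 + k) + 5 / 2 = _),
    show (2 * (1 / 4 + (k : ℂ)) + 1) = ((2 * k + 3 / 2 : ℝ) : ℂ) by push_cast; ring]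
  simp only [← Complex.ofReal_mul, ← Complex.ofReal_inv]
  refine ⟨_, ?_, rfl⟩
  have g1 := g (x := n + 1 / 2) (by linarith)
  have g2 := g (x := n + 1) (by linarith)
  have g3 := g (x := n + 2 * k + 1) (by linarith)
  have g4 := g (x := n + 2 * k + 3 / 2) (by linarith)
  have g5 := g (x := n) (by linarith)
  have g6 := g (x := 2 * n - 1 / 2) (by linarith)
  have g7 := g (x := n + k + 3 / 2) (by linarith)
  have g8 := g (x := n - k) (by linarith)
  have g9 := g (x := 2 * k - n + 3) (by linarith)
  have g10 := g (x := 2 * k - n + 5 / 2) (by linarith)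
  positivity

end Reference

end Seed9
end

/-! ### Negligibility away from the peak. -/

noncomputable section
namespace Seed9
open Filter Topology

theorem le_pow_mul_of_succ_le {u : ℕ → ℝ} {q : ℝ} (hq : 0 ≤ q) {k₀ k₁ : ℕ} (h01 : k₀ ≤ k₁)
    (h : ∀ k, k₀ ≤ k → k < k₁ → u (k + 1) ≤ q * u k) : u k₁ ≤ q ^ (k₁ - k₀) * u k₀ := by
  induction k₁, h01 using Nat.le_induction with
  | base => simp
  | succ k hk ih =>
    have h1 := ih fun j hj hj' => h j hj (by omega)
    have h2 := h k hk (by omega)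
    rw [show k + 1 - k₀ = (k - k₀) + 1 by omega, pow_succ']
    nlinarith [mul_le_mul_of_nonneg_left h1 hq]

theorem le_pow_mul_of_le_succ {u : ℕ → ℝ} {q : ℝ} (hq : 0 ≤ q) {k₀ k₁ : ℕ} (h01 : k₀ ≤ k₁)
    (h : ∀ k, k₀ ≤ k → k < k₁ → u k ≤ q * u (k + 1)) : u k₀ ≤ q ^ (k₁ - k₀) * u k₁ := by
  induction k₁, h01 using Nat.le_induction with
  | base => simp
  | succ k hk ih =>
    have h1 := ih fun j hj hj' => h j hj (by omega)
    have h2 := h k hk (by omega)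
    rw [show k + 1 - k₀ = (k - k₀) + 1 by omega, pow_succ, mul_assoc]
    exact h1.trans (mul_le_mul_of_nonneg_left h2 (by positivity))

theorem mul_le_mul_of_succ_le {u v : ℕ → ℝ} {k₁ : ℕ}
    (h : ∀ k, k₁ ≤ k → u (k + 1) * v (k + 1) ≤ u k * v k) {k : ℕ} (hk : k₁ ≤ k) :
    u k * v k ≤ u k₁ * v k₁ := by
  induction k, hk using Nat.le_induction with
  | base => rfl
  | succ k hk ih => exact (h k hk).trans ih

/-- The exponent `δ n - 1` is a lower bound for the number of integers between two roundings at
distance `δ n`. -/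
theorem tendsto_pow_mul_rpow {q δ : ℝ} (hq : 0 < q) (hq1 : q < 1) (hδ : 0 < δ) (p : ℕ) :
    Tendsto (fun n : ℕ => ((n : ℝ) + 1) ^ p * q ^ (δ * n - 1)) atTop (𝓝 0) := by
  have hr : q ^ δ < 1 := Real.rpow_lt_one hq.le hq1 hδ
  have hr0 : 0 < q ^ δ := Real.rpow_pos_of_pos hq δ
  have h := (tendsto_add_atTop_iff_nat 1).2
    (tendsto_pow_const_mul_const_pow_of_abs_lt_one p (by rwa [abs_of_pos hr0]))
  have h2 := h.mul_const ((q ^ δ)⁻¹ * q⁻¹)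
  rw [zero_mul] at h2
  refine h2.congr fun n => ?_
  rw [Real.rpow_sub hq, Real.rpow_one, Real.rpow_mul hq.le, Real.rpow_natCast, pow_succ]
  push_cast
  field_simp

theorem pow_nat_le_rpow {q x : ℝ} (hq : 0 < q) (hq1 : q ≤ 1) {m : ℕ} (h : x ≤ m) :
    q ^ m ≤ q ^ x := by
  rw [← Real.rpow_natCast]
  exact Real.rpow_le_rpow_of_exponent_ge hq hq1 h

section Far

variable {a b c d : ℂ}

/-- Bernoulli's inequality: the factor from `right_mild` is dominated by a power of `(x+1)/x`, whose
products telescope. -/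
theorem one_add_div_sq_le {s x : ℝ} (hx : 0 < x) :
    (1 + 60 * (s / x)) ≤ ((x + 1) / x) ^ ⌈60 * s⌉₊ := by
  have h0 : 0 < 1 / x := by positivity
  have h1 := one_add_mul_le_pow (a := 1 / x) (by linarith) ⌈60 * s⌉₊
  have h2 : 60 * s ≤ ⌈60 * s⌉₊ := Nat.le_ceil _
  have h3 : 60 * (s / x) ≤ ⌈60 * s⌉₊ * (1 / x) := by
    rw [← mul_div_assoc, mul_one_div]
    gcongr
  have h4 : 1 + 1 / x = (x + 1) / x := by field_simp
  rw [h4] at h1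
  linarith

/-- Polynomial growth of the kernel to the right of its peak. -/
theorem norm_kern_growth (h : Admissible a b c d) {n k₁ k : ℕ} (hk₁ : 0 < k₁)
    (hs : 100 * shiftBound a b c d ≤ k₁) (hnk : 3 * (n : ℝ) ^ 2 ≤ 4 * (k₁ : ℝ) ^ 2)
    (hk : k₁ ≤ k) :
    ‖kern (a + n) b c (d + k)‖
      ≤ ‖kern (a + n) b c (d + k₁)‖ * (k : ℝ) ^ (2 * ⌈60 * shiftBound a b c d⌉₊) := by
  set e := 2 * ⌈60 * shiftBound a b c d⌉₊ with he
  have hs4 := one_le_shiftBound a b c d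
  -- The kernel divided by `j ^ e` is nonincreasing.
  have step : ∀ j : ℕ, k₁ ≤ j → ‖kern (a + n) b c (d + (j + 1 : ℕ))‖ * (((j + 1 : ℕ) : ℝ) ^ e)⁻¹
      ≤ ‖kern (a + n) b c (d + j)‖ * ((j : ℝ) ^ e)⁻¹ := by
    intro j hj
    have hj0 : (0 : ℝ) < j := by exact_mod_cast hk₁.trans_le hj
    have hjk : (k₁ : ℝ) ≤ j := by exact_mod_cast hj
    have hn0 : (0 : ℝ) ≤ n := n.cast_nonneg
    have hnj : 3 * (n : ℝ) ^ 2 ≤ 4 * (j : ℝ) ^ 2 := hnk.trans (by gcongr)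
    have h1 := norm_kern_succ_le h (by exact_mod_cast hj0) (hs.trans hjk) hnj
      (right_mild (by positivity) (by rw [div_pow, ← mul_div_assoc, div_le_iff₀ (by positivity)]; linarith)
        (by positivity) (by rw [div_le_iff₀ hj0]; linarith))
    have h2 : (1 + 60 * (shiftBound a b c d / j)) ^ 2 ≤ (((j : ℝ) + 1) / j) ^ e := by
      rw [he, mul_comm 2, pow_mul]
      have := one_add_div_sq_le (s := shiftBound a b c d) hj0
      gcongr
    have h3 := h1.trans (mul_le_mul_of_nonneg_right h2 (norm_nonneg _))
    rw [div_pow] at h3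
    rw [← div_eq_mul_inv, div_le_iff₀ (by positivity)]
    refine h3.trans (le_of_eq ?_)
    push_cast
    field_simp
  have := mul_le_mul_of_succ_le (u := fun j : ℕ => ‖kern (a + n) b c (d + j)‖)
    (v := fun j : ℕ => ((j : ℝ) ^ e)⁻¹) step hk
  have hk0 : (0 : ℝ) < k := by exact_mod_cast hk₁.trans_le hk
  rw [← div_eq_mul_inv, div_le_iff₀ (by positivity)] at this
  refine this.trans ?_
  have h1 : ((k₁ : ℝ) ^ e)⁻¹ ≤ 1 := inv_le_one_of_one_le₀ (one_le_pow₀ (by exact_mod_cast hk₁))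
  gcongr
  exact mul_le_of_le_one_right (norm_nonneg _) h1

/-- The point after which the kernel decays like `k⁻³`. -/
def tailStart (a b c d : ℂ) (n : ℕ) : ℕ := ⌈36 * (shiftBound a b c d * (n + 1)) ^ 2⌉₊

theorem norm_kern_mul_le (h : Admissible a b c d) {n k₁ k : ℕ} (hk₁ : tailStart a b c d n ≤ k₁)
    (hk : k₁ ≤ k) :
    ‖kern (a + n) b c (d + k)‖ * (k : ℝ) ^ 3 ≤ ‖kern (a + n) b c (d + k₁)‖ * (k₁ : ℝ) ^ 3 := by
  refine mul_le_mul_of_succ_le (u := fun j : ℕ => ‖kern (a + n) b c (d + j)‖)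
    (v := fun j : ℕ => (j : ℝ) ^ 3) (fun j hj => ?_) hk
  have := norm_kern_succ_tail h (n := n) (k := j)
    ((Nat.le_ceil _).trans (Nat.cast_le.2 (hk₁.trans hj)))
  push_cast at this ⊢
  exact this

theorem norm_Phi_le {n k : ℕ} : ‖Phi (a + n) b c (d + k)‖
    ≤ (2 * k + shiftBound a b c d) * ‖kern (a + n) b c (d + k)‖ := by
  unfold Phi
  rw [norm_mul]
  gcongr
  have h1 : ‖2 * d + 1‖ ≤ shiftBound a b c d := by
    convert norm_shift_le a b c d (x₁ := 0) (x₂ := 0) (x₃ := 0) (x₄ := 2) (y := 1)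
      (by decide) (by decide) (by decide) (by decide) (by rw [abs_le]; norm_num) using 2
    push_cast
    ring
  have := norm_add_le ((2 * k : ℕ) : ℂ) (2 * d + 1)
  rw [Complex.norm_natCast] at this
  rw [show 2 * (d + k) + 1 = ((2 * k : ℕ) : ℂ) + (2 * d + 1) by push_cast; ring]
  push_cast at this ⊢
  linarith

/-- The linear factor of `Phi` costs one power of `k`: `2k + s ≤ (2+s)k` and `(k+1)² ≤ 4k²`. -/
theorem norm_Phi_le_of_kern {n k : ℕ} {E : ℝ} (hk : 0 < k)
    (h : ‖kern (a + n) b c (d + k)‖ * (k : ℝ) ^ 3 ≤ E) :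
    ‖Phi (a + n) b c (d + k)‖ ≤ 4 * (2 + shiftBound a b c d) * E / ((k : ℝ) + 1) ^ 2 := by
  have hs4 := one_le_shiftBound a b c d
  have hk1 : (1 : ℝ) ≤ k := by exact_mod_cast hk
  refine norm_Phi_le.trans ?_
  rw [le_div_iff₀ (by positivity)]
  have hu := norm_nonneg (kern (a + n) b c (d + k))
  generalize ‖kern (a + n) b c (d + k)‖ = u at *
  generalize shiftBound a b c d = s at *
  have h1 : (2 * k + s) * ((k : ℝ) + 1) ^ 2 ≤ 4 * (2 + s) * (k : ℝ) ^ 3 := by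
    have e1 : (2 * k + s) ≤ (2 + s) * k := by nlinarith
    have e2 : ((k : ℝ) + 1) ^ 2 ≤ 4 * k ^ 2 := by nlinarith
    calc _ ≤ ((2 + s) * k) * (4 * (k : ℝ) ^ 2) := by gcongr
      _ = _ := by ring
  nlinarith [mul_le_mul_of_nonneg_left h1 hu]

theorem summable_inv_succ_sq : Summable fun k : ℕ => 1 / ((k : ℝ) + 1) ^ 2 := by
  have := (summable_nat_add_iff 1).2 (Real.summable_one_div_nat_pow.2 one_lt_two)
  simpa using this

theorem summable_Phi (h : Admissible a b c d) (n : ℕ) :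
    Summable fun k : ℕ => Phi (a + n) b c (d + k) := by
  set K := tailStart a b c d n + 1
  refine .of_norm_bounded_eventually_nat
    (g := fun k : ℕ => 4 * (2 + shiftBound a b c d)
      * (‖kern (a + n) b c (d + K)‖ * (K : ℝ) ^ 3) * (1 / ((k : ℝ) + 1) ^ 2))
    (summable_inv_succ_sq.mul_left _) ?_
  filter_upwards [eventually_ge_atTop K] with k hk
  rw [mul_one_div]
  exact norm_Phi_le_of_kern (by omega) (norm_kern_mul_le h (by omega) hk)

variable {δ M : ℝ}

set_option maxHeartbeats 2000000 in
/-- The kernel is negligible to the right of its peak. -/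
theorem far_right (h : Admissible a b c d) (hδ : 0 < δ) (hδ' : δ ≤ 1 / 100)
    (hM : ∀ᶠ n : ℕ in atTop, ∀ k : ℕ, |(k : ℝ) / n - peak| ≤ 3 / 2 * δ →
      ‖kern (a + n) b c (d + k)‖ ≤ M) :
    ∃ ε : ℕ → ℝ, Tendsto ε atTop (𝓝 0) ∧ ∀ᶠ n : ℕ in atTop, ∀ k : ℕ, (peak + 2 * δ) * n ≤ k →
      ‖Phi (a + n) b c (d + k)‖ ≤ ε n / ((k : ℝ) + 1) ^ 2 := by
  have hs4 := one_le_shiftBound a b c d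
  have hp := peak_gt
  have hp' := peak_lt
  have hpsq := peak_sq
  set s := shiftBound a b c d with hs
  set e := 2 * ⌈60 * s⌉₊ with he
  -- `right_strong` with `η = 4δ`, admissible since `(4 - 4δ)(3/4 + 1.72δ) ≥ 3`; its square is
  -- bounded by `q` itself.
  set q := 1 - 4 * δ / 3 with hq
  have hq0 : 0 < q := by linarith
  have hq1 : q < 1 := by linarith
  refine ⟨fun n => 4 * (2 + s) * (M * q ^ (δ * n - 1) * ((36 * s ^ 2 + 1) * ((n : ℝ) + 1) ^ 2) ^ (e + 3)), ?_, ?_⟩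
  · have := (tendsto_pow_mul_rpow hq0 hq1 hδ (2 * (e + 3))).const_mul
      (4 * (2 + s) * M * (36 * s ^ 2 + 1) ^ (e + 3))
    rw [mul_zero] at this
    refine this.congr fun n => ?_
    rw [mul_pow _ _ (e + 3), ← pow_mul]
    ring
  filter_upwards [hM, eventually_ge_atTop 1, tendsto_natCast_atTop_atTop.eventually_ge_atTop (2 / δ),
    tendsto_natCast_atTop_atTop.eventually_ge_atTop (200 * s / δ)] with n hM hn1 hn2 hn3 k hk
  have hn1' : (1 : ℝ) ≤ n := by exact_mod_cast hn1
  rw [div_le_iff₀ hδ] at hn2 hn3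
  -- At `k₀` the bound `M` still applies, because rounding moves `k₀ / n` by at most `δ / 2`.
  -- Between `k₀` and `k₁` the decay is geometric over about `δ n` steps.
  set k₀ := ⌈(peak + δ) * n⌉₊ with hk₀
  set k₁ := ⌈(peak + 2 * δ) * n⌉₊ with hk₁
  have a0 : (peak + δ) * n ≤ k₀ := Nat.le_ceil _
  have a1 : (k₀ : ℝ) < (peak + δ) * n + 1 := Nat.ceil_lt_add_one (by positivity)
  have b0 : (peak + 2 * δ) * n ≤ k₁ := Nat.le_ceil _
  have b1 : (k₁ : ℝ) < (peak + 2 * δ) * n + 1 := Nat.ceil_lt_add_one (by positivity)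
  have h01 : k₀ ≤ k₁ := Nat.ceil_mono (by nlinarith)
  have hk1k : k₁ ≤ k := Nat.ceil_le.2 hk
  have hbase : ‖kern (a + n) b c (d + k₀)‖ ≤ M := by
    refine hM k₀ ?_
    rw [abs_le]
    constructor
    · rw [le_sub_iff_add_le, le_div_iff₀ (by positivity)]
      nlinarith
    · rw [sub_le_iff_le_add, div_le_iff₀ (by positivity)]
      nlinarith
  have hgeom : ‖kern (a + n) b c (d + k₁)‖ ≤ q ^ (k₁ - k₀) * ‖kern (a + n) b c (d + k₀)‖ := by
    refine le_pow_mul_of_succ_le (u := fun j : ℕ => ‖kern (a + n) b c (d + j)‖) hq0.le h01 ?_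
    intro j hj hj'
    have hj1 : (peak + δ) * n ≤ j := a0.trans (by exact_mod_cast hj)
    have hj2 : (j : ℝ) < (peak + 2 * δ) * n := Nat.lt_ceil.1 hj'
    have hj0 : (0 : ℝ) < j := by nlinarith
    have hjn : (j : ℝ) ≤ n := by nlinarith
    have hsq : (3 / 4 + 1.72 * δ) * (n : ℝ) ^ 2 ≤ (j : ℝ) ^ 2 := by
      have : ((peak + δ) * n) ^ 2 ≤ (j : ℝ) ^ 2 := by gcongr
      refine le_trans ?_ this
      rw [mul_pow]
      gcongr
      nlinarith
    have key := norm_kern_succ_le h (by exact_mod_cast hj0) (by rw [← hs]; nlinarith) (by nlinarith [sq_nonneg (n : ℝ)])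
      (right_strong (m := (n : ℝ) / j) (η := 4 * δ) (t := s / j) (by rwa [le_div_iff₀ hj0, one_mul])
        (by
          rw [div_pow, ← mul_div_assoc, div_add' _ _ _ (by positivity), div_le_iff₀ (by positivity)]
          nlinarith [sq_nonneg (n : ℝ), mul_nonneg hδ.le (sq_nonneg (n : ℝ)),
            mul_nonneg (mul_nonneg hδ.le hδ.le) (sq_nonneg (n : ℝ)),
            mul_le_mul_of_nonneg_left hsq (by linarith : 0 ≤ 4 - 4 * δ)])
        (by positivity) (by positivity)
        (by rw [div_le_iff₀ hj0]; nlinarith)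
        (by rw [← mul_div_assoc, div_le_iff₀ hj0]; nlinarith))
    refine key.trans (mul_le_mul_of_nonneg_right ?_ (norm_nonneg _))
    rw [hq]
    nlinarith
  have hk₁0 : 0 < k₁ := by
    have : (0 : ℝ) < k₁ := by nlinarith
    exact_mod_cast this
  have hgr : ∀ j, k₁ ≤ j → _ := fun j hj => norm_kern_growth h (n := n) (k₁ := k₁) (k := j) hk₁0
    (by rw [← hs]; nlinarith) (by
      have : ((peak + 2 * δ) * n) ^ 2 ≤ (k₁ : ℝ) ^ 2 := by gcongr
      rw [mul_pow] at this
      nlinarith [mul_nonneg hδ.le (sq_nonneg (n : ℝ)), sq_nonneg (δ * n)]) hj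
  rw [← hs, ← he] at hgr
  -- From `k₁` to `K` the kernel grows at most polynomially, and beyond `K` it decays like `k⁻³`. As
  -- `K = O(n²)`, the geometric factor wins.
  set K := max k₁ (tailStart a b c d n) with hK
  have hKle : (K : ℝ) ≤ (36 * s ^ 2 + 1) * ((n : ℝ) + 1) ^ 2 := by
    rw [hK, Nat.cast_max]
    refine max_le ?_ ?_
    · nlinarith [sq_nonneg s, sq_nonneg ((n : ℝ) + 1), mul_nonneg (sq_nonneg s) (sq_nonneg ((n : ℝ) + 1))]
    · have := (Nat.ceil_lt_add_one (a := 36 * (s * (n + 1)) ^ 2) (by positivity)).le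
      unfold tailStart
      rw [← hs]
      nlinarith [sq_nonneg ((n : ℝ))]
  have hmain : ‖kern (a + n) b c (d + k)‖ * (k : ℝ) ^ 3
      ≤ ‖kern (a + n) b c (d + k₁)‖ * (K : ℝ) ^ (e + 3) := by
    rcases le_total k K with hkK | hkK
    · have hkK' : (k : ℝ) ≤ K := by exact_mod_cast hkK
      calc _ ≤ (‖kern (a + n) b c (d + k₁)‖ * (k : ℝ) ^ e) * (k : ℝ) ^ 3 := by
            gcongr
            exact hgr k hk1k
        _ = ‖kern (a + n) b c (d + k₁)‖ * (k : ℝ) ^ (e + 3) := by ring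
        _ ≤ _ := by gcongr
    · calc _ ≤ ‖kern (a + n) b c (d + K)‖ * (K : ℝ) ^ 3 :=
            norm_kern_mul_le h (le_max_right _ _) hkK
        _ ≤ (‖kern (a + n) b c (d + k₁)‖ * (K : ℝ) ^ e) * (K : ℝ) ^ 3 := by
            gcongr
            exact hgr K (le_max_left _ _)
        _ = _ := by ring
  have hqpow : q ^ (k₁ - k₀) ≤ q ^ (δ * n - 1) := by
    refine pow_nat_le_rpow hq0 hq1.le ?_
    rw [Nat.cast_sub h01]
    linarith
  refine norm_Phi_le_of_kern (by omega) (hmain.trans ?_)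
  have hM0 : 0 ≤ M := (norm_nonneg _).trans hbase
  have hq3 : 0 ≤ q ^ (δ * n - 1) := (Real.rpow_pos_of_pos hq0 _).le
  have : ‖kern (a + n) b c (d + k₁)‖ ≤ M * q ^ (δ * n - 1) := by
    refine hgeom.trans ?_
    rw [mul_comm]
    gcongr
  gcongr

set_option maxHeartbeats 2000000 in
/-- The kernel is negligible to the left of its peak. -/
theorem far_left (h : Admissible a b c d) (hδ : 0 < δ) (hδ' : δ ≤ 1 / 100)
    (hM : ∀ᶠ n : ℕ in atTop, ∀ k : ℕ, |(k : ℝ) / n - peak| ≤ 3 / 2 * δ →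
      ‖kern (a + n) b c (d + k)‖ ≤ M) :
    ∃ ε : ℕ → ℝ, Tendsto ε atTop (𝓝 0) ∧ ∀ᶠ n : ℕ in atTop, ∀ k : ℕ, (k : ℝ) ≤ (peak - 2 * δ) * n →
      ‖Phi (a + n) b c (d + k)‖ ≤ ε n / ((k : ℝ) + 1) ^ 2 := by
  have hs4 := one_le_shiftBound a b c d
  have hp := peak_gt
  have hp' := peak_lt
  have hpsq := peak_sq
  set s := shiftBound a b c d with hs
  -- `left_strong` with `η = 6δ`, from `4(3/4 - 1.5δ) + 6δ = 3`.
  set q := 1 - 3 / 4 * δ with hq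
  have hq0 : 0 < q := by linarith
  have hq1 : q < 1 := by linarith
  refine ⟨fun n => (2 + s) * ((n : ℝ) + 1) ^ 3 * (Real.exp (400 * s) * (M * q ^ (δ * n - 1))), ?_, ?_⟩
  · have := (tendsto_pow_mul_rpow hq0 hq1 hδ 3).const_mul ((2 + s) * Real.exp (400 * s) * M)
    rw [mul_zero] at this
    refine this.congr fun n => ?_
    ring
  filter_upwards [hM, eventually_ge_atTop 1, tendsto_natCast_atTop_atTop.eventually_ge_atTop (2 / δ),
    tendsto_natCast_atTop_atTop.eventually_ge_atTop (1000 * s / δ)] with n hM hn1 hn2 hn3 k hk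
  have hn1' : (1 : ℝ) ≤ n := by exact_mod_cast hn1
  have hn0' : (0 : ℝ) < n := by linarith
  rw [div_le_iff₀ hδ] at hn2 hn3
  set k₀ := ⌊(peak - δ) * n⌋₊ with hk₀
  set k₁ := ⌊(peak - 2 * δ) * n⌋₊ with hk₁
  have nn0 : 0 ≤ (peak - δ) * n := mul_nonneg (by linarith) hn0'.le
  have nn1 : 0 ≤ (peak - 2 * δ) * n := mul_nonneg (by linarith) hn0'.le
  have a0 : (k₀ : ℝ) ≤ (peak - δ) * n := Nat.floor_le nn0
  have a1 : (peak - δ) * n < k₀ + 1 := Nat.lt_floor_add_one _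
  have b0 : (k₁ : ℝ) ≤ (peak - 2 * δ) * n := Nat.floor_le nn1
  have b1 : (peak - 2 * δ) * n < k₁ + 1 := Nat.lt_floor_add_one _
  have h01 : k₁ ≤ k₀ := Nat.floor_mono (by nlinarith)
  have hkk1 : k ≤ k₁ := Nat.le_floor hk
  have hns : 1000 * s ≤ n := by nlinarith
  have hbase : ‖kern (a + n) b c (d + k₀)‖ ≤ M := by
    refine hM k₀ ?_
    rw [abs_le]
    constructor
    · rw [le_sub_iff_add_le, le_div_iff₀ (by positivity)]
      nlinarith
    · rw [sub_le_iff_le_add, div_le_iff₀ (by positivity)]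
      nlinarith
  have hgeom : ‖kern (a + n) b c (d + k₁)‖ ≤ q ^ (k₀ - k₁) * ‖kern (a + n) b c (d + k₀)‖ := by
    refine le_pow_mul_of_le_succ (u := fun j : ℕ => ‖kern (a + n) b c (d + j)‖) hq0.le h01 ?_
    intro j hj hj'
    have hj1 : (peak - 2 * δ) * n - 1 ≤ j := by
      have : (k₁ : ℝ) ≤ j := by exact_mod_cast hj
      linarith
    have hj2 : (j : ℝ) ≤ (peak - δ) * n := le_trans (by exact_mod_cast hj'.le) a0
    have hsq : (j : ℝ) ^ 2 ≤ (3 / 4 - 1.5 * δ) * (n : ℝ) ^ 2 := by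
      have : (j : ℝ) ^ 2 ≤ ((peak - δ) * n) ^ 2 := by gcongr
      refine this.trans ?_
      rw [mul_pow]
      gcongr
      nlinarith
    have hnn : 0 ≤ δ * (n : ℝ) ^ 2 := by positivity
    have key := norm_kern_le_succ h hn1 hns (by nlinarith)
      (left_strong (m := (j : ℝ) / n) (η := 6 * δ) (t := s / n)
        (by rw [le_div_iff₀ hn0']; nlinarith)
        (by
          rw [div_pow, ← mul_div_assoc, div_add' _ _ _ (by positivity), div_le_iff₀ (by positivity)]
          nlinarith)
        (by positivity) (by positivity)
        (by rw [div_le_iff₀ hn0']; linarith)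
        (by rw [← mul_div_assoc, div_le_iff₀ hn0']; nlinarith))
    refine key.trans (mul_le_mul_of_nonneg_right ?_ (norm_nonneg _))
    rw [hq]
    nlinarith
  -- There are at most `n` steps, each costing at most `(1 + 200 s/n)²`, so the total stays bounded.
  have hmild : ‖kern (a + n) b c (d + k)‖ ≤ Real.exp (400 * s) * ‖kern (a + n) b c (d + k₁)‖ := by
    have h1 : ‖kern (a + n) b c (d + k)‖
        ≤ ((1 + 200 * (s / n)) ^ 2) ^ (k₁ - k) * ‖kern (a + n) b c (d + k₁)‖ := by
      refine le_pow_mul_of_le_succ (u := fun j : ℕ => ‖kern (a + n) b c (d + j)‖)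
        (by positivity) hkk1 ?_
      intro j hj hj'
      have hj2 : (j : ℝ) ≤ (peak - 2 * δ) * n := le_trans (by exact_mod_cast hj'.le) b0
      have hsq : (j : ℝ) ^ 2 ≤ 3 / 4 * (n : ℝ) ^ 2 := by
        have : (j : ℝ) ^ 2 ≤ (peak * n) ^ 2 := by
          gcongr
          nlinarith
        rwa [mul_pow, hpsq] at this
      exact norm_kern_le_succ h hn1 hns (by linarith)
        (left_mild (m := (j : ℝ) / n) (by positivity)
          (by rw [div_pow, ← mul_div_assoc, div_le_iff₀ (by positivity)]; linarith)
          (by positivity) (by rw [div_le_iff₀ hn0']; linarith))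
    refine h1.trans (mul_le_mul_of_nonneg_right ?_ (norm_nonneg _))
    have h2 : k₁ - k ≤ n := by
      have : (k₁ : ℝ) ≤ n := by nlinarith
      have : k₁ ≤ n := by exact_mod_cast this
      omega
    calc ((1 + 200 * (s / n)) ^ 2) ^ (k₁ - k) ≤ ((1 + 200 * (s / n)) ^ 2) ^ n := by
          refine pow_le_pow_right₀ (one_le_pow₀ ?_) h2
          have : 0 ≤ s / n := by positivity
          linarith
      _ ≤ (Real.exp (200 * (s / n)) ^ 2) ^ n := by
          have := Real.add_one_le_exp (200 * (s / n))
          have h0 : 0 ≤ s / n := by positivity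
          gcongr
          linarith
      _ = Real.exp (400 * s) := by
          rw [← pow_mul, ← Real.exp_nat_mul]
          congr 1
          push_cast
          field_simp
          ring
  have hqpow : q ^ (k₀ - k₁) ≤ q ^ (δ * n - 1) := by
    refine pow_nat_le_rpow hq0 hq1.le ?_
    rw [Nat.cast_sub h01]
    linarith
  have hM0 : 0 ≤ M := (norm_nonneg _).trans hbase
  have hq3 : 0 ≤ q ^ (δ * n - 1) := (Real.rpow_pos_of_pos hq0 _).le
  have hfin : ‖kern (a + n) b c (d + k)‖ ≤ Real.exp (400 * s) * (M * q ^ (δ * n - 1)) := by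
    refine hmild.trans ?_
    gcongr
    refine hgeom.trans ?_
    rw [mul_comm]
    gcongr
  have hkn : (k : ℝ) ≤ n := by nlinarith
  rw [le_div_iff₀ (by positivity)]
  calc ‖Phi (a + n) b c (d + k)‖ * ((k : ℝ) + 1) ^ 2
      ≤ ((2 * k + s) * ‖kern (a + n) b c (d + k)‖) * ((k : ℝ) + 1) ^ 2 := by
        gcongr
        exact norm_Phi_le
    _ ≤ (((2 + s) * ((n : ℝ) + 1)) * (Real.exp (400 * s) * (M * q ^ (δ * n - 1)))) * ((n : ℝ) + 1) ^ 2 := by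
        gcongr
        nlinarith
    _ = _ := by ring

end Far

end Seed9
end

/-! ### The limit of the row sums. -/

noncomputable section
namespace Seed9
open Filter Topology

/-- The model of `Phi` near its peak. -/
def modelPhi (n k : ℕ) : ℝ := modelConst * (2 * k * model n k)

theorem modelConst_pos : 0 < modelConst := Real.exp_pos _

theorem modelPhi_pos {n k : ℕ} (hn : 0 < n) (h1 : k < n) (h2 : n < 2 * k) : 0 < modelPhi n k := by
  have := model_pos hn h1 h2
  have := modelConst_pos
  have : (0 : ℝ) < k := by exact_mod_cast (by omega : 0 < k)
  unfold modelPhi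
  positivity

/-- Convergence along `peakFilter` is uniform over a whole band of `k` around `peak * n`, not merely
along sequences. -/
theorem exists_of_eventually_peakFilter {p : ℕ × ℕ → Prop} (h : ∀ᶠ q in peakFilter, p q) :
    ∃ r : ℝ, 0 < r ∧ ∀ᶠ n : ℕ in atTop, ∀ k : ℕ, |(k : ℝ) / n - peak| < r → p (n, k) := by
  have hb := (atTop_basis.comap (Prod.fst : ℕ × ℕ → ℕ)).inf
    ((Metric.nhds_basis_ball (x := peak)).comap (fun q : ℕ × ℕ => (q.2 : ℝ) / q.1))
  obtain ⟨⟨N, r⟩, ⟨-, hr⟩, hs⟩ := hb.eventually_iff.1 h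
  refine ⟨r, hr, ?_⟩
  filter_upwards [eventually_ge_atTop N] with n hn k hk
  refine hs ⟨hn, ?_⟩
  simpa [Real.dist_eq] using hk

theorem tendsto_Phi_div_modelPhi (a b c d : ℂ) :
    Tendsto (fun q : ℕ × ℕ => Phi (a + q.1) b c (d + q.2) / modelPhi q.1 q.2) peakFilter
      (𝓝 1) := by
  have hc : (modelConst : ℂ) ≠ 0 := by exact_mod_cast modelConst_pos.ne'
  have hk : Tendsto Prod.snd peakFilter atTop :=
    tendsto_atTop_of_ratio (by linarith [peak_gt]) tendsto_fst_peakFilter tendsto_ratio_peakFilter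
  have h1 : Tendsto (fun q : ℕ × ℕ => (2 * d + 1) / 2 / (q.2 : ℂ) + 1) peakFilter (𝓝 1) := by
    have := ((tendsto_const_div_atTop_nhds_zero_nat ((2 * d + 1) / 2)).comp hk).add_const 1
    simpa using this
  have h2 := (h1.mul (tendsto_kern_div_model a b c d)).div_const (modelConst : ℂ)
  rw [one_mul, div_self hc] at h2
  refine h2.congr' ?_
  filter_upwards [eventually_peakFilter] with q hq
  have hk0 : (q.2 : ℂ) ≠ 0 := by exact_mod_cast (by omega : q.2 ≠ 0)
  have hm : (model q.1 q.2 : ℂ) ≠ 0 := by exact_mod_cast (model_pos hq.1 hq.2.1 hq.2.2).ne'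
  unfold Phi modelPhi
  push_cast
  field_simp
  ring

theorem eventually_Phi_near (a b c d : ℂ) {ε : ℝ} (hε : 0 < ε) :
    ∃ r : ℝ, 0 < r ∧ ∀ᶠ n : ℕ in atTop, ∀ k : ℕ, |(k : ℝ) / n - peak| < r →
      0 < modelPhi n k ∧ ‖Phi (a + n) b c (d + k) - modelPhi n k‖ ≤ ε * modelPhi n k := by
  have h := (tendsto_Phi_div_modelPhi a b c d).eventually (Metric.closedBall_mem_nhds _ hε)
  have h' := h.and eventually_peakFilter
  obtain ⟨r, hr, hn⟩ := exists_of_eventually_peakFilter h'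
  refine ⟨r, hr, hn.mono fun n hn k hk => ?_⟩
  obtain ⟨h1, h2, h3, h4⟩ := hn k hk
  have hpos := modelPhi_pos h2 h3 h4
  refine ⟨hpos, ?_⟩
  have hne : (modelPhi n k : ℂ) ≠ 0 := by exact_mod_cast hpos.ne'
  rw [dist_eq_norm] at h1
  have e : Phi (a + n) b c (d + k) - modelPhi n k
      = (Phi (a + n) b c (d + k) / modelPhi n k - 1) * modelPhi n k := by field_simp
  rw [e, norm_mul, Complex.norm_real, Real.norm_eq_abs, abs_of_pos hpos]
  gcongr

/-- A nonnegative term is at most its row sum `1/(8π)`. This is the source of the a priori bound on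
the model. -/
theorem norm_Phi_ref_le {n : ℕ} (hn : 0 < n) (k : ℕ) :
    ‖Phi (1 / 4 + n) (-1 / 4) (1 / 4) (1 / 4 + k)‖ ≤ 1 := by
  choose f hf0 hf using Phi_ref_nonneg n
  have h := hasSum_Phi_ref hn
  simp only [hf] at h ⊢
  have h' : HasSum f (1 / (8 * Real.pi)) := by exact_mod_cast h
  rw [Complex.norm_real, Real.norm_eq_abs, abs_of_nonneg (hf0 k)]
  have h1 := le_hasSum h' k fun j _ => hf0 j
  refine h1.trans ?_
  rw [div_le_one (by positivity)]
  linarith [Real.pi_gt_three]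

theorem hasSum_norm_Phi_ref {n : ℕ} (hn : 0 < n) :
    HasSum (fun k : ℕ => ‖Phi (1 / 4 + n) (-1 / 4) (1 / 4) (1 / 4 + k)‖) (1 / (8 * Real.pi)) := by
  choose f hf0 hf using Phi_ref_nonneg n
  have h := hasSum_Phi_ref hn
  simp only [hf] at h ⊢
  simp only [Complex.norm_real, Real.norm_eq_abs, abs_of_nonneg (hf0 _)]
  exact_mod_cast h

/-- Away from the peak, `Phi` is dominated by a null sequence times a summable one. -/
theorem far_bound {a b c d : ℂ} (h : Admissible a b c d) :
    ∃ r : ℝ, 0 < r ∧ ∀ δ : ℝ, 0 < δ → δ ≤ r → ∃ ε : ℕ → ℝ, Tendsto ε atTop (𝓝 0) ∧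
      ∀ᶠ n : ℕ in atTop, ∀ k : ℕ, 2 * δ ≤ |(k : ℝ) / n - peak| →
        ‖Phi (a + n) b c (d + k)‖ ≤ ε n / ((k : ℝ) + 1) ^ 2 := by
  obtain ⟨r₁, hr₁, h₁⟩ := eventually_Phi_near a b c d one_pos
  obtain ⟨r₂, hr₂, h₂⟩ := eventually_Phi_near (1 / 4) (-1 / 4) (1 / 4) (1 / 4)
    (by norm_num : (0 : ℝ) < 1 / 2)
  refine ⟨min (min r₁ r₂ / 2) (1 / 100), by positivity, fun δ hδ hδr => ?_⟩
  have hδ1 : δ ≤ r₁ / 2 := hδr.trans ((min_le_left _ _).trans (by gcongr; exact min_le_left _ _))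
  have hδ2 : δ ≤ r₂ / 2 := hδr.trans ((min_le_left _ _).trans (by gcongr; exact min_le_right _ _))
  have hδ3 : δ ≤ 1 / 100 := hδr.trans (min_le_right _ _)
  -- The model is at most twice the reference value, hence at most `2`, and `Phi` is at most twice
  -- the model. Since `|2(d+k)+1| ≥ 1` near the peak, `kern` is no larger than `Phi`.
  have hM : ∀ᶠ n : ℕ in atTop, ∀ k : ℕ, |(k : ℝ) / n - peak| ≤ 3 / 2 * δ →
      ‖kern (a + n) b c (d + k)‖ ≤ 4 := by
    filter_upwards [h₁, h₂, eventually_gt_atTop 0,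
      tendsto_natCast_atTop_atTop.eventually_ge_atTop (2 * shiftBound a b c d)]
      with n h₁ h₂ hn hns k hk
    obtain ⟨p1, b1⟩ := h₁ k (by linarith)
    obtain ⟨-, b2⟩ := h₂ k (by linarith)
    have b3 := norm_Phi_ref_le hn k
    have hn' : (0 : ℝ) < n := by exact_mod_cast hn
    have t1 : ‖(modelPhi n k : ℂ)‖ = modelPhi n k := by
      rw [Complex.norm_real, Real.norm_eq_abs, abs_of_pos p1]
    have t2 := norm_sub_norm_le (modelPhi n k : ℂ) (Phi (1 / 4 + n) (-1 / 4) (1 / 4) (1 / 4 + k))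
    rw [norm_sub_rev, t1] at t2
    have t3 := norm_sub_norm_le (Phi (a + n) b c (d + k)) (modelPhi n k : ℂ)
    rw [t1] at t3
    have b4 : ‖Phi (a + n) b c (d + k)‖ ≤ 4 := by linarith
    refine le_trans ?_ b4
    unfold Phi
    rw [norm_mul]
    refine le_mul_of_one_le_left (norm_nonneg _) ?_
    have hs4 := one_le_shiftBound a b c d
    have hkn : 0.8 * n ≤ (k : ℝ) := by
      have := (abs_le.1 hk).1
      have h5 : 0.8 ≤ (k : ℝ) / n := by linarith [peak_gt]
      rwa [le_div_iff₀ hn'] at h5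
    have u1 := norm_sub_norm_le ((2 * k : ℕ) : ℂ) (-(2 * d + 1))
    rw [Complex.norm_natCast, norm_neg, sub_neg_eq_add] at u1
    have u2 : ‖2 * d + 1‖ ≤ shiftBound a b c d := by
      convert norm_shift_le a b c d (x₁ := 0) (x₂ := 0) (x₃ := 0) (x₄ := 2) (y := 1)
        (by decide) (by decide) (by decide) (by decide) (by rw [abs_le]; norm_num) using 2
      push_cast
      ring
    rw [show 2 * (d + k) + 1 = ((2 * k : ℕ) : ℂ) + (2 * d + 1) by push_cast; ring]
    push_cast at u1 ⊢
    linarith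
  obtain ⟨ε₁, he₁, H₁⟩ := far_right h hδ hδ3 hM
  obtain ⟨ε₂, he₂, H₂⟩ := far_left h hδ hδ3 hM
  refine ⟨fun n => |ε₁ n| + |ε₂ n|, by simpa using he₁.abs.add he₂.abs, ?_⟩
  filter_upwards [H₁, H₂, eventually_gt_atTop 0] with n H₁ H₂ hn k hk
  have hn' : (0 : ℝ) < n := by exact_mod_cast hn
  rcases le_abs.1 hk with hk | hk
  · refine (H₁ k ?_).trans ?_
    · rw [← le_div_iff₀ hn']
      linarith
    · gcongr
      linarith [le_abs_self (ε₁ n), abs_nonneg (ε₂ n)]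
  · refine (H₂ k ?_).trans ?_
    · rw [← div_le_iff₀ hn']
      linarith
    · gcongr
      linarith [le_abs_self (ε₂ n), abs_nonneg (ε₁ n)]

/-- The limit of the row sums does not depend on the parameters. -/
theorem tendsto_tsum_Phi {a b c d : ℂ} (h : Admissible a b c d) :
    Tendsto (fun n : ℕ => ∑' k : ℕ, Phi (a + n) b c (d + k)) atTop (𝓝 (1 / (8 * Real.pi))) := by
  rw [Metric.tendsto_nhds]
  intro η hη
  set ε : ℝ := min (1 / 2) (η / 2) with hε
  have hε0 : 0 < ε := by positivity
  have hε2 : ε ≤ 1 / 2 := min_le_left _ _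
  have hεη : ε ≤ η / 2 := min_le_right _ _
  obtain ⟨r₁, hr₁, h₁⟩ := eventually_Phi_near a b c d hε0
  obtain ⟨r₂, hr₂, h₂⟩ := eventually_Phi_near (1 / 4) (-1 / 4) (1 / 4) (1 / 4) hε0
  obtain ⟨r₃, hr₃, h₃⟩ := far_bound h
  obtain ⟨r₄, hr₄, h₄⟩ := far_bound admissible_ref
  set δ := min (min (r₁ / 3) (r₂ / 3)) (min r₃ r₄) with hδ
  have hδ0 : 0 < δ := by positivity
  have d1 : δ ≤ r₁ / 3 := (min_le_left _ _).trans (min_le_left _ _)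
  have d2 : δ ≤ r₂ / 3 := (min_le_left _ _).trans (min_le_right _ _)
  obtain ⟨ε₃, he₃, h₃⟩ := h₃ δ hδ0 ((min_le_right _ _).trans (min_le_left _ _))
  obtain ⟨ε₄, he₄, h₄⟩ := h₄ δ hδ0 ((min_le_right _ _).trans (min_le_right _ _))
  set T := ∑' k : ℕ, 1 / ((k : ℝ) + 1) ^ 2
  have hlim : Tendsto (fun n => (|ε₃ n| + |ε₄ n|) * T) atTop (𝓝 0) := by
    simpa using (he₃.abs.add he₄.abs).mul_const T
  filter_upwards [h₁, h₂, h₃, h₄, eventually_gt_atTop 0, hlim.eventually (gt_mem_nhds (half_pos hη))]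
    with n h₁ h₂ h₃ h₄ hn hT
  -- Near the peak both functions are within `ε` times the model of the model, and the model is at
  -- most twice the reference value; far from it both are small on their own.
  have hpt : ∀ k : ℕ, ‖Phi (a + n) b c (d + k) - Phi (1 / 4 + n) (-1 / 4) (1 / 4) (1 / 4 + k)‖
      ≤ 4 * ε * ‖Phi (1 / 4 + n) (-1 / 4) (1 / 4) (1 / 4 + k)‖
        + (|ε₃ n| + |ε₄ n|) * (1 / ((k : ℝ) + 1) ^ 2) := by
    intro k
    set f := Phi (a + n) b c (d + k)
    set g := Phi (1 / 4 + n) (-1 / 4) (1 / 4) (1 / 4 + k)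
    rcases lt_or_ge |(k : ℝ) / n - peak| (2 * δ) with hk | hk
    · obtain ⟨p1, b1⟩ := h₁ k (by linarith)
      obtain ⟨-, b2⟩ := h₂ k (by linarith)
      change ‖f - modelPhi n k‖ ≤ ε * modelPhi n k at b1
      change ‖g - modelPhi n k‖ ≤ ε * modelPhi n k at b2
      have t1 : ‖(modelPhi n k : ℂ)‖ = modelPhi n k := by
        rw [Complex.norm_real, Real.norm_eq_abs, abs_of_pos p1]
      have t2 := norm_sub_norm_le (modelPhi n k : ℂ) g
      rw [norm_sub_rev, t1] at t2
      have t3 := norm_sub_le_norm_sub_add_norm_sub f (modelPhi n k : ℂ) g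
      rw [norm_sub_rev (modelPhi n k : ℂ) g] at t3
      have t4 : 0 ≤ (|ε₃ n| + |ε₄ n|) * (1 / ((k : ℝ) + 1) ^ 2) := by positivity
      have t5 : modelPhi n k ≤ 2 * ‖g‖ := by nlinarith
      nlinarith
    · have b1 : ‖f‖ ≤ _ := h₃ k hk
      have b2 : ‖g‖ ≤ _ := h₄ k hk
      have t1 := norm_sub_le f g
      have t2 : ε₃ n / ((k : ℝ) + 1) ^ 2 ≤ |ε₃ n| * (1 / ((k : ℝ) + 1) ^ 2) := by
        rw [mul_one_div]
        gcongr
        exact le_abs_self _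
      have t3 : ε₄ n / ((k : ℝ) + 1) ^ 2 ≤ |ε₄ n| * (1 / ((k : ℝ) + 1) ^ 2) := by
        rw [mul_one_div]
        gcongr
        exact le_abs_self _
      have t4 : 0 ≤ 4 * ε * ‖g‖ := by positivity
      rw [add_mul]
      linarith
  have hsr := hasSum_Phi_ref hn
  have hd : HasSum (fun k : ℕ => Phi (a + n) b c (d + k)
      - Phi (1 / 4 + n) (-1 / 4) (1 / 4) (1 / 4 + k)) _ := (summable_Phi h n).hasSum.sub hsr
  have hb := ((hasSum_norm_Phi_ref hn).mul_left (4 * ε)).add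
    (summable_inv_succ_sq.hasSum.mul_left (|ε₃ n| + |ε₄ n|))
  have := hd.norm_le_of_bounded hb hpt
  rw [dist_eq_norm]
  refine this.trans_lt ?_
  have hpi : 4 * ε * (1 / (8 * Real.pi)) ≤ ε := by
    rw [mul_one_div, div_le_iff₀ (by positivity)]
    nlinarith [Real.pi_gt_three]
  linarith

end Seed9
end

/-! ### Reflection, and `F` as a multiple of `Phi`. -/

noncomputable section
namespace Seed9
open Filter Topology

/-- `z` is not an integer. -/
def NonInt (z : ℂ) : Prop := ∀ m : ℤ, z ≠ m

theorem NonInt.add_int {z w : ℂ} (h : NonInt z) (m : ℤ) (hw : w = z + m) : NonInt w := by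
  intro j hj
  refine h (j - m) ?_
  push_cast
  linear_combination hj - hw

theorem NonInt.neg {z w : ℂ} (h : NonInt z) (hw : w = -z) : NonInt w := by
  intro j hj
  refine h (-j) ?_
  push_cast
  linear_combination -hj + hw

theorem NonInt.ne_zero {z : ℂ} (h : NonInt z) : z ≠ 0 := by simpa using h 0

theorem nonInt_of_norm_lt_one {z : ℂ} (h0 : z ≠ 0) (h : ‖z‖ < 1) : NonInt z := by
  rintro m rfl
  rw [Complex.norm_intCast] at h
  have : |m| < 1 := by exact_mod_cast h
  have : m = 0 := by rwa [Int.abs_lt_one_iff] at this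
  simp [this] at h0

theorem nonInt_half_add {z : ℂ} (h : ‖z‖ < 1 / 2) : NonInt (1 / 2 + z) := by
  intro m hm
  have hz : z = ((m - 1 / 2 : ℝ) : ℂ) := by push_cast; linear_combination hm
  rw [hz, Complex.norm_real, Real.norm_eq_abs, abs_lt] at h
  have h1 : (0 : ℝ) < m := by linarith [h.1]
  have h2 : (m : ℝ) < 1 := by linarith [h.2]
  have h1' : 0 < m := by exact_mod_cast h1
  have h2' : m < 1 := by exact_mod_cast h2
  omega

theorem NonInt.Gamma_ne_zero {z : ℂ} (h : NonInt z) : Complex.Gamma z ≠ 0 :=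
  Complex.Gamma_ne_zero fun m => by simpa using h (-m)

theorem NonInt.sin_ne_zero {z : ℂ} (h : NonInt z) : Complex.sin (Real.pi * z) ≠ 0 := by
  rw [Ne, Complex.sin_eq_zero_iff]
  rintro ⟨k, hk⟩
  have hpi : (Real.pi : ℂ) ≠ 0 := by exact_mod_cast Real.pi_ne_zero
  refine h k (mul_left_cancel₀ hpi ?_)
  rw [hk, mul_comm]

theorem NonInt.Gamma_succ {z w : ℂ} (h : NonInt z) (hw : w = z + 1) :
    Complex.Gamma w = z * Complex.Gamma z := by
  rw [hw, Complex.Gamma_add_one z h.ne_zero]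

/-- A device for cancellation: all relations `z * z⁻¹ = 1` and squares of signs are gathered in `t`,
so that `ring` can finish with the inverses as atoms. -/
theorem eq_of_eq_mul_one {x y t : ℂ} (ht : t = 1) (h : x = y * t) : x = y := by
  rw [h, ht, mul_one]

theorem neg_one_zpow_mul_self (m : ℤ) : ((-1 : ℂ) ^ m) * (-1) ^ m = 1 := by
  rw [← mul_zpow]; simp

/-- The reflection formula at an integer shift. -/
theorem NonInt.Gamma_reflect {w z y : ℂ} (h : NonInt w) (m : ℤ) (hz : z = w + m)
    (hy : y = 1 - z) : Complex.Gamma y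
      = (-1) ^ m * (Real.pi / Complex.sin (Real.pi * w)) * (Complex.Gamma z)⁻¹ := by
  have hz' := h.add_int m hz
  have h1 := Complex.Gamma_mul_Gamma_one_sub z
  have h2 : Complex.sin (Real.pi * z) = (-1) ^ m * Complex.sin (Real.pi * w) := by
    rw [hz, mul_add, mul_comm (Real.pi : ℂ) (m : ℂ), Complex.sin_antiperiodic.add_int_mul_eq,
      Int.cast_negOnePow]
  have hs := h.sin_ne_zero
  have hm := neg_one_zpow_mul_self m
  have hm0 : (-1 : ℂ) ^ m ≠ 0 := zpow_ne_zero _ (by norm_num)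
  rw [h2] at h1
  rw [hy]
  have hG := hz'.Gamma_ne_zero
  field_simp at h1 ⊢
  linear_combination (-1 : ℂ) ^ m * h1 - Complex.Gamma z * Complex.Gamma (1 - z)
    * Complex.sin (Real.pi * w) * hm

/-- The reflection formula around `1 / 2`. -/
theorem inv_Gamma_reflect_half {w y x : ℂ} (h : ‖w‖ < 1 / 2) (n : ℕ) (hy : y = 1 / 2 - (w + n))
    (hx : x = w + n + 1 / 2) : (Complex.Gamma y)⁻¹
      = (-1) ^ n * (Complex.cos (Real.pi * w) * (Real.pi : ℂ)⁻¹) * Complex.Gamma x := by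
  have hN := nonInt_half_add h
  have h1 := hN.Gamma_reflect (n : ℤ) (z := x) (y := y) (by rw [hx]; push_cast; ring)
    (by rw [hy, hx]; ring)
  have h2 : Complex.sin (Real.pi * (1 / 2 + w)) = Complex.cos (Real.pi * w) := by
    rw [mul_add, add_comm, show (Real.pi : ℂ) * (1 / 2) = Real.pi / 2 by ring,
      Complex.sin_add_pi_div_two]
  rw [h2, zpow_natCast] at h1
  rw [h1, mul_inv, mul_inv, inv_inv, inv_div, ← inv_pow, div_eq_mul_inv]
  norm_num

/-- With `r = 1/100` the result is below `1/2`, so every form plus `1/2` or `1` stays in the right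
half plane. -/
theorem norm_lt_of_small {a b c d : ℂ} {r : ℝ} (ha : ‖a‖ < r) (hb : ‖b‖ < r) (hc : ‖c‖ < r)
    (hd : ‖d‖ < r) {x₁ x₂ x₃ x₄ : ℤ} (h₁ : |x₁| ≤ 2) (h₂ : |x₂| ≤ 2) (h₃ : |x₃| ≤ 2)
    (h₄ : |x₄| ≤ 2) {z : ℂ} (hz : z = x₁ * a + x₂ * b + x₃ * c + x₄ * d) : ‖z‖ < 8 * r := by
  have key : ∀ (x : ℤ) (z : ℂ), |x| ≤ 2 → ‖(x : ℂ) * z‖ ≤ 2 * ‖z‖ := by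
    intro x z hx
    rw [norm_mul]
    gcongr
    rw [Complex.norm_intCast]
    exact_mod_cast hx
  have := norm_add_le ((x₁ : ℂ) * a + x₂ * b + x₃ * c) (x₄ * d)
  have := norm_add_le ((x₁ : ℂ) * a + x₂ * b) (x₃ * c)
  have := norm_add_le ((x₁ : ℂ) * a) (x₂ * b)
  have := key _ a h₁
  have := key _ b h₂
  have := key _ c h₃
  have := key _ d h₄
  rw [hz]
  linarith

theorem add_re_pos_of_norm_lt {z : ℂ} {x : ℝ} (h : ‖z‖ < x) : 0 < (z + x).re := by
  have := (abs_le.1 (Complex.abs_re_le_norm z)).1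
  simp
  linarith

/-- The parameters are close to the origin. -/
structure Small (a b c d : ℂ) : Prop where
  ha : ‖a‖ < 1 / 100
  hb : ‖b‖ < 1 / 100
  hc : ‖c‖ < 1 / 100
  hd : ‖d‖ < 1 / 100

/-- The parameters are close to the origin, and `a + b`, `a - d`, `a + b + c - d` do not
vanish. -/
structure Generic (a b c d : ℂ) : Prop extends Small a b c d where
  hab : a + b ≠ 0
  had : a - d ≠ 0
  habcd : a + b + c - d ≠ 0

variable {a b c d : ℂ}

theorem Small.admissible (h : Small a b c d) : Admissible a b c d := by
  obtain ⟨ha, hb, hc, hd⟩ := h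
  have key : ∀ (x₁ x₂ x₃ x₄ : ℤ), |x₁| ≤ 2 → |x₂| ≤ 2 → |x₃| ≤ 2 → |x₄| ≤ 2 →
      0 < (x₁ * a + x₂ * b + x₃ * c + x₄ * d + 1 / 2 : ℂ).re := by
    intro x₁ x₂ x₃ x₄ h₁ h₂ h₃ h₄
    have := add_re_pos_of_norm_lt (x := 1 / 2)
      ((norm_lt_of_small ha hb hc hd h₁ h₂ h₃ h₄ rfl).trans (by norm_num))
    push_cast at this
    exact this
  constructor
  · convert key 1 2 1 0 (by decide) (by decide) (by decide) (by decide) using 2; push_cast; ring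
  · convert key 1 1 2 0 (by decide) (by decide) (by decide) (by decide) using 2; push_cast; ring
  · convert key 1 (-1) 0 0 (by decide) (by decide) (by decide) (by decide) using 2; push_cast; ring
  · convert key 1 0 (-1) 0 (by decide) (by decide) (by decide) (by decide) using 2; push_cast; ring
  · convert key 1 1 0 2 (by decide) (by decide) (by decide) (by decide) using 2; push_cast; ring
  · convert key 1 0 1 2 (by decide) (by decide) (by decide) (by decide) using 2; push_cast; ring

namespace Generic

theorem nonInt_ab (h : Generic a b c d) : NonInt (a + b) :=
  nonInt_of_norm_lt_one h.hab (by linarith [norm_add_le a b, h.ha, h.hb])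

theorem nonInt_ad (h : Generic a b c d) : NonInt (a - d) :=
  nonInt_of_norm_lt_one h.had (by linarith [norm_sub_le a d, h.ha, h.hd])

theorem nonInt_abcd (h : Generic a b c d) : NonInt (a + b + c - d) :=
  nonInt_of_norm_lt_one h.habcd (by
    linarith [norm_sub_le (a + b + c) d, norm_add_le (a + b) c, norm_add_le a b, h.ha, h.hb,
      h.hc, h.hd])

theorem norm_a_sub_b (h : Generic a b c d) : ‖a - b‖ < 1 / 2 := by
  linarith [norm_sub_le a b, h.ha, h.hb]

theorem norm_a_sub_c (h : Generic a b c d) : ‖a - c‖ < 1 / 2 := by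
  linarith [norm_sub_le a c, h.ha, h.hc]

/-- `F` is proportional to its regularization. -/
theorem F_eq (h : Generic a b c d) (n k : ℕ) :
    F a b c d n k = 8 * Real.pi * limitValue a b c d * Phi (a + n) b c (d + k) := by
  have hpi : (Real.pi : ℂ) ≠ 0 := by exact_mod_cast Real.pi_ne_zero
  unfold F Phi kern gammaNum limitValue
  rw [h.nonInt_ab.Gamma_reflect (n : ℤ) (z := a + b + n) (y := -a - b - n + 1)
      (by push_cast; ring) (by ring),
    h.nonInt_ad.Gamma_reflect (n - k : ℤ) (z := a - d + (n - k)) (y := -a + d + k - n + 1)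
      (by push_cast; ring) (by ring),
    h.nonInt_abcd.Gamma_reflect (n - k : ℤ) (z := a + b + c - d + (n - k))
      (y := -a - b - c + d + k - n + 1) (by push_cast; ring) (by ring)]
  simp only [div_eq_mul_inv, mul_inv]
  simp only [← one_div (2 : ℂ), one_mul, show (5 : ℂ) * (1 / 2) = 5 / 2 by norm_num]
  rw [inv_Gamma_reflect_half h.norm_a_sub_b n (y := -a + b - n + 1 / 2) (x := a - b + 1 / 2 + n)
      (by ring) (by ring),
    inv_Gamma_reflect_half h.norm_a_sub_c n (y := -a + c - n + 1 / 2) (x := a - c + 1 / 2 + n)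
      (by ring) (by ring),
    show a + 2 * b + c + n + 1 / 2 = a + n + 2 * b + c + 1 / 2 by ring,
    show a + b + 2 * c + n + 1 / 2 = a + n + b + 2 * c + 1 / 2 by ring,
    show a + b + 2 * d + 2 * k + n + 1 / 2 = a + n + b + 2 * (d + k) + 1 / 2 by ring,
    show a + c + 2 * d + 2 * k + n + 1 / 2 = a + n + c + 2 * (d + k) + 1 / 2 by ring,
    show a - b + 1 / 2 + n = a + n - b + 1 / 2 by ring,
    show a - c + 1 / 2 + n = a + n - c + 1 / 2 by ring,
    show a + b + n = a + n + b by ring, show a + c + n = a + n + c by ring,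
    show -2 * (2 * a + b + c + 2 * n) = -2 * (2 * (a + n) + b + c) by ring,
    show 2 * a + b + c + 2 * n - 1 = 2 * (a + n) + b + c - 1 by ring,
    show a + d + k + n + 1 = a + n + (d + k) + 1 by ring,
    show a + b + c + d + k + n + 1 = a + n + b + c + (d + k) + 1 by ring,
    show a - d + (n - k) = a + n - (d + k) by ring,
    show a + b + c - d + (n - k) = a + n + b + c - (d + k) by ring,
    show -a - b + 2 * d + 2 * k - n + 5 / 2 = -(a + n) - b + 2 * (d + k) + 5 / 2 by ring,
    show -a - c + 2 * d + 2 * k - n + 5 / 2 = -(a + n) - c + 2 * (d + k) + 5 / 2 by ring,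
    zpow_natCast]
  have s1 : ((-1 : ℂ) ^ n) * (-1) ^ n = 1 := by rw [← mul_pow]; simp
  have s2 := neg_one_zpow_mul_self (n - k : ℤ)
  have s3 : (Real.pi : ℂ) * (Real.pi : ℂ)⁻¹ = 1 := mul_inv_cancel₀ hpi
  generalize (-1 : ℂ) ^ (n - k : ℤ) = σ at *
  generalize (-1 : ℂ) ^ n = τ at *
  generalize (Real.pi : ℂ)⁻¹ = ϖ at *
  -- The sign `(-1)^n` occurs four times: in `F`, in one sine reflection and in two cosine
  -- reflections. The sign `(-1)^(n-k)` occurs twice. Three factors `π` against two `π⁻¹` leave the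
  -- single `π` of `8πL`.
  have s4 : τ * τ * (τ * τ) * (σ * σ) * (Real.pi * ϖ * (Real.pi * ϖ)) = 1 := by
    rw [s1, s2, s3]; norm_num
  refine eq_of_eq_mul_one s4 ?_
  ring

/-- The first assertion about the row sums. -/
theorem summable_F (h : Generic a b c d) (n : ℕ) : Summable fun k => F a b c d n k := by
  simp only [h.F_eq]
  exact (summable_Phi h.admissible n).mul_left _

theorem tendsto_tsum_F (h : Generic a b c d) :
    Tendsto (fun n => ∑' k, F a b c d n k) atTop (𝓝 (limitValue a b c d)) := by
  have hpi : (Real.pi : ℂ) ≠ 0 := by exact_mod_cast Real.pi_ne_zero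
  have := (tendsto_tsum_Phi h.admissible).const_mul (8 * Real.pi * limitValue a b c d)
  simp only [h.F_eq, tsum_mul_left]
  convert this using 2
  field_simp

end Generic
end Seed9
end

/-! ### Hypergeometric terms and boundary values of the WZ pair. -/

noncomputable section
namespace Seed9
open Filter Topology

variable {a b c d : ℂ}

theorem eq_of_mul_one_eq {x y s t : ℂ} (hs : s = 1) (ht : t = 1) (h : x * s = y * t) :
    x = y := by
  rwa [hs, ht, mul_one, mul_one] at h

theorem norm_quartic_le {s : ℂ} {N : ℝ} (hN : 1 ≤ N) (hs : ‖s‖ ≤ N) (c₄ c₃ c₂ c₁ c₀ : ℂ) :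
    ‖c₄ * s ^ 4 + c₃ * s ^ 3 + c₂ * s ^ 2 + c₁ * s + c₀‖
      ≤ (‖c₄‖ + ‖c₃‖ + ‖c₂‖ + ‖c₁‖ + ‖c₀‖) * N ^ 4 := by
  have key : ∀ (x : ℂ) (j : ℕ), j ≤ 4 → ‖x * s ^ j‖ ≤ ‖x‖ * N ^ 4 := by
    intro x j hj
    rw [norm_mul, norm_pow]
    gcongr
    exact (pow_le_pow_left₀ (norm_nonneg _) hs j).trans (pow_le_pow_right₀ hN hj)
  have h4 := key c₄ 4 le_rfl
  have h3 := key c₃ 3 (by norm_num)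
  have h2 := key c₂ 2 (by norm_num)
  have h1 := key c₁ 1 (by norm_num)
  have h0 := key c₀ 0 (by norm_num)
  rw [pow_one] at h1
  rw [pow_zero, mul_one] at h0
  have := norm_add_le (c₄ * s ^ 4 + c₃ * s ^ 3 + c₂ * s ^ 2 + c₁ * s) c₀
  have := norm_add_le (c₄ * s ^ 4 + c₃ * s ^ 3 + c₂ * s ^ 2) (c₁ * s)
  have := norm_add_le (c₄ * s ^ 4 + c₃ * s ^ 3) (c₂ * s ^ 2)
  have := norm_add_le (c₄ * s ^ 4) (c₃ * s ^ 3)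
  linarith

theorem tendsto_add_natCast_div (x y : ℂ) :
    Tendsto (fun n : ℕ => (x + n) / (y + n)) atTop (𝓝 1) := by
  have h := ((tendsto_nat_div_add x).inv₀ one_ne_zero).mul (tendsto_nat_div_add y)
  rw [inv_one, mul_one] at h
  refine h.congr' ?_
  filter_upwards [eventually_gt_atTop 0] with n hn
  have hn' : (n : ℂ) ≠ 0 := by exact_mod_cast hn.ne'
  rw [inv_div]
  field_simp

/-- A ratio test allowing a quartic factor. -/
theorem summable_of_ratio_of_quartic {f g ρ : ℕ → ℂ} {l : ℂ} {K : ℝ} (hl : ‖l‖ < 1)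
    (hg : ∀ n, g (n + 1) = g n * ρ n) (hρ : Tendsto ρ atTop (𝓝 l))
    (hf : ∀ n : ℕ, ‖f n‖ ≤ K * (n + 1) ^ 4 * ‖g n‖) : Summable f := by
  obtain ⟨r, hr, hr1⟩ := exists_between hl
  have hs : Summable fun n : ℕ => ((1 : ℂ) + n) ^ 4 * g n := by
    have h1 : Tendsto (fun n : ℕ => (((2 : ℂ) + n) / (1 + n)) ^ 4 * ρ n) atTop (𝓝 l) := by
      simpa using ((tendsto_add_natCast_div 2 1).pow 4).mul hρ
    refine summable_of_ratio_norm_eventually_le hr1 ?_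
    filter_upwards [h1.norm.eventually_le_const hr] with n hn
    have h0 : (1 : ℂ) + n ≠ 0 := by exact_mod_cast (by omega : 1 + n ≠ 0)
    have e : ((1 : ℂ) + (n + 1 : ℕ)) ^ 4 * g (n + 1)
        = ((2 + n) / (1 + n)) ^ 4 * ρ n * ((1 + n) ^ 4 * g n) := by
      rw [hg]
      push_cast
      field_simp
      ring
    rw [e, norm_mul]
    gcongr
  refine Summable.of_norm_bounded (hs.norm.mul_left K) fun n => (hf n).trans_eq ?_
  rw [norm_mul, norm_pow, mul_assoc]
  have : ‖(1 : ℂ) + n‖ = (n : ℝ) + 1 := by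
    rw [show (1 : ℂ) + n = ((n + 1 : ℕ) : ℂ) by push_cast; ring, Complex.norm_natCast]
    push_cast; ring
  rw [this]

theorem norm_inv_le_two {z : ℂ} (n : ℕ) (hz : 1 / 2 ≤ z.re) : ‖(z + n)⁻¹‖ ≤ 2 := by
  have h1 : (1 : ℝ) / 2 ≤ (z + n).re := by
    have : (0 : ℝ) ≤ n := n.cast_nonneg
    simp at *
    linarith
  have h2 := (Complex.re_le_norm (z + n)).trans' h1
  rw [norm_inv]
  exact inv_le_of_inv_le₀ (by norm_num) (by linarith)

namespace Small

theorem re_pos (h : Small a b c d) {x₁ x₂ x₃ x₄ : ℤ} (h₁ : |x₁| ≤ 2) (h₂ : |x₂| ≤ 2)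
    (h₃ : |x₃| ≤ 2) (h₄ : |x₄| ≤ 2) {z : ℂ} {y : ℝ} (hy : 1 / 2 ≤ y)
    (hz : z = x₁ * a + x₂ * b + x₃ * c + x₄ * d + y) : 0 < z.re := by
  rw [hz]
  exact add_re_pos_of_norm_lt ((norm_lt_of_small h.ha h.hb h.hc h.hd h₁ h₂ h₃ h₄ rfl).trans_le
    (le_trans (by norm_num) hy))

theorem re_pos_ab (h : Small a b c d) : 0 < (a + b + 1).re :=
  h.re_pos (x₁ := 1) (x₂ := 1) (x₃ := 0) (x₄ := 0) (y := 1) (by decide) (by decide) (by decide)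
    (by decide) (by norm_num) (by push_cast; ring)

theorem re_pos_ac (h : Small a b c d) : 0 < (a + c + 1).re :=
  h.re_pos (x₁ := 1) (x₂ := 0) (x₃ := 1) (x₄ := 0) (y := 1) (by decide) (by decide) (by decide)
    (by decide) (by norm_num) (by push_cast; ring)

theorem re_pos_two_abc (h : Small a b c d) : 0 < (2 * a + b + c + 1).re :=
  h.re_pos (x₁ := 2) (x₂ := 1) (x₃ := 1) (x₄ := 0) (y := 1) (by decide) (by decide) (by decide)
    (by decide) (by norm_num) (by push_cast; ring)

theorem re_pos_ad (h : Small a b c d) : 0 < (a + d + 1).re :=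
  h.re_pos (x₁ := 1) (x₂ := 0) (x₃ := 0) (x₄ := 1) (y := 1) (by decide) (by decide) (by decide)
    (by decide) (by norm_num) (by push_cast; ring)

theorem re_pos_a_sub_d (h : Small a b c d) : 0 < (a - d + 1).re :=
  h.re_pos (x₁ := 1) (x₂ := 0) (x₃ := 0) (x₄ := -1) (y := 1) (by decide) (by decide) (by decide)
    (by decide) (by norm_num) (by push_cast; ring)

theorem re_pos_d_sub_a (h : Small a b c d) : 0 < (-a + d + 1).re :=
  h.re_pos (x₁ := -1) (x₂ := 0) (x₃ := 0) (x₄ := 1) (y := 1) (by decide) (by decide) (by decide)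
    (by decide) (by norm_num) (by push_cast; ring)

theorem re_pos_abcd (h : Small a b c d) : 0 < (a + b + c + d + 1).re :=
  h.re_pos (x₁ := 1) (x₂ := 1) (x₃ := 1) (x₄ := 1) (y := 1) (by decide) (by decide) (by decide)
    (by decide) (by norm_num) (by push_cast; ring)

theorem re_pos_abc_sub_d (h : Small a b c d) : 0 < (a + b + c - d + 1).re :=
  h.re_pos (x₁ := 1) (x₂ := 1) (x₃ := 1) (x₄ := -1) (y := 1) (by decide) (by decide) (by decide)
    (by decide) (by norm_num) (by push_cast; ring)

theorem re_pos_d_sub_abc (h : Small a b c d) : 0 < (-a - b - c + d + 1).re :=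
  h.re_pos (x₁ := -1) (x₂ := -1) (x₃ := -1) (x₄ := 1) (y := 1) (by decide) (by decide) (by decide)
    (by decide) (by norm_num) (by push_cast; ring)

theorem re_pos_dab (h : Small a b c d) : 0 < (-a - b + 2 * d + 1 / 2).re :=
  h.re_pos (x₁ := -1) (x₂ := -1) (x₃ := 0) (x₄ := 2) (y := 1 / 2) (by decide) (by decide)
    (by decide) (by decide) (by norm_num) (by push_cast; ring)

theorem re_pos_dac (h : Small a b c d) : 0 < (-a - c + 2 * d + 1 / 2).re :=
  h.re_pos (x₁ := -1) (x₂ := 0) (x₃ := -1) (x₄ := 2) (y := 1 / 2) (by decide) (by decide)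
    (by decide) (by decide) (by norm_num) (by push_cast; ring)

theorem norm_two_abc (h : Small a b c d) : ‖2 * a + b + c‖ < 1 := by
  have := norm_add_le (2 * a + b) c
  have := norm_add_le (2 * a) b
  rw [norm_mul, Complex.norm_ofNat] at this
  linarith [h.ha, h.hb, h.hc]

theorem norm_add_nat_le (h : Small a b c d) (n : ℕ) : ‖a + n‖ ≤ n + 1 := by
  have := norm_add_le a n
  rw [Complex.norm_natCast] at this
  linarith [h.ha]

theorem norm_inv_two_abc_le (h : Small a b c d) (n : ℕ) :
    ‖(2 * a + b + c + 2 * n + 1)⁻¹‖ ≤ 2 := by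
  have := norm_inv_le_two (z := 2 * a + b + c + 1) (2 * n) (by
    have h1 := (abs_le.1 (Complex.abs_re_le_norm (2 * a + b + c))).1
    have h2 : ‖2 * a + b + c‖ ≤ 1 / 2 := by
      have := norm_add_le (2 * a + b) c
      have := norm_add_le (2 * a) b
      rw [norm_mul, Complex.norm_ofNat] at this
      linarith [h.ha, h.hb, h.hc]
    simp only [Complex.add_re, Complex.one_re] at h1 ⊢
    linarith)
  convert this using 3
  push_cast
  ring

end Small

theorem poch_zero (x : ℂ) : poch x 0 = 1 := by simp [poch]

theorem poch_succ (x : ℂ) (n : ℕ) : poch x (n + 1) = poch x n * (x + n) := by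
  simp [poch, ascPochhammer_succ_eval]

theorem Gamma_add_nat {z w : ℂ} (hz : 0 < z.re) (n : ℕ) (hw : w = z + n) :
    Complex.Gamma w = poch z n * Complex.Gamma z := by
  subst hw
  induction n with
  | zero => simp [poch_zero]
  | succ n ih =>
    rw [Gamma_succ' (z := z + n) (by simp; positivity) (by push_cast; ring), ih, poch_succ]
    ring

theorem inv_Gamma_add_nat {z w : ℂ} (hz : 0 < z.re) (n : ℕ) (hw : w = z + n) :
    (Complex.Gamma w)⁻¹ = (poch z n)⁻¹ * (Complex.Gamma z)⁻¹ := by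
  rw [Gamma_add_nat hz n hw, mul_inv]

/-- Valid at the poles too, since `1/Γ` is entire; this replaces the reflection formula for the
decreasing arguments in `Psi`. -/
theorem inv_Gamma_sub_nat {z w : ℂ} (n : ℕ) (hw : w = z - n) :
    (Complex.Gamma w)⁻¹ = (-1) ^ n * poch (1 - z) n * (Complex.Gamma z)⁻¹ := by
  subst hw
  induction n with
  | zero => simp [poch_zero]
  | succ n ih =>
    rw [inv_Gamma' (z := z - (n + 1 : ℕ)) (w := z - n) (by push_cast; ring), ih, poch_succ]
    push_cast
    ring

/-- The common part of `B₂` and `C`. -/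
def pochQuot (a b c : ℂ) (n : ℕ) : ℂ :=
  poch (a - b + 1 / 2) n * poch (a - c + 1 / 2) n * poch (a + 2 * b + c + 1 / 2) n
    * poch (a + b + 2 * c + 1 / 2) n / (poch (a + b + 1) n * poch (a + c + 1) n
      * poch (2 * a + b + c + 1) (2 * n))

/-- The quotient of consecutive values of `pochQuot`; the `1/4` comes from halving the two new
factors of the symbol of length `2n`. -/
def pochRatio (a b c : ℂ) (n : ℕ) : ℂ :=
  1 / 4 * ((a - b + 1 / 2 + n) / (a + b + 1 + n) * ((a - c + 1 / 2 + n) / (a + c + 1 + n))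
    * ((a + 2 * b + c + 1 / 2 + n) / ((2 * a + b + c + 1) / 2 + n))
    * ((a + b + 2 * c + 1 / 2 + n) / ((2 * a + b + c + 2) / 2 + n)))

theorem pochQuot_succ (n : ℕ) :
    pochQuot a b c (n + 1) = pochQuot a b c n * pochRatio a b c n := by
  unfold pochQuot pochRatio
  rw [show 2 * (n + 1) = 2 * n + 1 + 1 by ring]
  simp only [poch_succ]
  rw [show (2 * a + b + c + 1) / 2 + n = (2 * a + b + c + 1 + (2 * n : ℕ)) / 2 by push_cast; ring,
    show (2 * a + b + c + 2) / 2 + n = (2 * a + b + c + 1 + (2 * n + 1 : ℕ)) / 2 by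
      push_cast; ring]
  simp only [div_eq_mul_inv, mul_inv, inv_inv]
  ring

theorem tendsto_pochRatio (a b c : ℂ) : Tendsto (pochRatio a b c) atTop (𝓝 (1 / 4)) := by
  have := ((((tendsto_add_natCast_div (a - b + 1 / 2) (a + b + 1)).mul
    (tendsto_add_natCast_div (a - c + 1 / 2) (a + c + 1))).mul
    (tendsto_add_natCast_div (a + 2 * b + c + 1 / 2) ((2 * a + b + c + 1) / 2))).mul
    (tendsto_add_natCast_div (a + b + 2 * c + 1 / 2) ((2 * a + b + c + 2) / 2))).const_mul
    (1 / 4 : ℂ)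
  exact this.trans_eq (congrArg 𝓝 (by norm_num))

/-- The hypergeometric part of `C`. -/
def weight (a b c d : ℂ) (n : ℕ) : ℂ :=
  pochQuot a b c n * ((2 : ℂ) ^ (-4 * (n : ℤ))
    * (poch (a + b - 2 * d + 1 / 2) n * poch (a + b + 2 * d + 1 / 2) n
      * poch (a + c - 2 * d + 1 / 2) n * poch (a + c + 2 * d + 1 / 2) n
      / (poch (a - d + 1) n * poch (a + d + 1) n * poch (a + b + c - d + 1) n
        * poch (a + b + c + d + 1) n)))

def weightRatio (a b c d : ℂ) (n : ℕ) : ℂ :=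
  pochRatio a b c n * (1 / 16 * ((a + b - 2 * d + 1 / 2 + n) / (a - d + 1 + n)
    * ((a + b + 2 * d + 1 / 2 + n) / (a + d + 1 + n))
    * ((a + c - 2 * d + 1 / 2 + n) / (a + b + c - d + 1 + n))
    * ((a + c + 2 * d + 1 / 2 + n) / (a + b + c + d + 1 + n))))

theorem weight_succ (n : ℕ) :
    weight a b c d (n + 1) = weight a b c d n * weightRatio a b c d n := by
  unfold weight weightRatio
  simp only [pochQuot_succ, poch_succ]
  rw [show (-4 * ((n + 1 : ℕ) : ℤ)) = -4 * (n : ℤ) + (-4) by push_cast; ring,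
    zpow_add₀ two_ne_zero, show (2 : ℂ) ^ (-4 : ℤ) = 1 / 16 by norm_num]
  simp only [div_eq_mul_inv, mul_inv]
  ring

theorem tendsto_weightRatio (a b c d : ℂ) :
    Tendsto (weightRatio a b c d) atTop (𝓝 (1 / 64)) := by
  have := (tendsto_pochRatio a b c).mul
    (((((tendsto_add_natCast_div (a + b - 2 * d + 1 / 2) (a - d + 1)).mul
    (tendsto_add_natCast_div (a + b + 2 * d + 1 / 2) (a + d + 1))).mul
    (tendsto_add_natCast_div (a + c - 2 * d + 1 / 2) (a + b + c - d + 1))).mul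
    (tendsto_add_natCast_div (a + c + 2 * d + 1 / 2) (a + b + c + d + 1))).const_mul
    (1 / 16 : ℂ))
  exact this.trans_eq (congrArg 𝓝 (by norm_num))

/-- The summand `C`, without its factors independent of `n`. -/
def term (a b c d : ℂ) (n : ℕ) : ℂ :=
  P a b c d n * (2 * a + b + c + 2 * n + 1)⁻¹ * weight a b c d n

/-- The ratio tends to `1/64`, and `P` contributes only a quartic factor. Nothing need be nonzero
here: the vanishing denominators of `C` have been split off. -/
theorem Small.summable_term (h : Small a b c d) : Summable (term a b c d) := by
  refine summable_of_ratio_of_quartic (l := 1 / 64) (g := weight a b c d)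
    (ρ := weightRatio a b c d) (by norm_num) weight_succ (tendsto_weightRatio a b c d)
    (K := (‖(336 : ℂ)‖ + ‖672 * (b + c) + 320‖
      + ‖432 * b ^ 2 + 960 * b * c + 432 * c ^ 2 - 192 * d ^ 2 + 480 * (b + c) + 104‖
      + ‖96 * b ^ 3 + 384 * b ^ 2 * c + 384 * b * c ^ 2 + 96 * c ^ 3 - 192 * (b + c) * d ^ 2
        + 192 * b ^ 2 + 448 * b * c + 192 * c ^ 2 - 128 * d ^ 2 + 104 * (b + c) + 16‖
      + ‖32 * b ^ 3 * c + 80 * b ^ 2 * c ^ 2 + 32 * b * c ^ 3 + 64 * b * c * d ^ 2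
        + 16 * b ^ 3 + 80 * b ^ 2 * c + 80 * b * c ^ 2 + 16 * c ^ 3 - 64 * (b + c) * d ^ 2
        + 20 * b ^ 2 + 48 * b * c + 20 * c ^ 2 - 16 * d ^ 2 + 8 * (b + c) + 1‖) * 2) fun n => ?_
  unfold term
  rw [norm_mul, norm_mul]
  refine mul_le_mul_of_nonneg_right ?_ (norm_nonneg _)
  unfold P
  refine (mul_le_mul (norm_quartic_le (by simp) (h.norm_add_nat_le n) _ _ _ _ _)
    (h.norm_inv_two_abc_le n) (norm_nonneg _) (by positivity)).trans_eq ?_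
  ring

theorem C_eq_term (n : ℕ) : C a b c d n
    = -(1 / 256) * ((a + b)⁻¹ * (a + c)⁻¹ * (a - d)⁻¹ * (2 * a + b + c - 1)⁻¹
      * (2 * a + b + c)⁻¹ * (a + b + c - d)⁻¹) * term a b c d n := by
  have e3 : (2 : ℂ) ^ (-4 * (n : ℤ) - 8) = (2 : ℂ) ^ (-4 * (n : ℤ)) * (1 / 256) := by
    rw [zpow_sub₀ two_ne_zero, div_eq_mul_inv]
    norm_num
  unfold C term weight pochQuot
  rw [e3]
  generalize P a b c d n = p
  simp only [div_eq_mul_inv, mul_inv]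
  generalize (2 * a + b + c - 1)⁻¹ = y1
  generalize (2 * a + b + c + 2 * n + 1)⁻¹ = y2
  ring

/-- The Gamma factors of the second function at `n = 0`. -/
def gammaQuot (a b c d : ℂ) : ℂ :=
  gammaNum a b c d * ((Complex.Gamma (a + b + 1))⁻¹ * (Complex.Gamma (a + c + 1))⁻¹
    * (Complex.Gamma (2 * a + b + c + 1))⁻¹ * (Complex.Gamma (a + d + 1))⁻¹
    * (Complex.Gamma (a + b + c + d + 1))⁻¹ * (Complex.Gamma (a - d + 1))⁻¹
    * (Complex.Gamma (a + b + c - d + 1))⁻¹ * (Complex.Gamma (-a - b + 2 * d + 1 / 2))⁻¹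
    * (Complex.Gamma (-a - c + 2 * d + 1 / 2))⁻¹)

theorem P_add_nat (a b c d : ℂ) (n : ℕ) : P (a + n) b c d 0 = P a b c d n := by
  unfold P
  simp

/-- The values of the second function along an integer ray. -/
theorem Small.Psi_eq_term (h : Small a b c d) (n : ℕ) :
    Psi (a + n) b c d = -(1 / 256) * gammaQuot a b c d * term a b c d n := by
  have q := h.admissible
  have e2 : (2 : ℂ) ^ (-2 * (2 * (a + n) + b + c))
      = 2 ^ (-2 * (2 * a + b + c)) * (2 : ℂ) ^ (-4 * (n : ℤ)) := by
    rw [show -2 * (2 * (a + n) + b + c) = -2 * (2 * a + b + c) + ((-4 * (n : ℤ) : ℤ) : ℂ) by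
      push_cast; ring, Complex.cpow_add _ _ two_ne_zero, Complex.cpow_intCast]
  -- The two Gammas whose arguments decrease with `n` each produce this sign.
  have s1 : ((-1 : ℂ) ^ n) * (-1) ^ n = 1 := by rw [← mul_pow]; simp
  unfold Psi psi gammaQuot gammaNum term weight pochQuot
  rw [P_add_nat, e2,
    Gamma_add_nat q.h₁ n (w := a + n + 2 * b + c + 1 / 2) (by ring),
    Gamma_add_nat q.h₂ n (w := a + n + b + 2 * c + 1 / 2) (by ring),
    Gamma_add_nat q.h₃ n (w := a + n - b + 1 / 2) (by ring),
    Gamma_add_nat q.h₄ n (w := a + n - c + 1 / 2) (by ring),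
    Gamma_add_nat q.h₅ n (w := a + n + b + 2 * d + 1 / 2) (by ring),
    Gamma_add_nat q.h₆ n (w := a + n + c + 2 * d + 1 / 2) (by ring),
    inv_Gamma_add_nat h.re_pos_ab n (w := a + n + b + 1) (by ring),
    inv_Gamma_add_nat h.re_pos_ac n (w := a + n + c + 1) (by ring),
    Gamma_succ' (z := 2 * a + b + c + 1 + (2 * n : ℕ)) (w := 2 * (a + n) + b + c + 2)
      (by have := h.re_pos_two_abc; simp at this ⊢; positivity) (by push_cast; ring),
    Gamma_add_nat h.re_pos_two_abc (2 * n) rfl,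
    inv_Gamma_add_nat h.re_pos_ad n (w := a + n + d + 1) (by ring),
    inv_Gamma_add_nat h.re_pos_abcd n (w := a + n + b + c + d + 1) (by ring),
    inv_Gamma_add_nat h.re_pos_a_sub_d n (w := a + n - d + 1) (by ring),
    inv_Gamma_add_nat h.re_pos_abc_sub_d n (w := a + n + b + c - d + 1) (by ring),
    inv_Gamma_sub_nat n (z := -a - b + 2 * d + 1 / 2) (w := -(a + n) - b + 2 * d + 1 / 2) (by ring),
    inv_Gamma_sub_nat n (z := -a - c + 2 * d + 1 / 2) (w := -(a + n) - c + 2 * d + 1 / 2) (by ring),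
    show 1 - (-a - b + 2 * d + 1 / 2) = a + b - 2 * d + 1 / 2 by ring,
    show 1 - (-a - c + 2 * d + 1 / 2) = a + c - 2 * d + 1 / 2 by ring,
    show 2 * a + b + c + 1 + (2 * n : ℕ) = 2 * a + b + c + 2 * n + 1 by push_cast; ring]
  generalize P a b c d n = p
  simp only [div_eq_mul_inv, mul_inv]
  generalize (-1 : ℂ) ^ n = σ at *
  generalize (2 * a + b + c + 2 * n + 1)⁻¹ = y2
  refine eq_of_mul_one_eq rfl s1 ?_
  ring

namespace Generic

theorem nonInt_ac (h : Generic a b c d) (hac : a + c ≠ 0) : NonInt (a + c) :=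
  nonInt_of_norm_lt_one hac (by linarith [norm_add_le a c, h.ha, h.hc])

/-- `F` is a specialization of `seed9`. -/
theorem F_eq_seed9 (h : Generic a b c d) (hs : 2 * a + b + c ≠ 0) (n k : ℕ) :
    F a b c d n k = -(Complex.exp (-(Real.pi * Complex.I * (-a + b + 1 / 2))) / 8) *
      seed9 (1 - 2 * (a + n)) (-a + b - n + 1 / 2) (-a + c - n + 1 / 2) (a + d + k + n) := by
  have hN : NonInt (2 * a + b + c) := nonInt_of_norm_lt_one hs h.norm_two_abc
  have hN1 : NonInt (1 - (2 * a + b + c) - 2 * n) :=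
    (hN.neg rfl).add_int (1 - 2 * n) (by push_cast; ring)
  unfold F seed9
  rw [show 2 * (1 - 2 * (a + n)) - (-a + b - n + 1 / 2) - (-a + c - n + 1 / 2)
        = 1 - (2 * a + b + c) - 2 * n by ring,
    hN1.Gamma_succ rfl,
    show -2 * (1 - 2 * (a + n)) + (-a + b - n + 1 / 2) + (-a + c - n + 1 / 2) + 1
        = 2 * a + b + c + 2 * n by ring,
    show 1 - 2 * (a + n) - (-a + b - n + 1 / 2) + 1 / 2 = -a - b - n + 1 by ring,
    show 1 - 2 * (a + n) + (a + d + k + n) = -a + d + k - n + 1 by ring,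
    show -a + b - n + 1 / 2 + 2 * (a + d + k + n) = a + b + 2 * d + 2 * k + n + 1 / 2 by ring,
    show -a + c - n + 1 / 2 + 2 * (a + d + k + n) = a + c + 2 * d + 2 * k + n + 1 / 2 by ring,
    show -2 * (1 - 2 * (a + n)) + 2 * (-a + b - n + 1 / 2) + (-a + c - n + 1 / 2) + 1
        = a + 2 * b + c + n + 1 / 2 by ring,
    show -2 * (1 - 2 * (a + n)) + (-a + b - n + 1 / 2) + 2 * (-a + c - n + 1 / 2) + 1
        = a + b + 2 * c + n + 1 / 2 by ring,
    show 1 - (2 * a + b + c) - 2 * n + (a + d + k + n) = -a - b - c + d + k - n + 1 by ring,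
    show a + d + k + n + 1 = a + d + k + n + 1 by ring,
    show -(1 - 2 * (a + n)) + (-a + c - n + 1 / 2) + 1 / 2 = a + c + n by ring,
    show 2 * (1 - 2 * (a + n)) - (-a + b - n + 1 / 2) + 2 * (a + d + k + n) + 1
        = -a - b + 2 * d + 2 * k - n + 5 / 2 by ring,
    show 2 * (1 - 2 * (a + n)) - (-a + c - n + 1 / 2) + 2 * (a + d + k + n) + 1
        = -a - c + 2 * d + 2 * k - n + 5 / 2 by ring,
    show -(1 - 2 * (a + n)) + (-a + b - n + 1 / 2) + (-a + c - n + 1 / 2) + (a + d + k + n) + 1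
        = a + b + c + d + k + n + 1 by ring,
    show 2 * (1 - 2 * (a + n) + 2 * (a + d + k + n)) = 2 * (2 * d + 2 * k + 1) by ring]
  have he : Complex.exp (Real.pi * Complex.I * (-a + b - n + 1 / 2))
      = Complex.exp (Real.pi * Complex.I * (-a + b + 1 / 2)) * (-1) ^ n := by
    have h0 : Complex.exp (-(n * (Real.pi * Complex.I))) = (-1) ^ n := by
      rw [Complex.exp_neg, Complex.exp_nat_mul, Complex.exp_pi_mul_I, ← inv_pow]
      norm_num
    rw [← h0, ← Complex.exp_add]
    congr 1
    ring
  have h2 : (2 : ℂ) ^ (4 * (1 - 2 * (a + n)) - 2 * (-a + b - n + 1 / 2) - 2 * (-a + c - n + 1 / 2))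
      = 4 * 2 ^ (-2 * (2 * a + b + c + 2 * n)) := by
    rw [show 4 * (1 - 2 * (a + n)) - 2 * (-a + b - n + 1 / 2) - 2 * (-a + c - n + 1 / 2)
      = ((2 : ℕ) : ℂ) + -2 * (2 * a + b + c + 2 * n) by push_cast; ring,
      Complex.cpow_add _ _ two_ne_zero, Complex.cpow_natCast]
    norm_num
  have he' : Complex.exp (-(Real.pi * Complex.I * (-a + b + 1 / 2)))
      * Complex.exp (Real.pi * Complex.I * (-a + b + 1 / 2)) = 1 := by
    rw [← Complex.exp_add, neg_add_cancel, Complex.exp_zero]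
  -- `seed9` contains `Γ(z+1)/Γ(z)` with `z = 1 - (2a+b+c) - 2n`. It equals `z` only off the poles,
  -- whence `2a+b+c ≠ 0`; its sign against `2a+b+c+2n-1` is the minus in the prefactor.
  have hG : Complex.Gamma (1 - (2 * a + b + c) - 2 * n)
      * (Complex.Gamma (1 - (2 * a + b + c) - 2 * n))⁻¹ = 1 := mul_inv_cancel₀ hN1.Gamma_ne_zero
  rw [he, h2]
  simp only [div_eq_mul_inv, mul_inv]
  rw [inv_Gamma' (z := 2 * a + b + c + 2 * n - 1) (w := 2 * a + b + c + 2 * n) (by ring)]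
  simp only [div_eq_mul_inv] at he' hG
  generalize Complex.exp (-(Real.pi * Complex.I * (-a + b + 1 * 2⁻¹))) = E at *
  generalize Complex.exp (Real.pi * Complex.I * (-a + b + 1 * 2⁻¹)) = E' at *
  generalize Complex.Gamma (1 - (2 * a + b + c) - 2 * n) = g at *
  generalize g⁻¹ = g' at *
  symm
  have hu : E * E' * (g * g') = 1 := by rw [he', hG, mul_one]
  refine eq_of_eq_mul_one hu ?_
  ring

end Generic

/-- The regularization of `D`. -/
def Dreg (a b c d : ℂ) : ℂ :=
  gammaNum a b c d * ((2 * a + b + c - 1) * (Complex.Gamma (a + b))⁻¹ * (Complex.Gamma (a + c))⁻¹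
    * (Complex.Gamma (2 * a + b + c))⁻¹ * (Complex.Gamma (a + d + 1))⁻¹
    * (Complex.Gamma (a + b + c + d + 1))⁻¹ * (Complex.Gamma (a - d))⁻¹
    * (Complex.Gamma (a + b + c - d))⁻¹ * (Complex.Gamma (-a - b + 2 * d + 1 / 2))⁻¹
    * (Complex.Gamma (-a - c + 2 * d + 1 / 2))⁻¹)

namespace Generic

theorem D_eq (h : Generic a b c d) :
    D a b c d = 8 * Real.pi * limitValue a b c d * Dreg a b c d := by
  have hpi : (Real.pi : ℂ) ≠ 0 := by exact_mod_cast Real.pi_ne_zero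
  unfold D Dreg gammaNum limitValue
  rw [h.nonInt_ab.Gamma_reflect 0 (z := a + b) (y := -a - b + 1) (by push_cast; ring) (by ring),
    h.nonInt_ad.Gamma_reflect 0 (z := a - d) (y := -a + d + 1) (by push_cast; ring) (by ring),
    h.nonInt_abcd.Gamma_reflect 0 (z := a + b + c - d)
      (y := -a - b - c + d + 1) (by push_cast; ring) (by ring)]
  simp only [div_eq_mul_inv, mul_inv]
  simp only [← one_div (2 : ℂ), one_mul]
  rw [inv_Gamma_reflect_half h.norm_a_sub_b 0 (y := -a + b + 1 / 2) (x := a - b + 1 / 2)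
      (by push_cast; ring) (by push_cast; ring),
    inv_Gamma_reflect_half h.norm_a_sub_c 0 (y := -a + c + 1 / 2) (x := a - c + 1 / 2)
      (by push_cast; ring) (by push_cast; ring), zpow_zero, pow_zero]
  have s3 : (Real.pi : ℂ) * (Real.pi : ℂ)⁻¹ = 1 := mul_inv_cancel₀ hpi
  generalize (Real.pi : ℂ)⁻¹ = ϖ at *
  have s4 : Real.pi * ϖ * (Real.pi * ϖ) = 1 := by rw [s3, mul_one]
  refine eq_of_eq_mul_one s4 ?_
  ring

end Generic

namespace Generic

theorem limitValue_ne_zero (h : Generic a b c d) : limitValue a b c d ≠ 0 := by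
  have hcos : ∀ z : ℂ, ‖z‖ < 1 / 2 → Complex.cos (Real.pi * z) ≠ 0 := by
    intro z hz
    have := (nonInt_half_add hz).sin_ne_zero
    rwa [mul_add, add_comm, show (Real.pi : ℂ) * (1 / 2) = Real.pi / 2 by ring,
      Complex.sin_add_pi_div_two] at this
  have h1 := hcos _ h.norm_a_sub_b
  have h2 := hcos _ h.norm_a_sub_c
  have h3 := h.nonInt_ab.sin_ne_zero
  have h4 := h.nonInt_ad.sin_ne_zero
  have h5 := h.nonInt_abcd.sin_ne_zero
  unfold limitValue
  simp [h1, h2, h3, h4, h5]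

/-- The two extra hypotheses keep `1/Γ(a+c)` and `1/Γ(2a+b+c)` from vanishing; all other factors are
nonzero near the origin in the generic case. -/
theorem D_ne_zero (h : Generic a b c d) (hac : a + c ≠ 0) (hs : 2 * a + b + c ≠ 0) :
    D a b c d ≠ 0 := by
  have hpi : (Real.pi : ℂ) ≠ 0 := by exact_mod_cast Real.pi_ne_zero
  have hN : NonInt (2 * a + b + c) := nonInt_of_norm_lt_one hs h.norm_two_abc
  have p : ∀ {z : ℂ}, 0 < z.re → Complex.Gamma z ≠ 0 := fun hz =>
    Complex.Gamma_ne_zero_of_re_pos hz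
  have q := h.admissible
  have t1 : (2 : ℂ) ^ (-2 * (2 * a + b + c)) ≠ 0 := by simp [Complex.cpow_eq_zero_iff]
  have t2 : 2 * a + b + c - 1 ≠ 0 := (hN.add_int (-1) (by push_cast; ring)).ne_zero
  rw [h.D_eq]
  refine mul_ne_zero (mul_ne_zero (mul_ne_zero (by norm_num) hpi) h.limitValue_ne_zero) ?_
  unfold Dreg gammaNum
  have g : ∀ {z w : ℂ}, z ≠ 0 → w ≠ 0 → z * w ≠ 0 := mul_ne_zero
  have i : ∀ {z : ℂ}, z ≠ 0 → z⁻¹ ≠ 0 := inv_ne_zero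
  exact g (g t1 (g (g (g (g (g (p q.h₁) (p q.h₂)) (p q.h₃)) (p q.h₄)) (p q.h₅)) (p q.h₆)))
    (g (g (g (g (g (g (g (g (g t2 (i h.nonInt_ab.Gamma_ne_zero))
      (i (h.nonInt_ac hac).Gamma_ne_zero)) (i hN.Gamma_ne_zero)) (i (p h.re_pos_ad)))
      (i (p h.re_pos_abcd))) (i h.nonInt_ad.Gamma_ne_zero)) (i h.nonInt_abcd.Gamma_ne_zero))
      (i (p h.re_pos_dab))) (i (p h.re_pos_dac)))

/-- The first column of `F`. -/
theorem F_zero_eq (h : Generic a b c d) (k : ℕ) : F a b c d 0 k = D a b c d * A a b c d k := by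
  unfold F D A
  have q := h.admissible
  rw [Gamma_add_nat h.re_pos_d_sub_a k (w := -a + d + k - (0 : ℕ) + 1) (by push_cast; ring),
    Gamma_add_nat q.h₅ (2 * k) (w := a + b + 2 * d + 2 * k + (0 : ℕ) + 1 / 2) (by push_cast; ring),
    Gamma_add_nat q.h₆ (2 * k) (w := a + c + 2 * d + 2 * k + (0 : ℕ) + 1 / 2) (by push_cast; ring),
    Gamma_add_nat h.re_pos_d_sub_abc k (w := -a - b - c + d + k - (0 : ℕ) + 1) (by push_cast; ring),
    Gamma_add_nat h.re_pos_ad k (w := a + d + k + (0 : ℕ) + 1) (by push_cast; ring),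
    Gamma_add_nat h.re_pos_abcd k (w := a + b + c + d + k + (0 : ℕ) + 1) (by push_cast; ring),
    Gamma_add_nat h.re_pos_dab (2 * k + 2) (w := -a - b + 2 * d + 2 * k - (0 : ℕ) + 5 / 2)
      (by push_cast; ring),
    Gamma_add_nat h.re_pos_dac (2 * k + 2) (w := -a - c + 2 * d + 2 * k - (0 : ℕ) + 5 / 2)
      (by push_cast; ring)]
  simp only [div_eq_mul_inv, mul_inv, Nat.cast_zero, mul_zero, add_zero, sub_zero, pow_zero]
  rw [inv_Gamma' (z := 2 * a + b + c - 1) (w := 2 * a + b + c) (by ring)]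
  ring

/-- The first row of the companion of `F`. -/
theorem Psi_eq_C (h : Generic a b c d) (hac : a + c ≠ 0) (hs : 2 * a + b + c ≠ 0) (n : ℕ) :
    Psi (a + n) b c d = Dreg a b c d * C a b c d n := by
  have hN : NonInt (2 * a + b + c) := nonInt_of_norm_lt_one hs h.norm_two_abc
  have t2 : 2 * a + b + c - 1 ≠ 0 := (hN.add_int (-1) (by push_cast; ring)).ne_zero
  have hu : (a + b) * (a + b)⁻¹ * ((a + c) * (a + c)⁻¹) * ((a - d) * (a - d)⁻¹)
      * ((2 * a + b + c - 1) * (2 * a + b + c - 1)⁻¹) * ((2 * a + b + c) * (2 * a + b + c)⁻¹)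
      * ((a + b + c - d) * (a + b + c - d)⁻¹) = 1 := by
    rw [mul_inv_cancel₀ h.hab, mul_inv_cancel₀ hac, mul_inv_cancel₀ h.had, mul_inv_cancel₀ t2,
      mul_inv_cancel₀ hs, mul_inv_cancel₀ h.habcd]
    norm_num
  rw [h.Psi_eq_term, C_eq_term]
  unfold Dreg gammaQuot
  rw [inv_Gamma' (z := a + b) rfl, inv_Gamma' (z := a + c) rfl, inv_Gamma' (z := a - d) rfl,
    inv_Gamma' (z := 2 * a + b + c) rfl, inv_Gamma' (z := a + b + c - d) rfl]
  generalize term a b c d n = t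
  generalize gammaNum a b c d = g
  generalize 2 * a + b + c - 1 = y1 at *
  generalize (2 * a + b + c)⁻¹ = y3 at *
  generalize (a + b)⁻¹ = y4 at *
  generalize (a + c)⁻¹ = y5 at *
  generalize (a - d)⁻¹ = y6 at *
  generalize (a + b + c - d)⁻¹ = y7 at *
  generalize y1⁻¹ = y8 at *
  refine eq_of_mul_one_eq hu rfl ?_
  ring

end Generic
end Seed9
end

/-! ### The second function as `k → ∞`. -/

noncomputable section
namespace Seed9
open Filter Topology

variable {a b c d : ℂ}

theorem tendsto_Gamma_ratio {ρ : ℝ} (hρ : 0 < ρ) {m : ℕ → ℕ}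
    (h : Tendsto (fun k => (m k : ℝ) / k) atTop (𝓝 ρ)) (α β : ℂ) :
    Tendsto (fun k : ℕ => Complex.Gamma (α + m k) * (Complex.Gamma (β + m k))⁻¹
      * (k : ℂ) ^ (β - α)) atTop (𝓝 ((ρ : ℂ) ^ (α - β))) := by
  have hρ0 : (ρ : ℂ) ≠ 0 := by exact_mod_cast hρ.ne'
  have h1 := tendsto_Gamma_scaled hρ tendsto_id h α
  have h2 := tendsto_inv_Gamma_scaled hρ tendsto_id h β
  rw [Complex.cpow_sub _ _ hρ0, div_eq_mul_inv]
  refine (h1.mul h2).congr' ?_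
  have hm : ∀ᶠ k : ℕ in atTop, 0 < (m k : ℝ) / k := h.eventually_const_lt hρ
  filter_upwards [hm, eventually_gt_atTop 0] with k hk hk0
  have hk0' : (k : ℂ) ≠ 0 := by exact_mod_cast hk0.ne'
  have hmk : 0 < (m k : ℝ) := by
    by_contra h0
    have : (m k : ℝ) = 0 := le_antisymm (not_lt.1 h0) (Nat.cast_nonneg _)
    simp [this] at hk
  have hG : Complex.Gamma (m k) ≠ 0 := Complex.Gamma_ne_zero_of_re_pos (by simpa using hmk)
  have hp : (k : ℂ) ^ α ≠ 0 := by simp [Complex.cpow_eq_zero_iff, hk0']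
  simp only [id]
  rw [Complex.cpow_sub _ _ hk0']
  field_simp

theorem tendsto_natCast_div_self : Tendsto (fun k : ℕ => (k : ℝ) / k) atTop (𝓝 1) := by
  refine tendsto_const_nhds.congr' ?_
  filter_upwards [eventually_gt_atTop 0] with k hk
  have : (k : ℝ) ≠ 0 := by exact_mod_cast hk.ne'
  field_simp

theorem tendsto_two_mul_div_self :
    Tendsto (fun k : ℕ => ((2 * k : ℕ) : ℝ) / k) atTop (𝓝 2) := by
  refine tendsto_const_nhds.congr' ?_
  filter_upwards [eventually_gt_atTop 0] with k hk
  have : (k : ℝ) ≠ 0 := by exact_mod_cast hk.ne'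
  push_cast
  field_simp

/-- The quadratic polynomial of `B₂` in the variable `a + n`. -/
def quad (a b c : ℂ) : ℂ :=
  12 * a ^ 2 + (12 * (b + c) + 8) * a + (-4 * b * c + 4 * (b + c) + 1)

theorem tendsto_inv_natCast : Tendsto (fun k : ℕ => ((k : ℂ))⁻¹) atTop (𝓝 0) :=
  tendsto_inv_atTop_nhds_zero_nat

/-- `P` is even and quadratic in `d`, with coefficient `-16 * quad x b c` of `d²`; the numerator
polynomial of `B₂` arises here. -/
theorem tendsto_P_div (x b c d : ℂ) :
    Tendsto (fun k : ℕ => P x b c (d + k) 0 * ((k : ℂ) ^ 2)⁻¹) atTop (𝓝 (-16 * quad x b c)) := by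
  have h := tendsto_inv_natCast
  have e : ∀ᶠ k : ℕ in atTop, -16 * quad x b c * (1 + d * (k : ℂ)⁻¹) ^ 2
      + P x b c 0 0 * (k : ℂ)⁻¹ ^ 2 = P x b c (d + k) 0 * ((k : ℂ) ^ 2)⁻¹ := by
    filter_upwards [eventually_gt_atTop 0] with k hk
    have : (k : ℂ) ≠ 0 := by exact_mod_cast hk.ne'
    unfold quad P
    field_simp
    push_cast
    ring
  refine Tendsto.congr' e ?_
  have := (((tendsto_const_nhds (x := (1 : ℂ))).add (h.const_mul d)).pow 2).const_mul
    (-16 * quad x b c) |>.add ((h.pow 2).const_mul (P x b c 0 0))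
  simpa using this

/-- The behaviour of the second function far to the right. -/
theorem tendsto_Psi_right {x b c d : ℂ} (h₁ : NonInt (x - d)) (h₂ : NonInt (x + b + c - d)) :
    Tendsto (fun k : ℕ => Psi x b c (d + k)) atTop (𝓝 (1 / 16 * quad x b c
      * (Complex.Gamma (x + 2 * b + c + 1 / 2) * Complex.Gamma (x + b + 2 * c + 1 / 2)
        * Complex.Gamma (x - b + 1 / 2) * Complex.Gamma (x - c + 1 / 2))
      * ((Complex.Gamma (x + b + 1))⁻¹ * (Complex.Gamma (x + c + 1))⁻¹
        * (Complex.Gamma (2 * x + b + c + 2))⁻¹)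
      * (Complex.sin (Real.pi * (x - d)) * Complex.sin (Real.pi * (x + b + c - d))
        * ((Real.pi : ℂ)⁻¹) ^ 2))) := by
  have hpi : (Real.pi : ℂ) ≠ 0 := by exact_mod_cast Real.pi_ne_zero
  have t1 := tendsto_Gamma_ratio two_pos tendsto_two_mul_div_self (x + b + 2 * d + 1 / 2)
    (-x - b + 2 * d + 1 / 2)
  have t2 := tendsto_Gamma_ratio two_pos tendsto_two_mul_div_self (x + c + 2 * d + 1 / 2)
    (-x - c + 2 * d + 1 / 2)
  have t3 := tendsto_Gamma_ratio one_pos tendsto_natCast_div_self (d - x) (x + d + 1)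
  have t4 := tendsto_Gamma_ratio one_pos tendsto_natCast_div_self (d - x - b - c)
    (x + b + c + d + 1)
  have t5 := tendsto_P_div x b c d
  have T := ((((t1.mul t2).mul (t3.mul t4)).mul t5).const_mul
    (-(1 / 256) * 2 ^ (-2 * (2 * x + b + c))
      * (Complex.Gamma (x + 2 * b + c + 1 / 2) * Complex.Gamma (x + b + 2 * c + 1 / 2)
        * Complex.Gamma (x - b + 1 / 2) * Complex.Gamma (x - c + 1 / 2))
      * ((Complex.Gamma (x + b + 1))⁻¹ * (Complex.Gamma (x + c + 1))⁻¹
        * (Complex.Gamma (2 * x + b + c + 2))⁻¹)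
      * (Complex.sin (Real.pi * (x - d)) * Complex.sin (Real.pi * (x + b + c - d))
        * ((Real.pi : ℂ)⁻¹) ^ 2)))
  have e2 : (2 : ℂ) ^ (-2 * (2 * x + b + c)) * ((2 : ℂ) ^ (x + b + 2 * d + 1 / 2
      - (-x - b + 2 * d + 1 / 2)) * 2 ^ (x + c + 2 * d + 1 / 2 - (-x - c + 2 * d + 1 / 2))) = 1 := by
    rw [← Complex.cpow_add _ _ two_ne_zero, ← Complex.cpow_add _ _ two_ne_zero,
      show -2 * (2 * x + b + c) + (x + b + 2 * d + 1 / 2 - (-x - b + 2 * d + 1 / 2)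
        + (x + c + 2 * d + 1 / 2 - (-x - c + 2 * d + 1 / 2))) = 0 by ring, Complex.cpow_zero]
  refine (T.congr' ?_).trans_eq ?_
  · filter_upwards [eventually_gt_atTop 0] with k hk
    have hk0 : (k : ℂ) ≠ 0 := by exact_mod_cast hk.ne'
    -- The Gamma quotients decay like `k⁻²`, which exactly balances the growth of `P`, so the limit
    -- is finite and in general nonzero.
    have hp : ((k : ℂ) ^ (-x - b + 2 * d + 1 / 2 - (x + b + 2 * d + 1 / 2))
        * (k : ℂ) ^ (-x - c + 2 * d + 1 / 2 - (x + c + 2 * d + 1 / 2))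
        * ((k : ℂ) ^ (x + d + 1 - (d - x)) * (k : ℂ) ^ (x + b + c + d + 1 - (d - x - b - c))))
        * ((k : ℂ) ^ 2)⁻¹ = 1 := by
      rw [← Complex.cpow_add _ _ hk0, ← Complex.cpow_add _ _ hk0, ← Complex.cpow_add _ _ hk0,
        show -x - b + 2 * d + 1 / 2 - (x + b + 2 * d + 1 / 2)
          + (-x - c + 2 * d + 1 / 2 - (x + c + 2 * d + 1 / 2))
          + (x + d + 1 - (d - x) + (x + b + c + d + 1 - (d - x - b - c))) = ((2 : ℕ) : ℂ) by
          push_cast; ring, Complex.cpow_natCast, mul_inv_cancel₀ (pow_ne_zero _ hk0)]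
    -- The two reciprocal Gammas with arguments going to `-∞` are reflected; their signs
    -- `(-1)^(1-k)` multiply to `1`, and the sines survive in the limit.
    have r1 := h₁.Gamma_reflect (1 - k : ℤ) (z := x - (d + k) + 1) (y := d - x + k)
      (by push_cast; ring) (by ring)
    have r2 := h₂.Gamma_reflect (1 - k : ℤ) (z := x + b + c - (d + k) + 1)
      (y := d - x - b - c + k) (by push_cast; ring) (by ring)
    have hs := neg_one_zpow_mul_self (1 - k : ℤ)
    have s1 := mul_inv_cancel₀ h₁.sin_ne_zero
    have s2 := mul_inv_cancel₀ h₂.sin_ne_zero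
    have s3 := mul_inv_cancel₀ hpi
    rw [r1, r2]
    unfold Psi psi gammaNum
    rw [show x + b + 2 * (d + k) + 1 / 2 = x + b + 2 * d + 1 / 2 + (2 * k : ℕ) by push_cast; ring,
      show x + c + 2 * (d + k) + 1 / 2 = x + c + 2 * d + 1 / 2 + (2 * k : ℕ) by push_cast; ring,
      show -x - b + 2 * (d + k) + 1 / 2 = -x - b + 2 * d + 1 / 2 + (2 * k : ℕ) by push_cast; ring,
      show -x - c + 2 * (d + k) + 1 / 2 = -x - c + 2 * d + 1 / 2 + (2 * k : ℕ) by push_cast; ring,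
      show x + (d + k) + 1 = x + d + 1 + k by ring,
      show x + b + c + (d + k) + 1 = x + b + c + d + 1 + k by ring]
    generalize (-1 : ℂ) ^ (1 - k : ℤ) = σ at *
    simp only [div_eq_mul_inv (Real.pi : ℂ)]
    generalize Complex.sin (Real.pi * (x - d)) = S1 at *
    generalize Complex.sin (Real.pi * (x + b + c - d)) = S2 at *
    generalize S1⁻¹ = S1' at *
    generalize S2⁻¹ = S2' at *
    generalize (Real.pi : ℂ)⁻¹ = ϖ at *
    symm
    have hu : σ * σ * (S1 * S1') * (S2 * S2') * (Real.pi * ϖ * (Real.pi * ϖ)) = 1 := by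
      rw [hs, s1, s2, s3]; norm_num
    have hu := congrArg₂ (· * ·) hu hp
    simp only [mul_one] at hu
    generalize (k : ℂ) ^ (-x - b + 2 * d + 1 / 2 - (x + b + 2 * d + 1 / 2)) = p1 at *
    generalize (k : ℂ) ^ (-x - c + 2 * d + 1 / 2 - (x + c + 2 * d + 1 / 2)) = p2 at *
    generalize (k : ℂ) ^ (x + d + 1 - (d - x)) = p3 at *
    generalize (k : ℂ) ^ (x + b + c + d + 1 - (d - x - b - c)) = p4 at *
    generalize ((k : ℂ) ^ 2)⁻¹ = p5 at *
    refine eq_of_mul_one_eq hu rfl ?_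
    ring
  · congr 1
    push_cast
    rw [Complex.one_cpow, Complex.one_cpow]
    generalize (2 : ℂ) ^ (-2 * (2 * x + b + c)) = y1 at *
    generalize (2 : ℂ) ^ (x + b + 2 * d + 1 / 2 - (-x - b + 2 * d + 1 / 2)) = y2 at *
    generalize (2 : ℂ) ^ (x + c + 2 * d + 1 / 2 - (-x - c + 2 * d + 1 / 2)) = y3 at *
    refine eq_of_mul_one_eq rfl e2 ?_
    ring

namespace Generic

theorem tendsto_Psi_right (h : Generic a b c d) (hac : a + c ≠ 0) (hs : 2 * a + b + c ≠ 0)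
    (n : ℕ) : Tendsto (fun k : ℕ => Psi (a + n) b c (d + k)) atTop
      (𝓝 (Dreg a b c d * B₁ a b c d * B₂ a b c n)) := by
  have q := h.admissible
  refine (Seed9.tendsto_Psi_right (h.nonInt_ad.add_int n (by push_cast; ring))
    (h.nonInt_abcd.add_int n (by push_cast; ring))).trans_eq (congrArg 𝓝 ?_)
  have hsin : ∀ w z : ℂ, z = w + n →
      Complex.sin (Real.pi * z) = (-1) ^ n * Complex.sin (Real.pi * w) := by
    rintro w z rfl
    rw [mul_add, mul_comm (Real.pi : ℂ) (n : ℂ), Complex.sin_antiperiodic.add_nat_mul_eq]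
  rw [hsin (a - d) (a + n - d) (by ring), hsin (a + b + c - d) (a + n + b + c - d) (by ring)]
  have e2 : (2 : ℂ) ^ (-2 * (2 * a + b + c)) * 2 ^ (4 * a + 2 * b + 2 * c - 4) = 1 / 16 := by
    rw [← Complex.cpow_add _ _ two_ne_zero, show -2 * (2 * a + b + c)
      + (4 * a + 2 * b + 2 * c - 4) = ((-4 : ℤ) : ℂ) by push_cast; ring, Complex.cpow_intCast]
    norm_num
  have s1 : ((-1 : ℂ) ^ n) * (-1) ^ n = 1 := by rw [← mul_pow]; simp
  unfold Dreg gammaNum B₁ B₂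
  rw [show 12 * a ^ 2 + 12 * a * b + 12 * a * c + 24 * a * n + 8 * a - 4 * b * c + 12 * b * n
        + 4 * b + 12 * c * n + 4 * c + 12 * n ^ 2 + 8 * n + 1 = quad (a + n) b c by unfold quad; ring,
    h.nonInt_ad.Gamma_reflect 0 (z := a - d) (y := -a + d + 1) (by push_cast; ring) (by ring),
    h.nonInt_abcd.Gamma_reflect 0 (z := a + b + c - d)
      (y := -a - b - c + d + 1) (by push_cast; ring) (by ring),
    Gamma_add_nat q.h₁ n (w := a + n + 2 * b + c + 1 / 2) (by ring),
    Gamma_add_nat q.h₂ n (w := a + n + b + 2 * c + 1 / 2) (by ring),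
    Gamma_add_nat q.h₃ n (w := a + n - b + 1 / 2) (by ring),
    Gamma_add_nat q.h₄ n (w := a + n - c + 1 / 2) (by ring),
    inv_Gamma_add_nat h.re_pos_ab n (w := a + n + b + 1) (by ring),
    inv_Gamma_add_nat h.re_pos_ac n (w := a + n + c + 1) (by ring),
    Gamma_succ' (z := 2 * a + b + c + 1 + (2 * n : ℕ)) (w := 2 * (a + n) + b + c + 2)
      (by have := h.re_pos_two_abc; simp at this ⊢; positivity) (by push_cast; ring),
    Gamma_add_nat h.re_pos_two_abc (2 * n) rfl,
    inv_Gamma' (z := a + b) rfl, inv_Gamma' (z := a + c) rfl,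
    inv_Gamma' (z := 2 * a + b + c) rfl,
    show 2 * a + b + c + 1 + (2 * n : ℕ) = 2 * a + b + c + 2 * n + 1 by push_cast; ring, zpow_zero]
  simp only [div_eq_mul_inv, mul_inv, inv_inv, inv_one]
  have hN : NonInt (2 * a + b + c) := nonInt_of_norm_lt_one hs h.norm_two_abc
  have t2 : 2 * a + b + c - 1 ≠ 0 := (hN.add_int (-1) (by push_cast; ring)).ne_zero
  have p : ∀ {z : ℂ}, 0 < z.re → Complex.Gamma z * (Complex.Gamma z)⁻¹ = 1 := fun hz =>
    mul_inv_cancel₀ (Complex.Gamma_ne_zero_of_re_pos hz)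
  have hu : (a + b) * (a + b)⁻¹ * ((a + c) * (a + c)⁻¹)
      * ((2 * a + b + c - 1) * (2 * a + b + c - 1)⁻¹) * ((2 * a + b + c) * (2 * a + b + c)⁻¹)
      * (Complex.Gamma (a - d) * (Complex.Gamma (a - d))⁻¹)
      * (Complex.Gamma (a + b + c - d) * (Complex.Gamma (a + b + c - d))⁻¹) = 1 := by
    rw [mul_inv_cancel₀ h.hab, mul_inv_cancel₀ hac, mul_inv_cancel₀ t2, mul_inv_cancel₀ hs,
      mul_inv_cancel₀ h.nonInt_ad.Gamma_ne_zero, mul_inv_cancel₀ h.nonInt_abcd.Gamma_ne_zero]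
    norm_num
  have hu' := congrArg₂ (· * ·) (congrArg₂ (· * ·) (congrArg₂ (· * ·) (p h.re_pos_ad)
    (p h.re_pos_abcd)) (congrArg₂ (· * ·) (p h.re_pos_dab) (p h.re_pos_dac)))
    (congrArg₂ (· * ·) (p q.h₅) (p q.h₆))
  have hu := congrArg₂ (· * ·) hu hu'
  simp only [mul_one, div_eq_mul_inv] at hu
  have e3 : (2 : ℂ) ^ (-2 * (2 * a + b + c)) * 2 ^ (4 * a + 2 * b + 2 * c - 4) * 16 = 1 := by
    rw [e2]; norm_num
  have hv := congrArg₂ (· * ·) e3 hu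
  simp only [mul_one] at hv
  generalize (-1 : ℂ) ^ n = σ at *
  generalize (2 : ℂ) ^ (-2 * (2 * a + b + c)) = w1 at *
  generalize (2 : ℂ) ^ (4 * a + 2 * b + 2 * c - 4) = w2 at *
  generalize 2 * a + b + c - 1 = y1 at *
  generalize 2 * a + b + c + 2 * n + 1 = y2 at *
  generalize (2 * a + b + c)⁻¹ = y3 at *
  generalize (a + b)⁻¹ = y4 at *
  generalize (a + c)⁻¹ = y5 at *
  generalize y1⁻¹ = y8 at *
  generalize y2⁻¹ = y9 at *
  generalize quad (a + n) b c = y11 at *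
  refine eq_of_mul_one_eq hv s1 ?_
  ring

end Generic
end Seed9
end

/-! ### Summation of the WZ equation. -/

noncomputable section
namespace Seed9
open Filter Topology

variable {a b c d : ℂ}

namespace Generic

theorem summable_B₂ (h : Generic a b c d) : Summable fun n => B₂ a b c n := by
  refine summable_of_ratio_of_quartic (g := pochQuot a b c) (ρ := pochRatio a b c) (l := 1 / 4)
    (by norm_num) pochQuot_succ (tendsto_pochRatio a b c)
    (K := (‖(0 : ℂ)‖ + ‖(0 : ℂ)‖ + ‖(12 : ℂ)‖ + ‖12 * (b + c) + 8‖
      + ‖-4 * b * c + 4 * (b + c) + 1‖) * 2) fun n => ?_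
  have e : B₂ a b c n = (0 * (a + n) ^ 4 + 0 * (a + n) ^ 3 + 12 * (a + n) ^ 2
      + (12 * (b + c) + 8) * (a + n) + (-4 * b * c + 4 * (b + c) + 1))
      * (2 * a + b + c + 2 * n + 1)⁻¹ * pochQuot a b c n := by
    unfold B₂ pochQuot
    simp only [div_eq_mul_inv, mul_inv]
    ring
  rw [e, norm_mul, norm_mul]
  refine mul_le_mul_of_nonneg_right ?_ (norm_nonneg _)
  refine (mul_le_mul (norm_quartic_le (by simp) (h.norm_add_nat_le n) _ _ _ _ _)
    (h.norm_inv_two_abc_le n) (norm_nonneg _) (by positivity)).trans_eq ?_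
  ring

theorem summable_C (h : Generic a b c d) : Summable fun n => C a b c d n := by
  simp only [C_eq_term]
  exact h.summable_term.mul_left _

/-- The companion of `F`. -/
def G (a b c d : ℂ) (n k : ℕ) : ℂ := 8 * Real.pi * limitValue a b c d * Psi (a + n) b c (d + k)

theorem F_sub_F (h : Generic a b c d) (n k : ℕ) :
    F a b c d (n + 1) k - F a b c d n k = G a b c d n (k + 1) - G a b c d n k := by
  rw [h.F_eq, h.F_eq]
  unfold G
  rw [← mul_sub, ← mul_sub, Phi_succ_sub h.admissible]

theorem G_zero (h : Generic a b c d) (hac : a + c ≠ 0) (hs : 2 * a + b + c ≠ 0) (n : ℕ) :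
    G a b c d n 0 = D a b c d * C a b c d n := by
  unfold G
  rw [Nat.cast_zero, add_zero, h.Psi_eq_C hac hs, h.D_eq]
  ring

theorem tendsto_G (h : Generic a b c d) (hac : a + c ≠ 0) (hs : 2 * a + b + c ≠ 0) (n : ℕ) :
    Tendsto (fun k => G a b c d n k) atTop (𝓝 (D a b c d * B₁ a b c d * B₂ a b c n)) := by
  refine ((h.tendsto_Psi_right hac hs n).const_mul _).trans_eq (congrArg 𝓝 ?_)
  rw [h.D_eq]
  ring

/-- Summing over `k` telescopes to the limit of `G` at infinity minus its value at `0`. -/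
theorem tsum_F_succ (h : Generic a b c d) (hac : a + c ≠ 0) (hs : 2 * a + b + c ≠ 0) (n : ℕ) :
    ∑' k, F a b c d (n + 1) k - ∑' k, F a b c d n k
      = D a b c d * B₁ a b c d * B₂ a b c n - D a b c d * C a b c d n := by
  rw [← (h.summable_F (n + 1)).tsum_sub (h.summable_F n)]
  have h1 := ((h.summable_F (n + 1)).sub (h.summable_F n)).hasSum.tendsto_sum_nat
  simp only [h.F_sub_F, Finset.sum_range_sub] at h1 ⊢
  rw [h.G_zero hac hs] at h1
  exact tendsto_nhds_unique h1 ((h.tendsto_G hac hs n).sub_const _)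

theorem summable_A (h : Generic a b c d) (hac : a + c ≠ 0) (hs : 2 * a + b + c ≠ 0) :
    Summable fun k => A a b c d k := by
  have := h.summable_F 0
  simp only [h.F_zero_eq] at this
  exact (summable_mul_left_iff (h.D_ne_zero hac hs)).1 this

/-- The four-variable extension. -/
theorem tsum_identity (h : Generic a b c d) (hac : a + c ≠ 0) (hs : 2 * a + b + c ≠ 0) :
    (∑' k, A a b c d k) + B₁ a b c d * (∑' n, B₂ a b c n) =
      (∑' n, C a b c d n) + 1 / D a b c d * limitValue a b c d := by
  have hD := h.D_ne_zero hac hs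
  have h1 : ∀ N : ℕ, ∑' k, F a b c d N k = D a b c d * ∑' k, A a b c d k
      + ∑ n ∈ Finset.range N, (D a b c d * B₁ a b c d * B₂ a b c n
        - D a b c d * C a b c d n) := by
    intro N
    induction N with
    | zero => simp only [h.F_zero_eq, tsum_mul_left, Finset.sum_range_zero, add_zero]
    | succ N ih =>
      rw [Finset.sum_range_succ, ← h.tsum_F_succ hac hs, ← add_assoc, ← ih]
      ring
  have h2 := ((h.summable_B₂.mul_left (D a b c d * B₁ a b c d)).sub
    (h.summable_C.mul_left (D a b c d))).hasSum.tendsto_sum_nat.const_add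
    (D a b c d * ∑' k, A a b c d k)
  simp only [← h1] at h2
  -- The row sums are evaluated twice as `n → ∞`: by the asymptotics and by telescoping from row
  -- `0`.
  have h3 := tendsto_nhds_unique h.tendsto_tsum_F h2
  rw [(h.summable_B₂.mul_left _).tsum_sub (h.summable_C.mul_left _), tsum_mul_left,
    tsum_mul_left] at h3
  rw [h3]
  field_simp
  ring

end Generic
end Seed9
end

/-! ### The series on `d = a` and termwise differentiation. -/

noncomputable section
namespace Seed9
open Filter Topology

variable {a b c d : ℂ}

theorem Small.gammaQuot_ne_zero (h : Small a b c d) : gammaQuot a b c d ≠ 0 := by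
  have p : ∀ {z : ℂ}, 0 < z.re → Complex.Gamma z ≠ 0 := fun hz =>
    Complex.Gamma_ne_zero_of_re_pos hz
  have g : ∀ {z w : ℂ}, z ≠ 0 → w ≠ 0 → z * w ≠ 0 := mul_ne_zero
  have i : ∀ {z : ℂ}, 0 < z.re → (Complex.Gamma z)⁻¹ ≠ 0 := fun hz => inv_ne_zero (p hz)
  have q := h.admissible
  have t1 : (2 : ℂ) ^ (-2 * (2 * a + b + c)) ≠ 0 := by simp [Complex.cpow_eq_zero_iff]
  unfold gammaQuot gammaNum
  exact g (g t1 (g (g (g (g (g (p q.h₁) (p q.h₂)) (p q.h₃)) (p q.h₄)) (p q.h₅)) (p q.h₆)))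
    (g (g (g (g (g (g (g (g (i h.re_pos_ab) (i h.re_pos_ac)) (i h.re_pos_two_abc))
      (i h.re_pos_ad)) (i h.re_pos_abcd)) (i h.re_pos_a_sub_d)) (i h.re_pos_abc_sub_d))
      (i h.re_pos_dab)) (i h.re_pos_dac))

/-- On the hyperplane `d = a` the row sums telescope to a single series. -/
theorem Small.hasSum_term (h : Small a b c a) :
    HasSum (term a b c a) (32 / (Real.pi * gammaQuot a b c a)) := by
  have hpi : (Real.pi : ℂ) ≠ 0 := by exact_mod_cast Real.pi_ne_zero
  have hg := h.gammaQuot_ne_zero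
  have h1 := tendsto_tsum_Phi h.admissible
  -- Each row sum is a partial sum of `gammaQuot / 256` times the series, so its limit `1/(8π)`
  -- gives the value `32/(π gammaQuot)`.
  simp only [fun n => (hasSum_Phi_diag h.admissible n).tsum_eq, h.Psi_eq_term,
    ← Finset.mul_sum] at h1
  have h2 := h1.const_mul (256 / gammaQuot a b c a)
  refine (h.summable_term.hasSum_iff_tendsto_nat).2 ?_
  convert h2 using 2
  · field_simp
  · field_simp
    norm_num

theorem coeff_zero : coeff 0 = 1 := by simp [coeff]

theorem coeff_succ (n : ℕ) :
    coeff (n + 1) = coeff n * (1 / 64 * (((n : ℝ) + 1 / 2) / (n + 1)) ^ 7) := by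
  have h2 : (2 : ℝ) ^ (6 * (n + 1)) = 2 ^ (6 * n) * 64 := by rw [mul_add, pow_add]; norm_num
  unfold coeff
  rw [ascPochhammer_succ_eval, ascPochhammer_succ_eval, h2]
  simp only [div_eq_mul_inv, mul_inv, mul_pow, inv_pow]
  ring

theorem coeff_nonneg (n : ℕ) : 0 ≤ coeff n := by
  induction n with
  | zero => simp [coeff_zero]
  | succ n ih => rw [coeff_succ]; positivity

theorem coeff_le (n : ℕ) : coeff n ≤ (1 / 64) ^ n := by
  induction n with
  | zero => simp [coeff_zero]
  | succ n ih =>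
    have h0 := coeff_nonneg n
    have h1 : ((n : ℝ) + 1 / 2) / (n + 1) ≤ 1 := by
      rw [div_le_one (by positivity)]; linarith
    have h2 : (((n : ℝ) + 1 / 2) / (n + 1)) ^ 7 ≤ 1 := pow_le_one₀ (by positivity) h1
    rw [coeff_succ, pow_succ (1 / 64 : ℝ) n]
    have : (1 : ℝ) / 64 * (((n : ℝ) + 1 / 2) / (n + 1)) ^ 7 ≤ 1 / 64 := by linarith
    gcongr

theorem norm_coeff_le (n : ℕ) : ‖(coeff n : ℂ)‖ ≤ (1 / 64) ^ n := by
  rw [Complex.norm_real, Real.norm_of_nonneg (coeff_nonneg n)]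
  exact coeff_le n

theorem weight_zero : weight a b c d 0 = 1 := by simp [weight, pochQuot, poch_zero]

/-- Splits off the value at the origin: on each curve used below, `ρ j` is `1` at the origin and
carries all the dependence on the parameter. -/
theorem weight_eq_prod {ρ : ℕ → ℂ}
    (h : ∀ j, weightRatio a b c d j = 1 / 64 * (((j : ℂ) + 1 / 2) / (j + 1)) ^ 7 * ρ j) (n : ℕ) :
    weight a b c d n = coeff n * ∏ j ∈ Finset.range n, ρ j := by
  induction n with
  | zero => simp [weight_zero, coeff_zero]
  | succ n ih =>
    rw [weight_succ, ih, h, coeff_succ, Finset.prod_range_succ]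
    push_cast
    ring

theorem summable_quartic_mul_geometric :
    Summable fun n : ℕ => ((n : ℝ) + 1) ^ 4 * (1 / 32) ^ n := by
  have h := ((summable_nat_add_iff 1).2 (summable_pow_mul_geometric_of_norm_lt_one 4
    (r := (1 / 32 : ℝ)) (by norm_num))).mul_left 32
  refine h.congr fun n => ?_
  push_cast
  ring

/-- Termwise differentiation of the series with the terms `coeff n * ∏ ρ j w * q n w`. -/
theorem hasSum_deriv_weighted {ρ q : ℕ → ℂ → ℂ} {ρ' q' : ℕ → ℂ} {r K : ℝ} (hr : 0 < r)
    (hρd : ∀ n, DifferentiableOn ℂ (ρ n) (Metric.ball 0 r))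
    (hρ : ∀ n, ∀ w ∈ Metric.ball (0 : ℂ) r, ‖ρ n w‖ ≤ 2) (hρ0 : ∀ n, ρ n 0 = 1)
    (hρ' : ∀ n, HasDerivAt (ρ n) (ρ' n) 0)
    (hqd : ∀ n, DifferentiableOn ℂ (q n) (Metric.ball 0 r))
    (hq : ∀ n : ℕ, ∀ w ∈ Metric.ball (0 : ℂ) r, ‖q n w‖ ≤ K * (n + 1) ^ 4)
    (hq' : ∀ n, HasDerivAt (q n) (q' n) 0) :
    ∃ S' : ℂ, HasDerivAt
        (fun w => ∑' n, (coeff n : ℂ) * ((∏ j ∈ Finset.range n, ρ j w) * q n w)) S' 0 ∧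
      HasSum (fun n => (coeff n : ℂ) * ((∑ j ∈ Finset.range n, ρ' j) * q n 0 + q' n)) S' := by
  have hd : ∀ n, DifferentiableOn ℂ
      (fun w => (coeff n : ℂ) * ((∏ j ∈ Finset.range n, ρ j w) * q n w)) (Metric.ball 0 r) :=
    fun n => ((DifferentiableOn.fun_finsetProd fun j _ => hρd j).mul (hqd n)).const_mul _
  -- The product of `n` factors bounded by `2` against `coeff n ≤ 64⁻ⁿ` leaves `32⁻ⁿ`, so the crude
  -- bound `2` is ample.
  have hb : ∀ (n : ℕ) (w : ℂ), w ∈ Metric.ball (0 : ℂ) r →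
      ‖(coeff n : ℂ) * ((∏ j ∈ Finset.range n, ρ j w) * q n w)‖
        ≤ K * (((n : ℝ) + 1) ^ 4 * (1 / 32) ^ n) := by
    intro n w hw
    have h1 : ‖∏ j ∈ Finset.range n, ρ j w‖ ≤ 2 ^ n := by
      rw [norm_prod]
      refine (Finset.prod_le_prod (fun _ _ => norm_nonneg _) fun j _ => hρ j w hw).trans_eq ?_
      simp
    rw [norm_mul, norm_mul]
    refine (mul_le_mul (norm_coeff_le n) (mul_le_mul h1 (hq n w hw) (norm_nonneg _)
      (by positivity)) (by positivity) (by positivity)).trans_eq ?_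
    rw [show (1 : ℝ) / 32 = 1 / 64 * 2 by norm_num, mul_pow]
    ring
  have h0 : (0 : ℂ) ∈ Metric.ball (0 : ℂ) r := Metric.mem_ball_self hr
  have hs := summable_quartic_mul_geometric.mul_left K
  refine ⟨_, ((Complex.differentiableOn_tsum_of_summable_norm hs hd Metric.isOpen_ball
    hb).differentiableAt (Metric.isOpen_ball.mem_nhds h0)).hasDerivAt, ?_⟩
  have h2 := Complex.hasSum_deriv_of_summable_norm hs hd Metric.isOpen_ball hb h0
  -- As every factor is `1` at `0`, the derivative of the product is the sum of the derivatives; the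
  -- harmonic numbers come from this sum.
  have hprod : ∀ n, HasDerivAt (fun w => ∏ j ∈ Finset.range n, ρ j w)
      (∑ j ∈ Finset.range n, ρ' j) 0 ∧ ∏ j ∈ Finset.range n, ρ j 0 = 1 := by
    intro n
    induction n with
    | zero => simpa using hasDerivAt_const (0 : ℂ) (1 : ℂ)
    | succ n ih =>
      simp only [Finset.prod_range_succ, Finset.sum_range_succ]
      refine ⟨?_, by rw [ih.2, hρ0, mul_one]⟩
      have := ih.1.mul (hρ' n)
      rw [hρ0, ih.2, mul_one, one_mul] at this
      exact this
  have e : (fun n => (coeff n : ℂ) * ((∑ j ∈ Finset.range n, ρ' j) * q n 0 + q' n))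
      = fun n => deriv (fun w => (coeff n : ℂ) * ((∏ j ∈ Finset.range n, ρ j w) * q n w)) 0 := by
    funext n
    have h3 := ((hprod n).1.mul (hq' n)).const_mul (coeff n : ℂ)
    rw [(hprod n).2, one_mul] at h3
    exact h3.deriv.symm
  rw [e]
  exact h2

/-- The odd reciprocals up to `2n` are all of them minus the even ones. -/
theorem sum_odd_eq_H (s n : ℕ) : ∑ j ∈ Finset.range n, (((j : ℝ) + 1 / 2) ^ s)⁻¹
    = 2 ^ s * H s (2 * n) - H s n := by
  have hH : ∀ m, H s (m + 1) = H s m + (((m : ℝ) + 1) ^ s)⁻¹ := by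
    intro m
    unfold H
    rw [Finset.sum_Icc_succ_top (by omega)]
    push_cast
    ring
  induction n with
  | zero => simp [H]
  | succ n ih =>
    rw [Finset.sum_range_succ, ih, show 2 * (n + 1) = 2 * n + 1 + 1 by ring, hH, hH, hH]
    push_cast
    have h1 : ((n : ℝ) + 1 / 2) ^ s = (2 ^ s)⁻¹ * (2 * n + 1) ^ s := by
      rw [← inv_pow, ← mul_pow]; congr 1; ring
    have h2 : (2 * (n : ℝ) + 1 + 1) ^ s = 2 ^ s * (n + 1) ^ s := by
      rw [← mul_pow]; congr 1; ring
    rw [h1, h2, mul_inv, mul_inv, inv_inv]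
    have : (2 : ℝ) ^ s * (2 ^ s)⁻¹ = 1 := mul_inv_cancel₀ (by positivity)
    linear_combination -(((n : ℝ) + 1) ^ s)⁻¹ * this

theorem sum_nat_eq_H (s n : ℕ) : ∑ j ∈ Finset.range n, (((j : ℝ) + 1) ^ s)⁻¹ = H s n := by
  induction n with
  | zero => simp [H]
  | succ n ih =>
    rw [Finset.sum_range_succ, ih]
    unfold H
    rw [Finset.sum_Icc_succ_top (by omega)]
    push_cast
    ring

end Seed9
end

/-! ### Elementary bounds and expansions of sine and cosine. -/

noncomputable section
namespace Seed9
open Filter Topology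

theorem norm_one_sub_mul_inv_le {w x : ℂ} {n : ℕ} {r R : ℝ} (hw : ‖w‖ ≤ r) (k : ℕ)
    (hx : 1 / 2 ≤ x.re) (hR : 2 ^ k * r ≤ R) : ‖w * ((x + n) ^ k)⁻¹‖ ≤ R := by
  rw [norm_mul, norm_inv, norm_pow, ← inv_pow, ← norm_inv]
  have h1 := pow_le_pow_left₀ (norm_nonneg _) (norm_inv_le_two n hx) k
  refine (mul_le_mul hw h1 (by positivity) ((norm_nonneg w).trans hw)).trans ?_
  linarith

theorem norm_one_sub_le {x : ℂ} {R : ℝ} (h : ‖x‖ ≤ R) : ‖1 - x‖ ≤ 1 + R := by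
  have := norm_sub_le 1 x
  rw [norm_one] at this
  linarith

theorem le_norm_one_sub {x : ℂ} {R : ℝ} (h : ‖x‖ ≤ R) : 1 - R ≤ ‖1 - x‖ := by
  have := norm_sub_norm_le 1 x
  rw [norm_one] at this
  linarith

theorem norm_inv_one_sub_le {x : ℂ} {R : ℝ} (h : ‖x‖ ≤ R) (hR : R < 1) :
    ‖(1 - x)⁻¹‖ ≤ (1 - R)⁻¹ := by
  rw [norm_inv]
  exact inv_anti₀ (by linarith) (le_norm_one_sub h)

theorem one_sub_ne_zero {x : ℂ} {R : ℝ} (h : ‖x‖ ≤ R) (hR : R < 1) : 1 - x ≠ 0 := by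
  have := le_norm_one_sub h
  exact norm_pos_iff.1 (by linarith)

theorem hasDerivAt_one_sub_mul (α : ℂ) : HasDerivAt (fun w : ℂ => 1 - w * α) (-α) 0 := by
  simpa using ((hasDerivAt_id (0 : ℂ)).mul_const α).const_sub 1

theorem tendsto_pow_punctured {k : ℕ} (hk : k ≠ 0) :
    Tendsto (fun z : ℂ => z ^ k) (𝓝[≠] 0) (𝓝[≠] 0) := by
  refine tendsto_nhdsWithin_iff.2 ⟨?_, ?_⟩
  · have : Tendsto (fun z : ℂ => z ^ k) (𝓝 0) (𝓝 (0 ^ k)) := (continuous_pow k).tendsto 0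
    rw [zero_pow hk] at this
    exact this.mono_left nhdsWithin_le_nhds
  · filter_upwards [self_mem_nhdsWithin] with z hz
    exact pow_ne_zero k hz

theorem tendsto_const_mul_punctured {x : ℂ} (hx : x ≠ 0) :
    Tendsto (fun z : ℂ => x * z) (𝓝[≠] 0) (𝓝[≠] 0) := by
  refine tendsto_nhdsWithin_iff.2 ⟨?_, ?_⟩
  · have : Tendsto (fun z : ℂ => x * z) (𝓝 0) (𝓝 (x * 0)) := (continuous_const_mul x).tendsto 0
    rw [mul_zero] at this
    exact this.mono_left nhdsWithin_le_nhds
  · filter_upwards [self_mem_nhdsWithin] with z hz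
    exact mul_ne_zero hx hz

/-- The relative remainder of the Taylor expansion of the exponential. -/
def expRem (n : ℕ) (z : ℂ) : ℂ :=
  (Complex.exp z - ∑ i ∈ Finset.range (n + 1), z ^ i / i.factorial) / z ^ n

theorem tendsto_expRem (n : ℕ) : Tendsto (expRem n) (𝓝 0) (𝓝 0) :=
  (Complex.exp_sub_sum_range_succ_isLittleO_pow n).tendsto_div_nhds_zero

theorem tendsto_expRem_const_mul (n : ℕ) (x : ℂ) :
    Tendsto (fun z => expRem n (x * z)) (𝓝[≠] 0) (𝓝 0) := by
  have : Tendsto (fun z : ℂ => x * z) (𝓝 0) (𝓝 (x * 0)) := (continuous_const_mul x).tendsto 0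
  rw [mul_zero] at this
  exact ((tendsto_expRem n).comp this).mono_left nhdsWithin_le_nhds

def sinRem (z : ℂ) : ℂ := (Complex.sin z - (z - z ^ 3 / 6 + z ^ 5 / 120)) / z ^ 5

def cosRem (z : ℂ) : ℂ := (Complex.cos z - (1 - z ^ 2 / 2 + z ^ 4 / 24)) / z ^ 4

theorem tendsto_sinRem : Tendsto sinRem (𝓝[≠] 0) (𝓝 0) := by
  -- Since `(-I)⁵ = -I⁵`, the sum of the two normalized remainders is the difference of exponentials
  -- that defines the sine.
  have h := ((tendsto_expRem_const_mul 5 Complex.I).add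
    (tendsto_expRem_const_mul 5 (-Complex.I))).const_mul (1 / 2)
  rw [add_zero, mul_zero] at h
  refine h.congr' ?_
  filter_upwards [self_mem_nhdsWithin] with z hz
  have hz : z ≠ 0 := hz
  unfold expRem sinRem Complex.sin
  rw [mul_comm Complex.I z, show -Complex.I * z = -z * Complex.I by ring]
  simp only [Finset.sum_range_succ, Finset.sum_range_zero, Nat.factorial]
  have hI := Complex.I_ne_zero
  generalize Complex.exp (z * Complex.I) = e1
  generalize Complex.exp (-z * Complex.I) = e2
  have i2 : Complex.I ^ 2 = -1 := Complex.I_sq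
  have i5 : Complex.I ^ 5 = Complex.I := by
    rw [show Complex.I ^ 5 = (Complex.I ^ 2) ^ 2 * Complex.I by ring, i2]; ring
  simp only [mul_pow, i5]
  field_simp
  push_cast
  ring_nf
  simp only [i2, Complex.I_pow_three]
  ring

theorem tendsto_cosRem : Tendsto cosRem (𝓝[≠] 0) (𝓝 0) := by
  have h := ((tendsto_expRem_const_mul 4 Complex.I).add
    (tendsto_expRem_const_mul 4 (-Complex.I))).const_mul (1 / 2)
  rw [add_zero, mul_zero] at h
  refine h.congr' ?_
  filter_upwards [self_mem_nhdsWithin] with z hz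
  have hz : z ≠ 0 := hz
  unfold expRem cosRem Complex.cos
  rw [mul_comm Complex.I z, show -Complex.I * z = -z * Complex.I by ring]
  simp only [Finset.sum_range_succ, Finset.sum_range_zero, Nat.factorial]
  generalize Complex.exp (z * Complex.I) = e1
  generalize Complex.exp (-z * Complex.I) = e2
  have i2 : Complex.I ^ 2 = -1 := Complex.I_sq
  have i4 : Complex.I ^ 4 = 1 := Complex.I_pow_four
  have i3 : Complex.I ^ 3 = -Complex.I := Complex.I_pow_three
  simp only [mul_pow, i4, i3, i2, neg_sq, pow_one]
  field_simp
  push_cast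
  ring

theorem sin_eq_sinRem (z : ℂ) : Complex.sin z = z - z ^ 3 / 6 + z ^ 5 / 120 + z ^ 5 * sinRem z := by
  rcases eq_or_ne z 0 with rfl | hz
  · simp
  · unfold sinRem
    field_simp
    ring

theorem cos_eq_cosRem (z : ℂ) : Complex.cos z = 1 - z ^ 2 / 2 + z ^ 4 / 24 + z ^ 4 * cosRem z := by
  rcases eq_or_ne z 0 with rfl | hz
  · simp
  · unfold cosRem
    field_simp
    ring

theorem tendsto_sin_div : Tendsto (fun z => Complex.sin z / z) (𝓝[≠] 0) (𝓝 1) := by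
  have h0 : Tendsto (fun z : ℂ => z) (𝓝[≠] 0) (𝓝 0) := tendsto_id.mono_left nhdsWithin_le_nhds
  have h : Tendsto (fun z : ℂ => 1 - z ^ 2 / 6 + z ^ 4 / 120 + z ^ 4 * sinRem z) (𝓝[≠] 0)
      (𝓝 (1 - 0 ^ 2 / 6 + 0 ^ 4 / 120 + 0 ^ 4 * 0)) :=
    ((tendsto_const_nhds.sub ((h0.pow 2).div_const 6)).add ((h0.pow 4).div_const 120)).add
      ((h0.pow 4).mul tendsto_sinRem)
  norm_num at h
  refine h.congr' ?_
  filter_upwards [self_mem_nhdsWithin] with z hz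
  have hz : z ≠ 0 := hz
  rw [sin_eq_sinRem]
  field_simp

/-- `z cos² z / sin z = (1 - z² + …)(1 + z²/6 + …)`, and `-1 + 1/6 = -5/6`. -/
theorem tendsto_mul_cos_sq_div_sin :
    Tendsto (fun z => (z * Complex.cos z ^ 2 / Complex.sin z - 1) / z ^ 2) (𝓝[≠] 0)
      (𝓝 (-5 / 6)) := by
  have h0 : Tendsto (fun z : ℂ => z) (𝓝[≠] 0) (𝓝 0) := tendsto_id.mono_left nhdsWithin_le_nhds
  have h1 := tendsto_sin_div
  have h2 : Tendsto (fun z : ℂ => 1 / 6 - z ^ 2 / 120 - z ^ 2 * sinRem z - (Complex.sin z / z) ^ 2)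
      (𝓝[≠] 0) (𝓝 (1 / 6 - 0 ^ 2 / 120 - 0 ^ 2 * 0 - 1 ^ 2)) :=
    ((tendsto_const_nhds.sub ((h0.pow 2).div_const 120)).sub
      ((h0.pow 2).mul tendsto_sinRem)).sub (h1.pow 2)
  refine ((h2.div h1 one_ne_zero).congr' ?_).trans_eq (by norm_num)
  filter_upwards [self_mem_nhdsWithin, h1.eventually_ne one_ne_zero] with z hz hs
  have hz : z ≠ 0 := hz
  have hs : Complex.sin z ≠ 0 := fun h => hs (by rw [h, zero_div])
  have e := sin_eq_sinRem z
  have e' : Complex.cos z ^ 2 = 1 - Complex.sin z ^ 2 := by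
    linear_combination Complex.sin_sq_add_cos_sq z
  rw [e', Pi.div_apply]
  generalize sinRem z = ε at *
  field_simp
  linear_combination 720 * e

end Seed9
end

/-! ### The curve `(0, u, -u, 0)`: the value at the origin and second-order harmonic numbers. -/

noncomputable section
namespace Seed9
open Filter Topology

theorem hasSum_of_complex {f : ℕ → ℝ} {g : ℕ → ℂ} {x : ℝ} {y : ℂ} (h : HasSum g y)
    (hf : ∀ n, (f n : ℂ) = g n) (hx : (x : ℂ) = y) : HasSum f x := by
  rw [← Complex.hasSum_ofReal, hx, funext hf]
  exact h

theorem one_sub_sq_mul_inv {x : ℂ} (hx : x ≠ 0) (u : ℂ) :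
    1 - u ^ 2 * (x ^ 2)⁻¹ = (x - u) * (x + u) * (x ^ 2)⁻¹ := by
  field_simp
  ring

theorem Gamma_half_add_mul_Gamma_half_sub {w : ℂ} (h : ‖w‖ < 1 / 2) :
    Complex.Gamma (1 / 2 + w) * Complex.Gamma (1 / 2 - w) = Real.pi / Complex.cos (Real.pi * w) := by
  have hpi : (Real.pi : ℂ) ≠ 0 := by exact_mod_cast Real.pi_ne_zero
  have hN := nonInt_half_add h
  have h1 := hN.Gamma_reflect 0 (z := 1 / 2 + w) (y := 1 / 2 - w) (by simp) (by ring)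
  have h2 : Complex.sin (Real.pi * (1 / 2 + w)) = Complex.cos (Real.pi * w) := by
    rw [mul_add, add_comm, show (Real.pi : ℂ) * (1 / 2) = Real.pi / 2 by ring,
      Complex.sin_add_pi_div_two]
  rw [h2, zpow_zero, one_mul] at h1
  rw [h1, mul_left_comm, mul_inv_cancel₀ hN.Gamma_ne_zero, mul_one]

theorem inv_Gamma_one_add_mul_inv_Gamma_one_sub {z : ℂ} (hz : z ≠ 0) :
    (Complex.Gamma (1 + z))⁻¹ * (Complex.Gamma (1 - z))⁻¹
      = Complex.sin (Real.pi * z) / (Real.pi * z) := by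
  rw [add_comm 1 z, Complex.Gamma_add_one z hz, mul_inv, mul_assoc, ← mul_inv,
    Complex.Gamma_mul_Gamma_one_sub, inv_div, div_eq_mul_inv, div_eq_mul_inv, mul_inv]
  ring

/-- All other Gammas pair off, so with `z = πu ≠ 0` the value of the series is `32/π³ · z cos² z /
sin z`. -/
theorem gammaQuot_antidiagonal {u : ℂ} (hu : ‖u‖ < 1 / 100) :
    gammaQuot 0 u (-u) 0 = (Real.pi / Complex.cos (Real.pi * u)) ^ 2
      * ((Complex.Gamma (1 + u))⁻¹ * (Complex.Gamma (1 - u))⁻¹) := by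
  have hu' : ‖u‖ < 1 / 2 := hu.trans (by norm_num)
  have hX := (nonInt_half_add hu').Gamma_ne_zero
  have hY : Complex.Gamma (1 / 2 - u) ≠ 0 :=
    (nonInt_half_add (z := -u) (by rwa [norm_neg])).Gamma_ne_zero
  rw [← Gamma_half_add_mul_Gamma_half_sub hu']
  unfold gammaQuot gammaNum
  rw [show (-2 * (2 * 0 + u + -u) : ℂ) = 0 by ring, Complex.cpow_zero,
    show 0 + 2 * u + -u + 1 / 2 = 1 / 2 + u by ring,
    show 0 + u + 2 * -u + 1 / 2 = 1 / 2 - u by ring, show 0 - u + 1 / 2 = 1 / 2 - u by ring,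
    show 0 - -u + 1 / 2 = 1 / 2 + u by ring, show 0 + u + 2 * 0 + 1 / 2 = 1 / 2 + u by ring,
    show 0 + -u + 2 * 0 + 1 / 2 = 1 / 2 - u by ring, show 0 + u + 1 = 1 + u by ring,
    show 0 + -u + 1 = 1 - u by ring, show 2 * 0 + u + -u + 1 = 1 by ring,
    show (0 : ℂ) + 0 + 1 = 1 by ring, show 0 + u + -u + 0 + 1 = 1 by ring,
    show (0 : ℂ) - 0 + 1 = 1 by ring, show 0 + u + -u - 0 + 1 = 1 by ring,
    show -0 - u + 2 * 0 + 1 / 2 = 1 / 2 - u by ring,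
    show -0 - -u + 2 * 0 + 1 / 2 = 1 / 2 + u by ring, Complex.Gamma_one]
  generalize Complex.Gamma (1 / 2 + u) = X at *
  generalize Complex.Gamma (1 / 2 - u) = Y at *
  generalize (Complex.Gamma (1 + u))⁻¹ = s
  generalize (Complex.Gamma (1 - u))⁻¹ = t
  field_simp

/-- The factors of the summands on the curve `(0, u, -u, 0)`, in terms of `w = u²`. -/
def ratioSq (j : ℕ) (w : ℂ) : ℂ :=
  (1 - w * ((1 / 2 + (j : ℂ)) ^ 2)⁻¹) ^ 4 * (1 - w * ((1 + (j : ℂ)) ^ 2)⁻¹)⁻¹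

def polySq (n : ℕ) (w : ℂ) : ℂ :=
  (336 * (n : ℂ) ^ 4 + 320 * (n : ℂ) ^ 3 + (104 - 96 * w) * (n : ℂ) ^ 2 + (16 - 64 * w) * n
    + (1 - 8 * w + 16 * w ^ 2)) * (2 * (n : ℂ) + 1)⁻¹

theorem add_natCast_ne_zero {x : ℂ} (h : 0 < x.re) (n : ℕ) : x + n ≠ 0 := by
  intro h0
  have := congrArg Complex.re h0
  simp at this
  have : (0 : ℝ) ≤ n := n.cast_nonneg
  linarith

/-- The shifts occur in pairs `±u`, so each summand is a function of `u²` and a first derivative in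
`w = u²` suffices. -/
theorem term_antidiagonal {u : ℂ} (hu : ‖u‖ < 1 / 100) (n : ℕ) :
    term 0 u (-u) 0 n
      = coeff n * ((∏ j ∈ Finset.range n, ratioSq j (u ^ 2)) * polySq n (u ^ 2)) := by
  have hw : ∀ j, weightRatio 0 u (-u) 0 j
      = 1 / 64 * (((j : ℂ) + 1 / 2) / (j + 1)) ^ 7 * ratioSq j (u ^ 2) := by
    intro j
    have hu1 : ‖(-u)‖ < 1 := by rw [norm_neg]; linarith
    have hu2 : ‖u‖ < 1 := by linarith
    have p1 := add_natCast_ne_zero (x := 1 + u) (by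
      have := add_re_pos_of_norm_lt hu2; rw [add_comm] at this; simpa using this) j
    have p2 := add_natCast_ne_zero (x := 1 - u) (by
      have := add_re_pos_of_norm_lt hu1; rw [add_comm] at this; simpa using this) j
    have p3 := add_natCast_ne_zero (x := 1 / 2) (by norm_num) j
    have p4 := add_natCast_ne_zero (x := 1) (by norm_num) j
    unfold weightRatio pochRatio ratioSq
    rw [one_sub_sq_mul_inv p3, one_sub_sq_mul_inv p4, show 1 + (j : ℂ) - u = 1 - u + j by ring,
      show 1 + (j : ℂ) + u = 1 + u + j by ring,
      show 0 + u + 1 + (j : ℂ) = 1 + u + j by ring, show 0 + -u + 1 + (j : ℂ) = 1 - u + j by ring,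
      show (2 * 0 + u + -u + 1) / 2 + (j : ℂ) = 1 / 2 + j by ring,
      show (2 * 0 + u + -u + 2) / 2 + (j : ℂ) = 1 + j by ring,
      show 0 - 0 + 1 + (j : ℂ) = 1 + j by ring, show 0 + 0 + 1 + (j : ℂ) = 1 + j by ring,
      show 0 + u + -u - 0 + 1 + (j : ℂ) = 1 + j by ring,
      show 0 + u + -u + 0 + 1 + (j : ℂ) = 1 + j by ring,
      show (j : ℂ) + 1 = 1 + j by ring, show (j : ℂ) + 1 / 2 = 1 / 2 + j by ring,
      show 0 - u + 1 / 2 + (j : ℂ) = 1 / 2 + j - u by ring,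
      show 0 - -u + 1 / 2 + (j : ℂ) = 1 / 2 + j + u by ring,
      show 0 + 2 * u + -u + 1 / 2 + (j : ℂ) = 1 / 2 + j + u by ring,
      show 0 + u + 2 * -u + 1 / 2 + (j : ℂ) = 1 / 2 + j - u by ring,
      show 0 + u - 2 * 0 + 1 / 2 + (j : ℂ) = 1 / 2 + j + u by ring,
      show 0 + u + 2 * 0 + 1 / 2 + (j : ℂ) = 1 / 2 + j + u by ring,
      show 0 + -u - 2 * 0 + 1 / 2 + (j : ℂ) = 1 / 2 + j - u by ring,
      show 0 + -u + 2 * 0 + 1 / 2 + (j : ℂ) = 1 / 2 + j - u by ring]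
    generalize 1 / 2 + (j : ℂ) - u = x1 at *
    generalize 1 / 2 + (j : ℂ) + u = x2 at *
    generalize 1 / 2 + (j : ℂ) = x3 at *
    generalize 1 + u + (j : ℂ) = x4 at *
    generalize 1 - u + (j : ℂ) = x5 at *
    generalize 1 + (j : ℂ) = x6 at *
    field_simp
    ring
  unfold term
  rw [weight_eq_prod hw]
  unfold P polySq
  rw [show 2 * 0 + u + -u + 2 * n + 1 = 2 * (n : ℂ) + 1 by ring]
  generalize (2 * (n : ℂ) + 1)⁻¹ = y
  ring

theorem hasSum_antidiagonal {u : ℂ} (hu : ‖u‖ < 1 / 100) :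
    HasSum (fun n => (coeff n : ℂ)
        * ((∏ j ∈ Finset.range n, ratioSq j (u ^ 2)) * polySq n (u ^ 2)))
      (32 / (Real.pi * gammaQuot 0 u (-u) 0)) := by
  have h : Small 0 u (-u) 0 := ⟨by simp, hu, by rwa [norm_neg], by simp⟩
  rw [← funext (term_antidiagonal hu)]
  exact h.hasSum_term

theorem ratioSq_zero (j : ℕ) : ratioSq j 0 = 1 := by simp [ratioSq]

theorem polySq_zero (n : ℕ) : polySq n 0 = (p n : ℝ) := by
  have : 2 * (n : ℂ) + 1 ≠ 0 := by exact_mod_cast (by omega : 2 * n + 1 ≠ 0)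
  unfold polySq p
  push_cast
  rw [← div_eq_mul_inv, div_eq_iff this]
  ring

theorem hasSum_coeff_mul_p_complex :
    HasSum (fun n => (coeff n : ℂ) * (p n : ℝ)) (32 / Real.pi ^ 3) := by
  have h := hasSum_antidiagonal (u := 0) (by simp)
  have e : gammaQuot 0 0 (-0) 0 = Real.pi ^ 2 := by
    rw [gammaQuot_antidiagonal (by simp)]; simp
  rw [e] at h
  simp only [zero_pow two_ne_zero, ratioSq_zero, polySq_zero, Finset.prod_const_one, one_mul] at h
  convert h using 1
  ring

theorem hasSum_coeff_mul_p : HasSum (fun n => coeff n * p n) (32 / Real.pi ^ 3) := by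
  refine hasSum_of_complex hasSum_coeff_mul_p_complex (fun n => ?_) ?_ <;> push_cast <;> rfl

theorem norm_inv_two_mul_add_one_le (n : ℕ) : ‖(2 * (n : ℂ) + 1)⁻¹‖ ≤ 2 := by
  have := norm_inv_le_two (z := 1) (2 * n) (by norm_num)
  push_cast at this
  rwa [add_comm]

theorem norm_polySq_le (n : ℕ) {w : ℂ} (hw : w ∈ Metric.ball (0 : ℂ) (1 / 100)) :
    ‖polySq n w‖ ≤ 2000 * (n + 1) ^ 4 := by
  rw [mem_ball_zero_iff] at hw
  unfold polySq
  rw [norm_mul]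
  have h1 := norm_quartic_le (s := n) (N := n + 1) (by simp) (by simp) 336 320 (104 - 96 * w)
    (16 - 64 * w) (1 - 8 * w + 16 * w ^ 2)
  have e2 : ‖104 - 96 * w‖ ≤ 105 := by
    have := norm_sub_le 104 (96 * w)
    rw [norm_mul, Complex.norm_ofNat, Complex.norm_ofNat] at this
    linarith
  have e1 : ‖16 - 64 * w‖ ≤ 17 := by
    have := norm_sub_le 16 (64 * w)
    rw [norm_mul, Complex.norm_ofNat, Complex.norm_ofNat] at this
    linarith
  have e0 : ‖1 - 8 * w + 16 * w ^ 2‖ ≤ 2 := by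
    have h1 := norm_add_le (1 - 8 * w) (16 * w ^ 2)
    have h2 := norm_sub_le 1 (8 * w)
    have h3 : ‖w‖ ^ 2 ≤ 1 / 100 := by nlinarith [norm_nonneg w]
    rw [norm_mul, Complex.norm_ofNat, norm_pow] at h1
    rw [norm_mul, Complex.norm_ofNat, norm_one] at h2
    linarith
  rw [Complex.norm_ofNat, Complex.norm_ofNat] at h1
  refine (mul_le_mul h1 (norm_inv_two_mul_add_one_le n) (norm_nonneg _) (by positivity)).trans ?_
  have h4 : (0 : ℝ) ≤ ((n : ℝ) + 1) ^ 4 := by positivity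
  nlinarith

theorem norm_ratioSq_sub {w : ℂ} (hw : w ∈ Metric.ball (0 : ℂ) (1 / 100)) (j : ℕ) :
    ‖w * ((1 / 2 + (j : ℂ)) ^ 2)⁻¹‖ ≤ 1 / 20 ∧ ‖w * ((1 + (j : ℂ)) ^ 2)⁻¹‖ ≤ 1 / 20 := by
  rw [mem_ball_zero_iff] at hw
  exact ⟨norm_one_sub_mul_inv_le hw.le 2 (by norm_num) (by norm_num),
    norm_one_sub_mul_inv_le hw.le 2 (by norm_num) (by norm_num)⟩

theorem norm_ratioSq_le (j : ℕ) {w : ℂ} (hw : w ∈ Metric.ball (0 : ℂ) (1 / 100)) :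
    ‖ratioSq j w‖ ≤ 2 := by
  obtain ⟨h1, h2⟩ := norm_ratioSq_sub hw j
  unfold ratioSq
  rw [norm_mul, norm_pow]
  refine (mul_le_mul (pow_le_pow_left₀ (norm_nonneg _) (norm_one_sub_le h1) 4)
    (norm_inv_one_sub_le h2 (by norm_num)) (norm_nonneg _) (by norm_num)).trans (by norm_num)

theorem differentiableOn_ratioSq (j : ℕ) :
    DifferentiableOn ℂ (ratioSq j) (Metric.ball 0 (1 / 100)) := by
  intro w hw
  have h := one_sub_ne_zero (norm_ratioSq_sub hw j).2 (by norm_num)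
  unfold ratioSq
  refine DifferentiableAt.differentiableWithinAt ?_
  exact DifferentiableAt.mul (by fun_prop) (DifferentiableAt.inv (by fun_prop) h)

theorem hasDerivAt_ratioSq (j : ℕ) : HasDerivAt (ratioSq j)
    (-4 * ((1 / 2 + (j : ℂ)) ^ 2)⁻¹ + ((1 + (j : ℂ)) ^ 2)⁻¹) 0 := by
  have h := ((hasDerivAt_one_sub_mul ((1 / 2 + (j : ℂ)) ^ 2)⁻¹).pow 4).mul
    ((hasDerivAt_one_sub_mul ((1 + (j : ℂ)) ^ 2)⁻¹).inv (by simp))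
  refine HasDerivAt.congr_deriv h ?_
  simp

theorem hasDerivAt_polySq (n : ℕ) : HasDerivAt (polySq n) (-(48 * n + 8)) 0 := by
  have : 2 * (n : ℂ) + 1 ≠ 0 := by exact_mod_cast (by omega : 2 * n + 1 ≠ 0)
  have i := hasDerivAt_id (0 : ℂ)
  have h := ((((i.const_mul 96).const_sub 104).mul_const ((n : ℂ) ^ 2)).const_add
    (336 * (n : ℂ) ^ 4 + 320 * (n : ℂ) ^ 3)).add
    (((i.const_mul 64).const_sub 16).mul_const (n : ℂ)) |>.add
    (((i.const_mul 8).const_sub 1).add ((i.pow 2).const_mul 16)) |>.mul_const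
    ((2 * (n : ℂ) + 1)⁻¹)
  refine HasDerivAt.congr_deriv h ?_
  rw [← div_eq_mul_inv, div_eq_iff this]
  simp
  ring

theorem sum_ratioSq_deriv (n : ℕ) : ∑ j ∈ Finset.range n, (-4 * ((1 / 2 + (j : ℂ)) ^ 2)⁻¹
    + ((1 + (j : ℂ)) ^ 2)⁻¹) = ((-(16 * H 2 (2 * n) - 5 * H 2 n) : ℝ) : ℂ) := by
  have h : ∑ j ∈ Finset.range n, (-4 * (((j : ℝ) + 1 / 2) ^ 2)⁻¹ + (((j : ℝ) + 1) ^ 2)⁻¹)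
      = -(16 * H 2 (2 * n) - 5 * H 2 n) := by
    rw [Finset.sum_add_distrib, ← Finset.mul_sum, sum_odd_eq_H, sum_nat_eq_H]
    ring
  rw [← h]
  push_cast
  simp only [add_comm]

theorem hasSum_coeff_H2 : HasSum (fun n : ℕ => coeff n *
    (p n * (16 * H 2 (2 * n) - 5 * H 2 n) + 48 * n + 8)) (80 / (3 * Real.pi)) := by
  have hpi : (Real.pi : ℂ) ≠ 0 := by exact_mod_cast Real.pi_ne_zero
  obtain ⟨S', hS, hsum⟩ := hasSum_deriv_weighted (by norm_num : (0 : ℝ) < 1 / 100)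
    differentiableOn_ratioSq (fun n w hw => norm_ratioSq_le n hw) ratioSq_zero hasDerivAt_ratioSq
    (fun n => by unfold polySq; fun_prop) (fun n w hw => norm_polySq_le n hw) hasDerivAt_polySq
  have hslope := (hasDerivAt_iff_tendsto_slope_zero.1 hS).comp
    (tendsto_pow_punctured two_ne_zero)
  have hlim := ((tendsto_mul_cos_sq_div_sin.comp (tendsto_const_mul_punctured hpi)).const_mul
    (32 / (Real.pi : ℂ) ^ 3 * Real.pi ^ 2))
  have hS' : S' = 32 / (Real.pi : ℂ) ^ 3 * Real.pi ^ 2 * (-5 / 6) := by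
    -- The derivative in `w` at `0` is the limit of difference quotients at `w = u²`, where the
    -- series has its closed form.
    refine tendsto_nhds_unique (hslope.congr' ?_) hlim
    have hball : ∀ᶠ u : ℂ in 𝓝[≠] 0, ‖u‖ < 1 / 100 := by
      refine nhdsWithin_le_nhds ?_
      filter_upwards [Metric.ball_mem_nhds (0 : ℂ) (by norm_num : (0 : ℝ) < 1 / 100)] with u hu
      simpa using hu
    filter_upwards [hball, self_mem_nhdsWithin] with u hu hu0
    have hu0 : u ≠ 0 := hu0
    have hN := nonInt_of_norm_lt_one hu0 (hu.trans (by norm_num))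
    have hsin := hN.sin_ne_zero
    have e1 := (hasSum_antidiagonal hu).tsum_eq
    have e0 := (hasSum_antidiagonal (u := 0) (by simp)).tsum_eq
    have eg : gammaQuot 0 0 (-0) 0 = Real.pi ^ 2 := by
      rw [gammaQuot_antidiagonal (by simp)]; simp
    have hcos : Complex.cos (Real.pi * u) ≠ 0 := by
      have := (nonInt_half_add (hu.trans (by norm_num))).sin_ne_zero
      rwa [mul_add, add_comm, show (Real.pi : ℂ) * (1 / 2) = Real.pi / 2 by ring,
        Complex.sin_add_pi_div_two] at this
    rw [eg, zero_pow two_ne_zero] at e0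
    rw [gammaQuot_antidiagonal hu, inv_Gamma_one_add_mul_inv_Gamma_one_sub hu0] at e1
    simp only [Function.comp, smul_eq_mul, zero_add, e1, e0]
    field_simp
  have hneg := hsum.neg
  rw [hS'] at hneg
  refine hasSum_of_complex hneg (fun n => ?_) ?_
  · rw [sum_ratioSq_deriv, polySq_zero]
    push_cast
    ring
  · push_cast
    field_simp
    norm_num

end Seed9
end

/-! ### The quartic curve and fourth-order harmonic numbers. -/

noncomputable section
namespace Seed9
open Filter Topology

/-- The cosine product is `(cos 2z + cos 2iz)/2 = 1 + 2z⁴/3 + …`, and `sin z sin(iz)/(iz²) = 1 +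
(1/60 - 1/36) z⁴ + …`. The quadratic terms cancel, and `2/3 - 1/60 + 1/36 = 61/90`. -/
theorem tendsto_quartic_coefficient :
    Tendsto (fun z => (Complex.cos (z + Complex.I * z) * Complex.cos (z - Complex.I * z)
      * (z * (Complex.I * z)) / (Complex.sin z * Complex.sin (Complex.I * z)) - 1) / z ^ 4)
      (𝓝[≠] 0) (𝓝 (61 / 90)) := by
  have h0 : Tendsto (fun z : ℂ => z) (𝓝[≠] 0) (𝓝 0) := tendsto_id.mono_left nhdsWithin_le_nhds
  have hI := tendsto_const_mul_punctured Complex.I_ne_zero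
  have h2 := tendsto_const_mul_punctured (two_ne_zero (α := ℂ))
  have a1 := tendsto_sin_div
  have a2 := tendsto_sin_div.comp hI
  have e1 := tendsto_sinRem
  have e2 := tendsto_sinRem.comp hI
  have d1 := tendsto_cosRem.comp h2
  have d2 := tendsto_cosRem.comp (h2.comp hI)
  have hN : Tendsto (fun z : ℂ => 2 / 3 + 8 * (cosRem (2 * z) + cosRem (2 * (Complex.I * z)))
      - 1 / 60 - z ^ 4 / 14400 + 1 / 36
      - sinRem z * (Complex.sin (Complex.I * z) / (Complex.I * z))
      - sinRem (Complex.I * z) * (1 + z ^ 4 / 120 - z ^ 2 / 6)) (𝓝[≠] 0)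
      (𝓝 (2 / 3 + 8 * (0 + 0) - 1 / 60 - 0 ^ 4 / 14400 + 1 / 36 - 0 * 1
        - 0 * (1 + 0 ^ 4 / 120 - 0 ^ 2 / 6))) :=
    (((((((d1.add d2).const_mul 8).const_add (2 / 3)).sub_const (1 / 60)).sub
      ((h0.pow 4).div_const 14400)).add_const (1 / 36)).sub (e1.mul a2)).sub
      (e2.mul ((((h0.pow 4).div_const 120).const_add 1).sub ((h0.pow 2).div_const 6)))
  refine ((hN.div (a1.mul a2) (by norm_num)).congr' ?_).trans_eq (by norm_num)
  filter_upwards [self_mem_nhdsWithin, a1.eventually_ne one_ne_zero,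
    a2.eventually_ne one_ne_zero] with z hz hs1 hs2
  have hz : z ≠ 0 := hz
  have hIz : Complex.I * z ≠ 0 := mul_ne_zero Complex.I_ne_zero hz
  have hs1 : Complex.sin z ≠ 0 := fun h => hs1 (by rw [h, zero_div])
  have hs2 : Complex.sin (Complex.I * z) ≠ 0 := fun h => hs2 (by
    simp only [Function.comp, h, zero_div])
  have i2 : Complex.I ^ 2 = -1 := Complex.I_sq
  have i4 : Complex.I ^ 4 = 1 := Complex.I_pow_four
  have f1 := sin_eq_sinRem z
  have f2 := sin_eq_sinRem (Complex.I * z)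
  have g1 := cos_eq_cosRem (2 * z)
  have g2 := cos_eq_cosRem (2 * (Complex.I * z))
  have hc : Complex.cos (z + Complex.I * z) * Complex.cos (z - Complex.I * z)
      = (Complex.cos (2 * z) + Complex.cos (2 * (Complex.I * z))) / 2 := by
    rw [Complex.cos_add_cos]
    ring_nf
  rw [show (Complex.I * z) ^ 3 = (Complex.I * z) * (Complex.I ^ 2 * z ^ 2) by ring,
    show (Complex.I * z) ^ 5 = (Complex.I * z) * (Complex.I ^ 4 * z ^ 4) by ring, i2, i4] at f2
  rw [show (2 * (Complex.I * z)) ^ 2 = 4 * (Complex.I ^ 2 * z ^ 2) by ring,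
    show (2 * (Complex.I * z)) ^ 4 = 16 * (Complex.I ^ 4 * z ^ 4) by ring, i2, i4] at g2
  rw [hc]
  simp only [Pi.div_apply, Function.comp]
  have f1' : Complex.sin z / z = 1 - z ^ 2 / 6 + z ^ 4 / 120 + z ^ 4 * sinRem z := by
    rw [div_eq_iff hz, f1]; ring
  have f2' : Complex.sin (Complex.I * z) / (Complex.I * z)
      = 1 + z ^ 2 / 6 + z ^ 4 / 120 + z ^ 4 * sinRem (Complex.I * z) := by
    rw [div_eq_iff hIz, f2]; ring
  have hs1' : Complex.sin z / z ≠ 0 := div_ne_zero hs1 hz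
  have hs2' : Complex.sin (Complex.I * z) / (Complex.I * z) ≠ 0 := div_ne_zero hs2 hIz
  rw [show (Complex.cos (2 * z) + Complex.cos (2 * (Complex.I * z))) / 2 * (z * (Complex.I * z))
      / (Complex.sin z * Complex.sin (Complex.I * z))
      = (Complex.cos (2 * z) + Complex.cos (2 * (Complex.I * z))) / 2
        / (Complex.sin z / z * (Complex.sin (Complex.I * z) / (Complex.I * z))) by
      field_simp]
  rw [div_sub_one (mul_ne_zero hs1' hs2'), div_right_comm]
  congr 1
  rw [f1', f2', g1, g2, eq_div_iff (pow_ne_zero 4 hz)]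
  ring

theorem gammaQuot_diagonal {t u : ℂ} (h₁ : ‖2 * t + u‖ < 1 / 2) (h₂ : ‖2 * t - u‖ < 1 / 2) :
    gammaQuot t (-t + u) (-t - u) t = Real.pi / Complex.cos (Real.pi * (2 * t + u))
      * (Real.pi / Complex.cos (Real.pi * (2 * t - u)))
      * ((Complex.Gamma (1 + u))⁻¹ * (Complex.Gamma (1 - u))⁻¹)
      * ((Complex.Gamma (1 + 2 * t))⁻¹ * (Complex.Gamma (1 - 2 * t))⁻¹) := by
  have hX := (nonInt_half_add h₁).Gamma_ne_zero
  have hY := (nonInt_half_add h₂).Gamma_ne_zero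
  rw [← Gamma_half_add_mul_Gamma_half_sub h₁, ← Gamma_half_add_mul_Gamma_half_sub h₂]
  unfold gammaQuot gammaNum
  rw [show (-2 * (2 * t + (-t + u) + (-t - u)) : ℂ) = 0 by ring, Complex.cpow_zero,
    show t + 2 * (-t + u) + (-t - u) + 1 / 2 = 1 / 2 - (2 * t - u) by ring,
    show t + (-t + u) + 2 * (-t - u) + 1 / 2 = 1 / 2 - (2 * t + u) by ring,
    show t - (-t + u) + 1 / 2 = 1 / 2 + (2 * t - u) by ring,
    show t - (-t - u) + 1 / 2 = 1 / 2 + (2 * t + u) by ring,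
    show t + (-t + u) + 2 * t + 1 / 2 = 1 / 2 + (2 * t + u) by ring,
    show t + (-t - u) + 2 * t + 1 / 2 = 1 / 2 + (2 * t - u) by ring,
    show t + (-t + u) + 1 = 1 + u by ring, show t + (-t - u) + 1 = 1 - u by ring,
    show 2 * t + (-t + u) + (-t - u) + 1 = 1 by ring, show t + t + 1 = 1 + 2 * t by ring,
    show t + (-t + u) + (-t - u) + t + 1 = 1 by ring, show t - t + 1 = 1 by ring,
    show t + (-t + u) + (-t - u) - t + 1 = 1 - 2 * t by ring,
    show -t - (-t + u) + 2 * t + 1 / 2 = 1 / 2 + (2 * t - u) by ring,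
    show -t - (-t - u) + 2 * t + 1 / 2 = 1 / 2 + (2 * t + u) by ring, Complex.Gamma_one]
  generalize Complex.Gamma (1 / 2 + (2 * t + u)) = X at *
  generalize Complex.Gamma (1 / 2 + (2 * t - u)) = Y at *
  generalize Complex.Gamma (1 / 2 - (2 * t + u)) = X' at *
  generalize Complex.Gamma (1 / 2 - (2 * t - u)) = Y' at *
  generalize (Complex.Gamma (1 + u))⁻¹ = s
  generalize (Complex.Gamma (1 - u))⁻¹ = s'
  generalize (Complex.Gamma (1 + 2 * t))⁻¹ = r
  generalize (Complex.Gamma (1 - 2 * t))⁻¹ = r'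
  field_simp

/-- The factors of the summands on the curve `(t, -t + 2it, -t - 2it, t)`, in terms of
`w = t⁴`. -/
def ratioQuart (j : ℕ) (w : ℂ) : ℂ :=
  (1 - w * (-64 * ((1 / 2 + (j : ℂ)) ^ 4)⁻¹)) ^ 2 * (1 - w * (16 * ((1 + (j : ℂ)) ^ 4)⁻¹))⁻¹

def polyQuart (n : ℕ) (w : ℂ) : ℂ :=
  (336 * (n : ℂ) ^ 4 + 320 * (n : ℂ) ^ 3 + 104 * (n : ℂ) ^ 2 + 16 * n + (1 + 1024 * w))
    * (2 * (n : ℂ) + 1)⁻¹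

/-- With `u² = -4t²` the four shifts are permuted by multiplication by `i`, so the product is `x⁴ +
64t⁴`, and in the companion lemma `x⁴ - 16t⁴`. This is why the curve involves only `t⁴`. -/
theorem one_sub_quartic_mul_inv {x t u : ℂ} (hx : x ≠ 0) (hu : u ^ 2 + 4 * t ^ 2 = 0) :
    1 - t ^ 4 * (-64 * (x ^ 4)⁻¹) = (x + (2 * t + u)) * (x - (2 * t + u)) * (x + (2 * t - u))
      * (x - (2 * t - u)) * (x ^ 4)⁻¹ := by
  field_simp
  linear_combination (2 * x ^ 2 - (4 * t ^ 2 + u ^ 2) + 16 * t ^ 2) * hu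

theorem one_sub_quartic_mul_inv' {x t u : ℂ} (hx : x ≠ 0) (hu : u ^ 2 + 4 * t ^ 2 = 0) :
    1 - t ^ 4 * (16 * (x ^ 4)⁻¹) = (x + u) * (x - u) * (x + 2 * t)
      * (x - 2 * t) * (x ^ 4)⁻¹ := by
  field_simp
  linear_combination (x ^ 2 - 4 * t ^ 2) * hu

theorem P_diagonal {t u : ℂ} (hu : u ^ 2 + 4 * t ^ 2 = 0) (n : ℕ) :
    P t (-t + u) (-t - u) t n = 336 * (n : ℂ) ^ 4 + 320 * (n : ℂ) ^ 3 + 104 * (n : ℂ) ^ 2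
      + 16 * n + (1 + 1024 * t ^ 4) := by
  have h2 : u ^ 2 = -4 * t ^ 2 := by linear_combination hu
  have h4 : u ^ 4 = 16 * t ^ 4 := by linear_combination (u ^ 2 - 4 * t ^ 2) * hu
  unfold P
  ring_nf
  simp only [h2, h4]
  ring

theorem natCast_add_norm_lt {z : ℂ} (h : ‖z‖ < 1) (n : ℕ) : 1 + n + z ≠ 0 := by
  have := add_natCast_ne_zero (x := 1 + z) (by
    have := add_re_pos_of_norm_lt h; rw [add_comm] at this; simpa using this) n
  rwa [add_right_comm] at this

theorem term_diagonal {t u : ℂ} (ht : ‖t‖ < 1 / 1000) (hu' : ‖u‖ < 1 / 100)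
    (hu : u ^ 2 + 4 * t ^ 2 = 0) (n : ℕ) : term t (-t + u) (-t - u) t n
      = coeff n * ((∏ j ∈ Finset.range n, ratioQuart j (t ^ 4)) * polyQuart n (t ^ 4)) := by
  have hw : ∀ j, weightRatio t (-t + u) (-t - u) t j
      = 1 / 64 * (((j : ℂ) + 1 / 2) / (j + 1)) ^ 7 * ratioQuart j (t ^ 4) := by
    intro j
    have n2 : ‖2 * t‖ < 1 := by rw [norm_mul, Complex.norm_ofNat]; linarith
    have p1 := natCast_add_norm_lt (z := u) (by linarith) j
    have p2 := natCast_add_norm_lt (z := -u) (by rw [norm_neg]; linarith) j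
    have p5 := natCast_add_norm_lt n2 j
    have p6 := natCast_add_norm_lt (z := -(2 * t)) (by rwa [norm_neg]) j
    rw [← sub_eq_add_neg] at p2 p6
    have p3 := add_natCast_ne_zero (x := 1 / 2) (by norm_num) j
    have p4 := add_natCast_ne_zero (x := 1) (by norm_num) j
    unfold weightRatio pochRatio ratioQuart
    rw [one_sub_quartic_mul_inv p3 hu, one_sub_quartic_mul_inv' p4 hu,
      show t + (-t + u) + 1 + (j : ℂ) = 1 + j + u by ring,
      show t + (-t - u) + 1 + (j : ℂ) = 1 + j - u by ring,
      show (2 * t + (-t + u) + (-t - u) + 1) / 2 + (j : ℂ) = 1 / 2 + j by ring,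
      show (2 * t + (-t + u) + (-t - u) + 2) / 2 + (j : ℂ) = 1 + j by ring,
      show t - t + 1 + (j : ℂ) = 1 + j by ring, show t + t + 1 + (j : ℂ) = 1 + j + 2 * t by ring,
      show t + (-t + u) + (-t - u) - t + 1 + (j : ℂ) = 1 + j - 2 * t by ring,
      show t + (-t + u) + (-t - u) + t + 1 + (j : ℂ) = 1 + j by ring,
      show (j : ℂ) + 1 = 1 + j by ring, show (j : ℂ) + 1 / 2 = 1 / 2 + j by ring,
      show t - (-t + u) + 1 / 2 + (j : ℂ) = 1 / 2 + j + (2 * t - u) by ring,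
      show t - (-t - u) + 1 / 2 + (j : ℂ) = 1 / 2 + j + (2 * t + u) by ring,
      show t + 2 * (-t + u) + (-t - u) + 1 / 2 + (j : ℂ) = 1 / 2 + j - (2 * t - u) by ring,
      show t + (-t + u) + 2 * (-t - u) + 1 / 2 + (j : ℂ) = 1 / 2 + j - (2 * t + u) by ring,
      show t + (-t + u) - 2 * t + 1 / 2 + (j : ℂ) = 1 / 2 + j - (2 * t - u) by ring,
      show t + (-t + u) + 2 * t + 1 / 2 + (j : ℂ) = 1 / 2 + j + (2 * t + u) by ring,
      show t + (-t - u) - 2 * t + 1 / 2 + (j : ℂ) = 1 / 2 + j - (2 * t + u) by ring,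
      show t + (-t - u) + 2 * t + 1 / 2 + (j : ℂ) = 1 / 2 + j + (2 * t - u) by ring]
    generalize 1 / 2 + (j : ℂ) - (2 * t + u) = x1 at *
    generalize 1 / 2 + (j : ℂ) + (2 * t + u) = x2 at *
    generalize 1 / 2 + (j : ℂ) - (2 * t - u) = x7 at *
    generalize 1 / 2 + (j : ℂ) + (2 * t - u) = x8 at *
    generalize 1 / 2 + (j : ℂ) = x3 at *
    generalize 1 + (j : ℂ) + u = x4 at *
    generalize 1 + (j : ℂ) - u = x5 at *
    generalize 1 + (j : ℂ) + 2 * t = x9 at *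
    generalize 1 + (j : ℂ) - 2 * t = x10 at *
    generalize 1 + (j : ℂ) = x6 at *
    field_simp
    ring
  unfold term
  rw [weight_eq_prod hw, P_diagonal hu]
  unfold polyQuart
  rw [show 2 * t + (-t + u) + (-t - u) + 2 * n + 1 = 2 * (n : ℂ) + 1 by ring]
  generalize (2 * (n : ℂ) + 1)⁻¹ = y
  ring

theorem hasSum_diagonal {t u : ℂ} (ht : ‖t‖ < 1 / 1000) (hu : u = 2 * Complex.I * t) :
    HasSum (fun n => (coeff n : ℂ)
        * ((∏ j ∈ Finset.range n, ratioQuart j (t ^ 4)) * polyQuart n (t ^ 4)))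
      (32 / (Real.pi * gammaQuot t (-t + u) (-t - u) t)) := by
  have hun : ‖u‖ = 2 * ‖t‖ := by rw [hu]; simp
  have hu2 : u ^ 2 + 4 * t ^ 2 = 0 := by
    rw [hu]; linear_combination 4 * t ^ 2 * Complex.I_sq
  have h1 := norm_add_le (-t) u
  have h2 := norm_sub_le (-t) u
  rw [norm_neg] at h1 h2
  have h : Small t (-t + u) (-t - u) t :=
    ⟨by linarith, by linarith, by linarith, by linarith⟩
  rw [← funext (term_diagonal ht (by linarith) hu2)]
  exact h.hasSum_term

theorem ratioQuart_zero (j : ℕ) : ratioQuart j 0 = 1 := by simp [ratioQuart]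

theorem polyQuart_zero (n : ℕ) : polyQuart n 0 = (p n : ℝ) := by
  have : 2 * (n : ℂ) + 1 ≠ 0 := by exact_mod_cast (by omega : 2 * n + 1 ≠ 0)
  unfold polyQuart p
  push_cast
  rw [← div_eq_mul_inv, div_eq_iff this]
  ring

theorem norm_polyQuart_le (n : ℕ) {w : ℂ} (hw : w ∈ Metric.ball (0 : ℂ) (1 / 10000)) :
    ‖polyQuart n w‖ ≤ 2000 * (n + 1) ^ 4 := by
  rw [mem_ball_zero_iff] at hw
  unfold polyQuart
  rw [norm_mul]
  have h1 := norm_quartic_le (s := n) (N := n + 1) (by simp) (by simp) 336 320 104 16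
    (1 + 1024 * w)
  have e0 : ‖1 + 1024 * w‖ ≤ 2 := by
    have h1 := norm_add_le 1 (1024 * w)
    rw [norm_mul, Complex.norm_ofNat, norm_one] at h1
    linarith
  simp only [Complex.norm_ofNat] at h1
  refine (mul_le_mul h1 (norm_inv_two_mul_add_one_le n) (norm_nonneg _) (by positivity)).trans ?_
  have h4 : (0 : ℝ) ≤ ((n : ℝ) + 1) ^ 4 := by positivity
  nlinarith

/-- The radius makes `64 · 2⁴ / 10000` less than `1/5`, which gives `(6/5)² / (4/5) ≤ 2` in
`norm_ratioQuart_le`. -/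
theorem norm_ratioQuart_sub {w : ℂ} (hw : w ∈ Metric.ball (0 : ℂ) (1 / 10000)) (j : ℕ) :
    ‖w * (-64 * ((1 / 2 + (j : ℂ)) ^ 4)⁻¹)‖ ≤ 1 / 5 ∧
      ‖w * (16 * ((1 + (j : ℂ)) ^ 4)⁻¹)‖ ≤ 1 / 5 := by
  rw [mem_ball_zero_iff] at hw
  rw [← mul_assoc, ← mul_assoc]
  constructor
  · refine norm_one_sub_mul_inv_le (r := 64 / 10000) ?_ 4 (by norm_num) (by norm_num)
    rw [norm_mul, norm_neg, Complex.norm_ofNat]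
    linarith
  · refine norm_one_sub_mul_inv_le (r := 16 / 10000) ?_ 4 (by norm_num) (by norm_num)
    rw [norm_mul, Complex.norm_ofNat]
    linarith

theorem norm_ratioQuart_le (j : ℕ) {w : ℂ} (hw : w ∈ Metric.ball (0 : ℂ) (1 / 10000)) :
    ‖ratioQuart j w‖ ≤ 2 := by
  obtain ⟨h1, h2⟩ := norm_ratioQuart_sub hw j
  unfold ratioQuart
  rw [norm_mul, norm_pow]
  refine (mul_le_mul (pow_le_pow_left₀ (norm_nonneg _) (norm_one_sub_le h1) 2)
    (norm_inv_one_sub_le h2 (by norm_num)) (norm_nonneg _) (by norm_num)).trans (by norm_num)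

theorem differentiableOn_ratioQuart (j : ℕ) :
    DifferentiableOn ℂ (ratioQuart j) (Metric.ball 0 (1 / 10000)) := by
  intro w hw
  have h := one_sub_ne_zero (norm_ratioQuart_sub hw j).2 (by norm_num)
  unfold ratioQuart
  refine DifferentiableAt.differentiableWithinAt ?_
  exact DifferentiableAt.mul (by fun_prop) (DifferentiableAt.inv (by fun_prop) h)

theorem hasDerivAt_ratioQuart (j : ℕ) : HasDerivAt (ratioQuart j)
    (128 * ((1 / 2 + (j : ℂ)) ^ 4)⁻¹ + 16 * ((1 + (j : ℂ)) ^ 4)⁻¹) 0 := by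
  have h := ((hasDerivAt_one_sub_mul (-64 * ((1 / 2 + (j : ℂ)) ^ 4)⁻¹)).pow 2).mul
    ((hasDerivAt_one_sub_mul (16 * ((1 + (j : ℂ)) ^ 4)⁻¹)).inv (by simp))
  refine HasDerivAt.congr_deriv h ?_
  simp
  ring

theorem hasDerivAt_polyQuart (n : ℕ) :
    HasDerivAt (polyQuart n) (1024 * (2 * (n : ℂ) + 1)⁻¹) 0 := by
  have h := ((((hasDerivAt_id (0 : ℂ)).const_mul 1024).const_add 1).const_add
    (336 * (n : ℂ) ^ 4 + 320 * (n : ℂ) ^ 3 + 104 * (n : ℂ) ^ 2 + 16 * n)).mul_const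
    ((2 * (n : ℂ) + 1)⁻¹)
  exact HasDerivAt.congr_deriv h (by ring)

theorem sum_ratioQuart_deriv (n : ℕ) : ∑ j ∈ Finset.range n, (128 * ((1 / 2 + (j : ℂ)) ^ 4)⁻¹
    + 16 * ((1 + (j : ℂ)) ^ 4)⁻¹) = ((16 * (128 * H 4 (2 * n) - 7 * H 4 n) : ℝ) : ℂ) := by
  have h : ∑ j ∈ Finset.range n, (128 * (((j : ℝ) + 1 / 2) ^ 4)⁻¹ + 16 * (((j : ℝ) + 1) ^ 4)⁻¹)
      = 16 * (128 * H 4 (2 * n) - 7 * H 4 n) := by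
    rw [Finset.sum_add_distrib, ← Finset.mul_sum, ← Finset.mul_sum, sum_odd_eq_H, sum_nat_eq_H]
    ring
  rw [← h]
  push_cast
  simp only [add_comm]

theorem cos_pi_mul_ne_zero {z : ℂ} (hz : ‖z‖ < 1 / 2) : Complex.cos (Real.pi * z) ≠ 0 := by
  have := (nonInt_half_add hz).sin_ne_zero
  rwa [mul_add, add_comm, show (Real.pi : ℂ) * (1 / 2) = Real.pi / 2 by ring,
    Complex.sin_add_pi_div_two] at this

theorem hasSum_coeff_H4 : HasSum (fun n : ℕ => coeff n *
    (p n * (128 * H 4 (2 * n) - 7 * H 4 n) + 64 / (2 * n + 1))) (976 * Real.pi / 45) := by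
  have hpi : (Real.pi : ℂ) ≠ 0 := by exact_mod_cast Real.pi_ne_zero
  obtain ⟨S', hS, hsum⟩ := hasSum_deriv_weighted (by norm_num : (0 : ℝ) < 1 / 10000)
    differentiableOn_ratioQuart (fun n w hw => norm_ratioQuart_le n hw) ratioQuart_zero
    hasDerivAt_ratioQuart (fun n => by unfold polyQuart; fun_prop)
    (fun n w hw => norm_polyQuart_le n hw) hasDerivAt_polyQuart
  have hslope := (hasDerivAt_iff_tendsto_slope_zero.1 hS).comp
    (tendsto_pow_punctured four_ne_zero)
  have h2pi : (2 * Real.pi : ℂ) ≠ 0 := mul_ne_zero two_ne_zero hpi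
  -- With `z = 2πt` the closed form becomes `32/π³` times the function of
  -- `tendsto_quartic_coefficient`, since `πu = iz`.
  have hlim := ((tendsto_quartic_coefficient.comp (tendsto_const_mul_punctured h2pi)).const_mul
    (32 / (Real.pi : ℂ) ^ 3 * (2 * Real.pi) ^ 4))
  have hS' : S' = 32 / (Real.pi : ℂ) ^ 3 * (2 * Real.pi) ^ 4 * (61 / 90) := by
    refine tendsto_nhds_unique (hslope.congr' ?_) hlim
    have hball : ∀ᶠ u : ℂ in 𝓝[≠] 0, ‖u‖ < 1 / 1000 := by
      refine nhdsWithin_le_nhds ?_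
      filter_upwards [Metric.ball_mem_nhds (0 : ℂ) (by norm_num : (0 : ℝ) < 1 / 1000)] with u hu
      simpa using hu
    filter_upwards [hball, self_mem_nhdsWithin] with t ht ht0
    have ht0 : t ≠ 0 := ht0
    obtain ⟨u, hu⟩ : ∃ u, u = 2 * Complex.I * t := ⟨_, rfl⟩
    have hun : ‖u‖ = 2 * ‖t‖ := by rw [hu]; simp
    have htn : ‖2 * t‖ = 2 * ‖t‖ := by simp
    have hu0 : u ≠ 0 := by rw [hu]; simp [ht0]
    have h2t : 2 * t ≠ 0 := mul_ne_zero two_ne_zero ht0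
    have h₁ : ‖2 * t + u‖ < 1 / 2 := by linarith [norm_add_le (2 * t) u]
    have h₂ : ‖2 * t - u‖ < 1 / 2 := by linarith [norm_sub_le (2 * t) u]
    have s1 := (nonInt_of_norm_lt_one hu0 (by linarith)).sin_ne_zero
    have s2 := (nonInt_of_norm_lt_one h2t (by linarith)).sin_ne_zero
    have c1 := cos_pi_mul_ne_zero h₁
    have c2 := cos_pi_mul_ne_zero h₂
    have e1 := (hasSum_diagonal ht hu).tsum_eq
    have e0 := hasSum_coeff_mul_p_complex.tsum_eq
    rw [gammaQuot_diagonal h₁ h₂, inv_Gamma_one_add_mul_inv_Gamma_one_sub hu0,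
      inv_Gamma_one_add_mul_inv_Gamma_one_sub h2t] at e1
    simp only [Function.comp, smul_eq_mul, zero_add, e1, ratioQuart_zero, polyQuart_zero,
      Finset.prod_const_one, one_mul, e0]
    rw [show 2 * Real.pi * t + Complex.I * (2 * Real.pi * t) = Real.pi * (2 * t + u) by
        rw [hu]; ring,
      show 2 * Real.pi * t - Complex.I * (2 * Real.pi * t) = Real.pi * (2 * t - u) by
        rw [hu]; ring,
      show Complex.I * (2 * Real.pi * t) = Real.pi * u by rw [hu]; ring,
      show 2 * Real.pi * t = Real.pi * (2 * t) by ring]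
    field_simp
  -- Both the harmonic part and the derivative `1024/(2n+1)` of `polyQuart` carry a factor `16`.
  have hdiv := hsum.div_const 16
  rw [hS'] at hdiv
  refine hasSum_of_complex hdiv (fun n => ?_) ?_
  · rw [sum_ratioQuart_deriv, polyQuart_zero]
    push_cast
    rw [div_eq_mul_inv (64 : ℂ)]
    ring
  · push_cast
    field_simp
    norm_num

end Seed9
end

/-! ### The line `(t, 0, 0, t)` and first-order harmonic numbers. -/

noncomputable section
namespace Seed9
open Filter Topology

/-- The factors of the summands on the line `(t, 0, 0, t)`. -/
def ratioLin (j : ℕ) (t : ℂ) : ℂ :=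
  (1 - t * (-(1 / 2 + (j : ℂ))⁻¹)) ^ 3 * (1 - t * (1 / 2 + (j : ℂ))⁻¹) ^ 2
    * (1 - t * (-3 * (1 / 2 + (j : ℂ))⁻¹)) ^ 2 * (1 - t * (-(1 + (j : ℂ))⁻¹))⁻¹ ^ 3
    * (1 - t * (-2 * (1 + (j : ℂ))⁻¹))⁻¹ ^ 2

def polyLin (n : ℕ) (t : ℂ) : ℂ :=
  (336 * (t + n) ^ 4 + 320 * (t + n) ^ 3 + (104 - 192 * t ^ 2) * (t + n) ^ 2
    + (16 - 128 * t ^ 2) * (t + n) + (1 - 16 * t ^ 2)) * (2 * t + 2 * n + 1)⁻¹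

theorem norm_ratioLin_sub {t : ℂ} (ht : t ∈ Metric.ball (0 : ℂ) (1 / 100)) (j : ℕ) :
    ‖t * (-(1 / 2 + (j : ℂ))⁻¹)‖ ≤ 1 / 50 ∧ ‖t * (1 / 2 + (j : ℂ))⁻¹‖ ≤ 1 / 50 ∧
      ‖t * (-3 * (1 / 2 + (j : ℂ))⁻¹)‖ ≤ 3 / 50 ∧ ‖t * (-(1 + (j : ℂ))⁻¹)‖ ≤ 1 / 50 ∧
      ‖t * (-2 * (1 + (j : ℂ))⁻¹)‖ ≤ 1 / 25 := by
  rw [mem_ball_zero_iff] at ht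
  have h1 := norm_inv_le_two (z := 1 / 2) j (by norm_num)
  have h2 := norm_inv_le_two (z := 1) j (by norm_num)
  simp only [norm_mul, norm_neg, Complex.norm_ofNat]
  have h0 := norm_nonneg t
  have h3 : ‖t‖ * ‖(1 / 2 + (j : ℂ))⁻¹‖ ≤ 1 / 100 * 2 :=
    mul_le_mul ht.le h1 (norm_nonneg _) (by norm_num)
  have h4 : ‖t‖ * ‖(1 + (j : ℂ))⁻¹‖ ≤ 1 / 100 * 2 :=
    mul_le_mul ht.le h2 (norm_nonneg _) (by norm_num)
  refine ⟨?_, ?_, ?_, ?_, ?_⟩ <;> linarith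

theorem norm_ratioLin_le (j : ℕ) {t : ℂ} (ht : t ∈ Metric.ball (0 : ℂ) (1 / 100)) :
    ‖ratioLin j t‖ ≤ 2 := by
  obtain ⟨h1, h2, h3, h4, h5⟩ := norm_ratioLin_sub ht j
  unfold ratioLin
  simp only [norm_mul, norm_pow]
  have k := fun {x : ℂ} {R : ℝ} (h : ‖x‖ ≤ R) (i : ℕ) =>
    pow_le_pow_left₀ (norm_nonneg x) h i
  refine (mul_le_mul (mul_le_mul (mul_le_mul (mul_le_mul (k (norm_one_sub_le h1) 3)
    (k (norm_one_sub_le h2) 2) (by positivity) (by norm_num)) (k (norm_one_sub_le h3) 2)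
    (by positivity) (by norm_num)) (k (norm_inv_one_sub_le h4 (by norm_num)) 3)
    (by positivity) (by norm_num)) (k (norm_inv_one_sub_le h5 (by norm_num)) 2)
    (by positivity) (by norm_num)).trans (by norm_num)

theorem differentiableAt_inv_one_sub_mul {t α : ℂ} (h : 1 - t * α ≠ 0) :
    DifferentiableAt ℂ (fun t => (1 - t * α)⁻¹) t :=
  DifferentiableAt.inv (by fun_prop) h

theorem differentiableOn_ratioLin (j : ℕ) :
    DifferentiableOn ℂ (ratioLin j) (Metric.ball 0 (1 / 100)) := by
  intro t ht
  obtain ⟨-, -, -, h4, h5⟩ := norm_ratioLin_sub ht j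
  have h4 := one_sub_ne_zero h4 (by norm_num)
  have h5 := one_sub_ne_zero h5 (by norm_num)
  unfold ratioLin
  refine DifferentiableAt.differentiableWithinAt ?_
  exact DifferentiableAt.mul (DifferentiableAt.mul (by fun_prop)
    ((differentiableAt_inv_one_sub_mul h4).pow 3)) ((differentiableAt_inv_one_sub_mul h5).pow 2)

theorem ratioLin_zero (j : ℕ) : ratioLin j 0 = 1 := by simp [ratioLin]

theorem hasDerivAt_ratioLin (j : ℕ) : HasDerivAt (ratioLin j)
    (7 * (1 / 2 + (j : ℂ))⁻¹ - 7 * (1 + (j : ℂ))⁻¹) 0 := by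
  have h := (((((hasDerivAt_one_sub_mul (-(1 / 2 + (j : ℂ))⁻¹)).pow 3).mul
    ((hasDerivAt_one_sub_mul (1 / 2 + (j : ℂ))⁻¹).pow 2)).mul
    ((hasDerivAt_one_sub_mul (-3 * (1 / 2 + (j : ℂ))⁻¹)).pow 2)).mul
    (((hasDerivAt_one_sub_mul (-(1 + (j : ℂ))⁻¹)).inv (by simp)).pow 3)).mul
    (((hasDerivAt_one_sub_mul (-2 * (1 + (j : ℂ))⁻¹)).inv (by simp)).pow 2)
  refine HasDerivAt.congr_deriv h ?_
  simp
  ring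

theorem sum_ratioLin_deriv (n : ℕ) : ∑ j ∈ Finset.range n, (7 * (1 / 2 + (j : ℂ))⁻¹
    - 7 * (1 + (j : ℂ))⁻¹) = ((14 * (H 1 (2 * n) - H 1 n) : ℝ) : ℂ) := by
  have h : ∑ j ∈ Finset.range n, (7 * (((j : ℝ) + 1 / 2) ^ 1)⁻¹ - 7 * (((j : ℝ) + 1) ^ 1)⁻¹)
      = 14 * (H 1 (2 * n) - H 1 n) := by
    rw [Finset.sum_sub_distrib, ← Finset.mul_sum, ← Finset.mul_sum, sum_odd_eq_H, sum_nat_eq_H]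
    ring
  rw [← h]
  push_cast
  simp only [add_comm, pow_one]

theorem polyLin_zero (n : ℕ) : polyLin n 0 = (p n : ℝ) := by
  have : 2 * (0 : ℂ) + 2 * n + 1 ≠ 0 := by
    rw [mul_zero, zero_add]
    exact_mod_cast (by omega : 2 * n + 1 ≠ 0)
  unfold polyLin p
  push_cast
  rw [← div_eq_mul_inv, div_eq_iff this]
  ring

theorem small_line {t : ℂ} (ht : t ∈ Metric.ball (0 : ℂ) (1 / 100)) : Small t 0 0 t := by
  rw [mem_ball_zero_iff] at ht
  exact ⟨ht, by simp, by simp, ht⟩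

theorem norm_inv_line_le {t : ℂ} (ht : t ∈ Metric.ball (0 : ℂ) (1 / 100)) (n : ℕ) :
    ‖(2 * t + 2 * n + 1)⁻¹‖ ≤ 2 := by
  simpa using (small_line ht).norm_inv_two_abc_le n

theorem line_ne_zero {t : ℂ} (ht : t ∈ Metric.ball (0 : ℂ) (1 / 100)) (n : ℕ) :
    2 * t + 2 * n + 1 ≠ 0 := by
  have h := add_natCast_ne_zero (small_line ht).re_pos_two_abc (2 * n)
  intro h0
  refine h ?_
  push_cast
  linear_combination h0

theorem norm_polyLin_le (n : ℕ) {t : ℂ} (ht : t ∈ Metric.ball (0 : ℂ) (1 / 100)) :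
    ‖polyLin n t‖ ≤ 2000 * (n + 1) ^ 4 := by
  have h2 := norm_inv_line_le ht n
  have hs := (small_line ht).norm_add_nat_le n
  rw [mem_ball_zero_iff] at ht
  have h3 : ‖t‖ ^ 2 ≤ 1 / 100 := by nlinarith [norm_nonneg t]
  unfold polyLin
  rw [norm_mul]
  have h1 := norm_quartic_le (s := t + n) (N := n + 1) (by simp) hs 336 320 (104 - 192 * t ^ 2)
    (16 - 128 * t ^ 2) (1 - 16 * t ^ 2)
  have e2 := norm_sub_le 104 (192 * t ^ 2)
  have e1 := norm_sub_le 16 (128 * t ^ 2)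
  have e0 := norm_sub_le 1 (16 * t ^ 2)
  simp only [norm_mul, norm_pow, norm_one, Complex.norm_ofNat] at e0 e1 e2 h1
  refine (mul_le_mul h1 h2 (norm_nonneg _) (by positivity)).trans ?_
  have h4 : (0 : ℝ) ≤ ((n : ℝ) + 1) ^ 4 := by positivity
  nlinarith

theorem differentiableOn_polyLin (n : ℕ) :
    DifferentiableOn ℂ (polyLin n) (Metric.ball 0 (1 / 100)) := by
  intro t ht
  have h := line_ne_zero ht n
  unfold polyLin
  refine DifferentiableAt.differentiableWithinAt ?_
  exact DifferentiableAt.mul (by fun_prop) (DifferentiableAt.inv (by fun_prop) h)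

theorem hasDerivAt_polyLin (n : ℕ) :
    HasDerivAt (polyLin n) (2 * (252 * (n : ℂ) ^ 2 + 76 * n + 7)) 0 := by
  have h0 := line_ne_zero (t := 0) (Metric.mem_ball_self (by norm_num)) n
  have h0' : 2 * (n : ℂ) + 1 ≠ 0 := by simpa using h0
  have i := hasDerivAt_id (0 : ℂ)
  have s := i.add_const (n : ℂ)
  have h := ((((((s.pow 4).const_mul 336).add ((s.pow 3).const_mul 320)).add
    ((((i.pow 2).const_mul 192).const_sub 104).mul (s.pow 2))).add
    ((((i.pow 2).const_mul 128).const_sub 16).mul s)).add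
    (((i.pow 2).const_mul 16).const_sub 1)).mul
    (((i.const_mul 2).add_const (2 * (n : ℂ))).add_const 1 |>.inv h0)
  refine HasDerivAt.congr_deriv h ?_
  have key : ∀ A B y : ℂ, y ≠ 0 → A * y⁻¹ + B * (-2 / y ^ 2) = (A * y - 2 * B) / y ^ 2 := by
    intro A B y hy
    field_simp
    ring
  simp
  rw [key _ _ _ h0', div_eq_iff (pow_ne_zero 2 h0')]
  ring

theorem term_line {t : ℂ} (ht : t ∈ Metric.ball (0 : ℂ) (1 / 100)) (n : ℕ) : term t 0 0 t n
      = coeff n * ((∏ j ∈ Finset.range n, ratioLin j t) * polyLin n t) := by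
  have hw : ∀ j, weightRatio t 0 0 t j
      = 1 / 64 * (((j : ℂ) + 1 / 2) / (j + 1)) ^ 7 * ratioLin j t := by
    intro j
    have ht' := ht
    rw [mem_ball_zero_iff] at ht'
    have p1 := natCast_add_norm_lt (z := t) (by linarith) j
    have p2 := natCast_add_norm_lt (z := 2 * t) (by
      rw [norm_mul, Complex.norm_ofNat]; linarith) j
    have p3 := add_natCast_ne_zero (x := 1 / 2) (by norm_num) j
    have p4 := add_natCast_ne_zero (x := 1) (by norm_num) j
    unfold weightRatio pochRatio ratioLin
    have key : ∀ {x : ℂ}, x ≠ 0 → ∀ y : ℂ, 1 - t * (y * x⁻¹) = (x - y * t) * x⁻¹ := by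
      intro x hx y
      field_simp
    rw [neg_eq_neg_one_mul (1 / 2 + (j : ℂ))⁻¹, neg_eq_neg_one_mul (1 + (j : ℂ))⁻¹,
      ← one_mul ((1 / 2 + (j : ℂ))⁻¹)]
    simp only [one_mul]
    rw [key p3, key p3, key p4, key p4, show 1 - t * (1 / 2 + (j : ℂ))⁻¹
        = (1 / 2 + j - t) * (1 / 2 + (j : ℂ))⁻¹ by have := key p3 1; rwa [one_mul, one_mul] at this,
      show 1 / 2 + (j : ℂ) - -1 * t = 1 / 2 + j + t by ring,
      show 1 / 2 + (j : ℂ) - -3 * t = 1 / 2 + j + 3 * t by ring,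
      show 1 + (j : ℂ) - -1 * t = 1 + j + t by ring,
      show 1 + (j : ℂ) - -2 * t = 1 + j + 2 * t by ring,
      show t + 0 + 1 + (j : ℂ) = 1 + j + t by ring,
      show (2 * t + 0 + 0 + 1) / 2 + (j : ℂ) = 1 / 2 + j + t by ring,
      show (2 * t + 0 + 0 + 2) / 2 + (j : ℂ) = 1 + j + t by ring,
      show t - t + 1 + (j : ℂ) = 1 + j by ring, show t + t + 1 + (j : ℂ) = 1 + j + 2 * t by ring,
      show t + 0 + 0 - t + 1 + (j : ℂ) = 1 + j by ring,
      show t + 0 + 0 + t + 1 + (j : ℂ) = 1 + j + 2 * t by ring,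
      show (j : ℂ) + 1 = 1 + j by ring, show (j : ℂ) + 1 / 2 = 1 / 2 + j by ring,
      show t - 0 + 1 / 2 + (j : ℂ) = 1 / 2 + j + t by ring,
      show t + 2 * 0 + 0 + 1 / 2 + (j : ℂ) = 1 / 2 + j + t by ring,
      show t + 0 + 2 * 0 + 1 / 2 + (j : ℂ) = 1 / 2 + j + t by ring,
      show t + 0 - 2 * t + 1 / 2 + (j : ℂ) = 1 / 2 + j - t by ring,
      show t + 0 + 2 * t + 1 / 2 + (j : ℂ) = 1 / 2 + j + 3 * t by ring]
    have p5 : 1 / 2 + (j : ℂ) + t ≠ 0 := by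
      have := add_natCast_ne_zero (x := 1 / 2 + t) (by
        have := add_re_pos_of_norm_lt (z := t) (x := 1 / 2) (by linarith)
        rw [add_comm] at this
        simpa using this) j
      rwa [add_right_comm] at this
    generalize 1 / 2 + (j : ℂ) + t = x1 at *
    generalize 1 / 2 + (j : ℂ) - t = x2 at *
    generalize 1 / 2 + (j : ℂ) + 3 * t = x7 at *
    generalize 1 / 2 + (j : ℂ) = x3 at *
    generalize 1 + (j : ℂ) + t = x4 at *
    generalize 1 + (j : ℂ) + 2 * t = x5 at *
    generalize 1 + (j : ℂ) = x6 at *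
    field_simp
    ring
  unfold term
  rw [weight_eq_prod hw]
  unfold P polyLin
  rw [show 2 * t + 0 + 0 + 2 * n + 1 = 2 * t + 2 * (n : ℂ) + 1 by ring]
  generalize (2 * t + 2 * (n : ℂ) + 1)⁻¹ = y
  ring

/-- The reciprocal of the Gamma factor on the line `(t, 0, 0, t)`. -/
def lineFactor (t : ℂ) : ℂ :=
  2 ^ (4 * t) * (Complex.Gamma (t + 1) ^ 2 * Complex.Gamma (2 * t + 1) ^ 3)
    * (Complex.Gamma (t + 1 / 2) ^ 2 * Complex.Gamma (3 * t + 1 / 2) ^ 2)⁻¹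

theorem inv_gammaQuot_line {t : ℂ} (ht : t ∈ Metric.ball (0 : ℂ) (1 / 100)) :
    (gammaQuot t 0 0 t)⁻¹ = lineFactor t := by
  have h := small_line ht
  have hX := Complex.Gamma_ne_zero_of_re_pos h.admissible.h₃
  unfold gammaQuot gammaNum lineFactor
  rw [show -2 * (2 * t + 0 + 0) = -(4 * t) by ring, Complex.cpow_neg,
    show t + 2 * 0 + 0 + 1 / 2 = t + 1 / 2 by ring, show t + 0 + 2 * 0 + 1 / 2 = t + 1 / 2 by ring,
    show t - 0 + 1 / 2 = t + 1 / 2 by ring, show t + 0 + 2 * t + 1 / 2 = 3 * t + 1 / 2 by ring,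
    show t + 0 + 1 = t + 1 by ring, show 2 * t + 0 + 0 + 1 = 2 * t + 1 by ring,
    show t + t + 1 = 2 * t + 1 by ring, show t + 0 + 0 + t + 1 = 2 * t + 1 by ring,
    show t - t + 1 = 1 by ring, show t + 0 + 0 - t + 1 = 1 by ring,
    show -t - 0 + 2 * t + 1 / 2 = t + 1 / 2 by ring, Complex.Gamma_one]
  rw [sub_zero] at hX
  generalize Complex.Gamma (t + 1 / 2) = X at *
  generalize Complex.Gamma (3 * t + 1 / 2) = Y at *
  simp only [mul_inv, inv_inv, inv_one]
  field_simp

theorem hasSum_line {t : ℂ} (ht : t ∈ Metric.ball (0 : ℂ) (1 / 100)) :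
    HasSum (fun n => (coeff n : ℂ) * ((∏ j ∈ Finset.range n, ratioLin j t) * polyLin n t))
      (32 / Real.pi * lineFactor t) := by
  rw [← funext (term_line ht), ← inv_gammaQuot_line ht, ← div_eq_mul_inv, div_div]
  exact (small_line ht).hasSum_term

/-- The value at `0` is `1/π²` and the logarithmic derivative is `4 log 2 + 8(ψ(1) - ψ(1/2)) = 20
log 2`; Euler's constant cancels. -/
theorem hasDerivAt_lineFactor :
    HasDerivAt lineFactor (20 * Real.log 2 / (Real.pi : ℂ) ^ 2) 0 := by
  have i := hasDerivAt_id (0 : ℂ)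
  have aff : ∀ x y : ℂ, HasDerivAt (fun t : ℂ => x * t + y) x 0 := fun x y => by
    simpa using (i.const_mul x).add_const y
  have comp : ∀ {x y z : ℂ}, HasDerivAt Complex.Gamma z y →
      HasDerivAt (fun t : ℂ => Complex.Gamma (x * t + y)) (z * x) 0 := by
    intro x y z h
    have h' : HasDerivAt Complex.Gamma z (x * 0 + y) := by rwa [mul_zero, zero_add]
    exact h'.comp 0 (aff x y)
  have hG : (Real.sqrt Real.pi : ℂ) = Complex.Gamma (1 / 2) := by
    rw [← Real.Gamma_one_half_eq, ← Complex.Gamma_ofReal]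
    norm_num
  have hhalf := Complex.hasDerivAt_Gamma_one_half
  rw [hG] at hhalf
  have hG0 : Complex.Gamma (1 / 2) ≠ 0 := Complex.Gamma_ne_zero_of_re_pos (by norm_num)
  have hG0' : Complex.Gamma 2⁻¹ ≠ 0 := by rwa [← one_div]
  have g1 := comp (x := 1) Complex.hasDerivAt_Gamma_one
  have g2 := comp (x := 2) Complex.hasDerivAt_Gamma_one
  have g3 := comp (x := 1) hhalf
  have g4 := comp (x := 3) hhalf
  have e := (aff 4 0).const_cpow (c := 2) (Or.inl two_ne_zero)
  have h := (e.mul ((g1.pow 2).mul (g2.pow 3))).mul (((g3.pow 2).mul (g4.pow 2)).inv (by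
    simp [hG0']))
  refine (h.congr_deriv ?_).congr_of_eventuallyEq (Eventually.of_forall fun t => ?_)
  · have hpi : (Real.pi : ℂ) = Complex.Gamma (1 / 2) ^ 2 := Gamma_one_half_sq.symm
    rw [hpi, Complex.ofReal_log (by norm_num)]
    simp
    generalize Complex.Gamma 2⁻¹ = g at *
    field_simp
    ring
  · simp [lineFactor]

theorem hasSum_coeff_H1 : HasSum (fun n : ℕ => coeff n *
    (7 * p n * (H 1 (2 * n) - H 1 n) + 252 * (n : ℝ) ^ 2 + 76 * n + 7))
    (320 * Real.log 2 / Real.pi ^ 3) := by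
  have hr : (0 : ℝ) < 1 / 100 := by norm_num
  obtain ⟨S', hS, hsum⟩ := hasSum_deriv_weighted hr differentiableOn_ratioLin
    (fun n w hw => norm_ratioLin_le n hw) ratioLin_zero hasDerivAt_ratioLin
    differentiableOn_polyLin (fun n w hw => norm_polyLin_le n hw) hasDerivAt_polyLin
  have hS2 := hasDerivAt_lineFactor.const_mul (32 / (Real.pi : ℂ))
  have hS' : S' = 32 / (Real.pi : ℂ) * (20 * Real.log 2 / (Real.pi : ℂ) ^ 2) := by
    refine (hS.congr_of_eventuallyEq ?_).unique hS2
    filter_upwards [Metric.ball_mem_nhds (0 : ℂ) hr] with t ht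
    exact (hasSum_line ht).tsum_eq.symm
  -- The derivatives at `0` come out as `14 (H_{2n} - H_n)` and `2 (252 n² + 76 n + 7)`, twice the
  -- stated terms.
  have hdiv := hsum.div_const 2
  rw [hS'] at hdiv
  refine hasSum_of_complex hdiv (fun n => ?_) ?_
  · rw [sum_ratioLin_deriv, polyLin_zero]
    push_cast
    ring
  · push_cast
    ring

end Seed9
end

/-! ### Assembly. -/

theorem mainTheorem10 :
    (∃ r : ℝ, 0 < r ∧ ∀ a b c d : ℂ, ‖a‖ < r → ‖b‖ < r → ‖c‖ < r → ‖d‖ < r →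
      a + b ≠ 0 → a - d ≠ 0 → a + b + c - d ≠ 0 →
        -- the limit
        (∀ n, Summable (fun k => Seed9.F a b c d n k)) ∧
        Filter.Tendsto (fun n => ∑' k, Seed9.F a b c d n k) Filter.atTop
          (nhds (Seed9.limitValue a b c d)) ∧
        (a + c ≠ 0 → 2 * a + b + c ≠ 0 →
          -- up to a factor independent of `n` and `k`, `F` is a specialization of `Seed9`
          (∀ n k : ℕ, Seed9.F a b c d n k =
            -(Complex.exp (-(Real.pi * Complex.I * (-a + b + 1 / 2))) / 8) *
              Seed9.seed9 (1 - 2 * (a + n)) (-a + b - n + 1 / 2) (-a + c - n + 1 / 2)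
                (a + d + k + n)) ∧
          -- the WZ-pair `(F, G)`, with its boundary values
          (∃ G : ℕ → ℕ → ℂ,
            (∀ n k, Seed9.F a b c d (n + 1) k - Seed9.F a b c d n k = G n (k + 1) - G n k) ∧
            (∀ k, Seed9.F a b c d 0 k = Seed9.D a b c d * Seed9.A a b c d k) ∧
            (∀ n, G n 0 = Seed9.D a b c d * Seed9.C a b c d n) ∧
            (∀ n, Filter.Tendsto (fun k => G n k) Filter.atTop
              (nhds (Seed9.D a b c d * Seed9.B₁ a b c d * Seed9.B₂ a b c n)))) ∧
          -- the four-variable extension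
          Seed9.D a b c d ≠ 0 ∧
          Summable (fun k => Seed9.A a b c d k) ∧
          Summable (fun n => Seed9.B₂ a b c n) ∧
          Summable (fun n => Seed9.C a b c d n) ∧
          (∑' k, Seed9.A a b c d k) + Seed9.B₁ a b c d * (∑' n, Seed9.B₂ a b c n) =
            (∑' n, Seed9.C a b c d n) + 1 / Seed9.D a b c d * Seed9.limitValue a b c d)) ∧
    -- the specialization at the origin and the harmonic-number extensions
    HasSum (fun n : ℕ => Seed9.coeff n * Seed9.p n) (32 / Real.pi ^ 3) ∧
    HasSum (fun n : ℕ => Seed9.coeff n *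
        (7 * Seed9.p n * (Seed9.H 1 (2 * n) - Seed9.H 1 n)
          + 252 * (n : ℝ) ^ 2 + 76 * n + 7))
      (320 * Real.log 2 / Real.pi ^ 3) ∧
    HasSum (fun n : ℕ => Seed9.coeff n *
        (Seed9.p n * (16 * Seed9.H 2 (2 * n) - 5 * Seed9.H 2 n) + 48 * n + 8))
      (80 / (3 * Real.pi)) ∧
    HasSum (fun n : ℕ => Seed9.coeff n *
        (Seed9.p n * (128 * Seed9.H 4 (2 * n) - 7 * Seed9.H 4 n) + 64 / (2 * n + 1)))
      (976 * Real.pi / 45) := by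
  refine ⟨⟨1 / 100, by norm_num, fun a b c d ha hb hc hd hab had habcd => ?_⟩,
    Seed9.hasSum_coeff_mul_p, Seed9.hasSum_coeff_H1, Seed9.hasSum_coeff_H2,
    Seed9.hasSum_coeff_H4⟩
  have h : Seed9.Generic a b c d := ⟨⟨ha, hb, hc, hd⟩, hab, had, habcd⟩
  refine ⟨h.summable_F, h.tendsto_tsum_F, fun hac hs => ⟨h.F_eq_seed9 hs,
    ⟨Seed9.Generic.G a b c d, h.F_sub_F, h.F_zero_eq, h.G_zero hac hs, h.tendsto_G hac hs⟩,
    h.D_ne_zero hac hs, h.summable_A hac hs, h.summable_B₂, h.summable_C,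
    h.tsum_identity hac hs⟩⟩
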